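/- Let $g\ge 0$ be a fixed integer. A connected graph is called complex if it contains at least two cycles, and a graph is called complex if all its components are complex. The core of a complex graph $Q$ is its largest subgraph of minimum degree at least two. The kernel of $Q$ is the multigraph (possibly with loops and multiple edges) whose vertices are the vertices of degree at least three of the core and which is obtained from the core by replacing every maximal path whose inner vertices all have degree two by a single edge. The deficiency of $Q$ is $\mathrm{d}(Q)=2m_K-3n_K$, where $n_K$ and $m_K$ are the numbers of vertices and edges of the kernel. For $n,l\in\mathbb N$ let $Q_g(n,n+l)$ be a graph chosen uniformly at random from all complex graphs with vertex set $\{1,\dots,n\}$ and exactly $n+l$ edges that are embeddable on $\mathbb S_g$, the closed orientable surface of genus $g$. Let $\varepsilon\colon\mathbb N\to\mathbb R$ be a function with $\varepsilon(n)\to 0$ as $n\to\infty$. Then there is a constant $c>0$, depending only on $g$ and $\varepsilon$, such that the following holds for all sequences $(n_k)$ and $(l_k)$ of non-negative integers with $n_k\to\infty$, $l_k\to\infty$ and $l_k\le\varepsilon(n_k)\,n_k$ for all large $k$. Write $Q_k=Q_g(n_k,n_k+l_k)$. (For all large $k$ the class from which $Q_k$ is chosen is non-empty.) 1. For every $\delta>0$,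 with probability tending to $1$ as $k\to\infty$, the number $n_C$ of vertices of the core of $Q_k$ satisfies $|n_C-\sqrt{3n_kl_k}|\le\delta\sqrt{3n_kl_k}$. 2. If $l_k=o(n_k^{1/3})$, then $\mathrm{d}(Q_k)=0$ with probability tending to $1$. 3. If $l_k=\Theta(n_k^{1/3})$, then $\mathrm{d}(Q_k)=O_p(1)$, i.e. for every $\eta>0$ there is $C>0$ such that $|\mathrm{d}(Q_k)|\le C$ with probability at least $1-\eta$ for all large $k$. 4. If $l_k=\omega(n_k^{1/3})$, then $|\mathrm{d}(Q_k)|\le c\sqrt{l_k^3/n_k}$ with probability tending to $1$. -/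

import Mathlib

open Filter Topology Asymptotics

/-! ### Closed orientable surfaces and graphs drawn on them -/

/-- A cellular decomposition of a closed connected oriented surface, given by its darts (oriented
edges). `next d` is the dart that follows `d` in the positive cyclic order of the darts leaving the
tail of `d`, and `rev d` is `d` with the opposite orientation. The vertices, edges and faces of the
decomposition are the cycles of `next`, of `rev` and of `next * rev`, respectively: having traversed
a dart `d`, the boundary walk of a face leaves the head of `d` through the dart next to `rev d`. -/
structure SurfaceMap (D : Type) where
  next : Equiv.Perm D
  rev : Equiv.Perm D
  rev_rev : ∀ d, rev (rev d) = d
  rev_ne : ∀ d, rev d ≠ d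
  /-- The surface is connected. -/
  connected : ∀ d e : D, ∃ w ∈ Subgroup.closure {next, rev}, w d = e

namespace SurfaceMap

variable {D : Type} (M : SurfaceMap D)

/-- The vertices of the decomposition. -/
def Vertex : Type := Quotient (Equiv.Perm.SameCycle.setoid M.next)

/-- The edges of the decomposition. -/
def Edge : Type := Quotient (Equiv.Perm.SameCycle.setoid M.rev)

/-- The faces of the decomposition. -/
def Face : Type := Quotient (Equiv.Perm.SameCycle.setoid (M.next * M.rev))

/-- The vertex that the dart `d` leaves. -/
def tail (d : D) : M.Vertex := Quotient.mk (Equiv.Perm.SameCycle.setoid M.next) d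

/-- The vertex at which the dart `d` arrives. -/
def head (d : D) : M.Vertex := M.tail (M.rev d)

/-- The decomposed surface is the closed orientable surface of genus `g`, i.e. its Euler
characteristic is `2 - 2g`. -/
def HasGenus (g : ℕ) : Prop :=
  (Nat.card M.Vertex : ℤ) - Nat.card M.Edge + Nat.card M.Face = 2 - 2 * (g : ℤ)

/-- `G` is drawn without crossings in the decomposed surface, along the decomposition: distinct
vertices of `G` are placed at distinct vertices, and every edge of `G` is drawn as an edge of the
decomposition. (The drawing need not be cellular and `G` need not be connected: the decomposition
may have vertices and edges that are not in the drawing.) -/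
def Draws {V : Type*} (G : SimpleGraph V) : Prop :=
  ∃ f : V → M.Vertex, Function.Injective f ∧
    ∀ u v, G.Adj u v → ∃ d : D, M.tail d = f u ∧ M.head d = f v

end SurfaceMap

/-! ### Complex graphs, cores and kernels -/

namespace SimpleGraph

variable {V : Type*} (G : SimpleGraph V)

/-- `G` is embeddable on the closed orientable surface of genus `g`: it can be drawn on it without
crossings, as a part of the `1`-skeleton of some cellular decomposition of that surface. -/
def EmbeddableOnSurface (g : ℕ) : Prop :=
  ∃ (D : Type) (_ : Finite D) (_ : Nonempty D) (M : SurfaceMap D), M.HasGenus g ∧ M.Draws G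

variable {G} in
/-- A component is complex if it contains at least two cycles. -/
def ConnectedComponent.IsComplex (c : G.ConnectedComponent) : Prop :=
  ∃ (u v : V) (p : G.Walk u u) (q : G.Walk v v), u ∈ c.supp ∧ v ∈ c.supp ∧
    p.IsCycle ∧ q.IsCycle ∧ {e | e ∈ p.edges} ≠ {e | e ∈ q.edges}

/-- A graph is complex if all its components are complex. -/
def IsComplex : Prop := ∀ c : G.ConnectedComponent, c.IsComplex

/-- The complex part of `G`: the union of its complex components. -/
def complexPart : G.Subgraph :=
  (⊤ : G.Subgraph).induce {v | (G.connectedComponentMk v).IsComplex}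

/-- The core of `G`: the largest subgraph of the complex part with minimum degree at least two
(a union of such subgraphs is again one). -/
noncomputable def core : G.Subgraph :=
  sSup {H : G.Subgraph | H ≤ G.complexPart ∧ ∀ v ∈ H.verts, 2 ≤ (H.neighborSet v).ncard}

/-- The number of vertices of the core. -/
noncomputable def coreOrder : ℕ := G.core.verts.ncard

/-- The vertices of the kernel of `G`: the vertices of degree at least three in the core. -/
def kernelVerts : Set V := {v ∈ G.core.verts | 3 ≤ (G.core.neighborSet v).ncard}

/-- The graph on the edges of the core in which two edges are joined if they meet in a vertex of
degree two. The maximal paths of the core whose inner vertices have degree two are its connected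
components. -/
def threadGraph : SimpleGraph G.core.edgeSet where
  Adj e f := e ≠ f ∧ ∃ v, v ∈ e.1 ∧ v ∈ f.1 ∧ (G.core.neighborSet v).ncard = 2
  symm := ⟨fun _ _ ⟨h, v, he, hf, hv⟩ => ⟨h.symm, v, hf, he, hv⟩⟩
  loopless := ⟨fun _ h => h.1 rfl⟩

/-- The edges of the kernel of `G` (a multigraph on `G.kernelVerts`): every maximal path of the core
whose inner vertices have degree two is replaced by a single edge. -/
def KernelEdge : Type _ := G.threadGraph.ConnectedComponent

/-- The deficiency of `G`: twice the number of edges minus three times the number of vertices of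
its kernel. -/
noncomputable def deficiency : ℤ := 2 * (Nat.card G.KernelEdge : ℤ) - 3 * (G.kernelVerts.ncard : ℤ)

end SimpleGraph

/-! ### Random complex graphs on a surface -/

/-- The class of complex graphs with vertex set `Fin n` and `m` edges that are embeddable on the
closed orientable surface of genus `g`. -/
def complexClass (g n m : ℕ) : Set (SimpleGraph (Fin n)) :=
  {G | G.IsComplex ∧ G.EmbeddableOnSurface g ∧ G.edgeSet.ncard = m}

/-- The probability that a graph chosen uniformly at random from `complexClass g n m` has the
property `P` (it is `0` for every `P` if the class is empty). -/
noncomputable def complexProb (g n m : ℕ) (P : SimpleGraph (Fin n) → Prop) : ℝ :=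
  ({G ∈ complexClass g n m | P G}.ncard : ℝ) / ((complexClass g n m).ncard : ℝ)

/-! Write S = √(3nl), let s be the number of core vertices, q the number of kernel vertices and d
the deficiency. Everything follows from two estimates for a uniform graph of the class: s lies
outside (1 ± δ)S with probability at most 4 exp(324 l²/S - δ²l/8) (`ncard_coreOrder_tail`), and the
mean of y^d is at most 2 exp(12(9 + 18y) l²/S) for each fixed y ≥ 0 (`sum_pow_deficiency_le`). Here
l/S → 0, and l²/S is at most μ = √(l³/n). If μ → 0, Markov's inequality bounds P(d ≠ 0) by about 2/y
with y as large as desired; with y = e it bounds P(d > D) by 2 exp(Aμ - D), which settles bounded μ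
and μ → ∞.

Both estimates come from counting. A complex graph is a core with a forest rooted at its vertices
(`ncard_complexClass`). Rooted forests obey a recursion in the number of roots
(`ncard_parentMaps_succ`). The kernel has l + q edges, so d = 2l - q (`deficiency_eq`).

For cores the number of cubic kernels on the surface is unknown, and it is not needed: all bounds
contain the same positive factor `fatWeight g l (2 * l)`, which cancels in probabilities. A core is
called fat if each kernel edge is subdivided at least twice. Fat cores of every size are counted
exactly by stars and bars in terms of the smallest ones (`fatCount_eq_choose`). Arbitrary cores
become fat by subdividing next to all kernel vertices (`coreCount_le_fatCount`). Splitting a kernel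
vertex of degree at least four lowers the deficiency by one, and reversing this costs a factor of at
most 18l/d (`fatWeight_sub_le`). Summed over d against y^d these costs form a binomial expansion of
(s + l + 18ly)^(3l-1) (`sum_coreCount_le`), whereas deficiency zero alone contributes at least (s -
8l)^(3l-1) (`le_coreCount`). For s near S the two powers differ by a factor exp(O(l²/S)).

The weight of s in such sums changes from s to s + 1 by a factor of about exp(3l/s - s/n), so it
peaks at s = S (`sum_coreWeight_tail`).

That the operations respect the surface is checked on rotation systems: splitting a vertex,
attaching a pendant edge and contracting an edge keep the Euler characteristic, because a product
with a transposition merges or cuts cycles of a permutation (`cycleCount_mul_swap`). -/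

set_option linter.unusedSectionVars false
set_option linter.unusedSimpArgs false

/-! ### Counting the cycles of a permutation -/

namespace Equiv.Perm

variable {D : Type*}

/-- The number of cycles of a permutation, fixed points included. -/
noncomputable def cycleCount (σ : Perm D) : ℕ := Nat.card (Quotient (SameCycle.setoid σ))

/-- `SameCycle` is the smallest equivalence relation that joins each point to its image, so
invariants of cycles need to be checked on single steps only. -/
lemma SameCycle.rel_of_step {σ : Perm D} {r : D → D → Prop} (hr : Equivalence r)
    (h : ∀ x, r x (σ x)) {x y : D} (hxy : SameCycle σ x y) : r x y := by
  obtain ⟨i, rfl⟩ := hxy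
  induction i using Int.induction_on with
  | zero => exact hr.refl x
  | succ i ih =>
    have : (σ ^ ((i : ℤ) + 1)) x = σ ((σ ^ (i : ℤ)) x) := by
      rw [add_comm, zpow_add, zpow_one, mul_apply]
    rw [this]
    exact hr.trans ih (h _)
  | pred i ih =>
    have : σ ((σ ^ (-(i : ℤ) - 1)) x) = (σ ^ (-(i : ℤ))) x := by
      rw [← mul_apply, ← zpow_one_add]
      congr 2
      ring
    have h' := h ((σ ^ (-(i : ℤ) - 1)) x)
    rw [this] at h'
    exact hr.trans ih (hr.symm h')

lemma SameCycle.step (σ : Perm D) (x : D) : SameCycle σ x (σ x) := ⟨1, by simp⟩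

variable [DecidableEq D]

/-! ### Merging two cycles by a transposition. -/

section Merge

variable {σ : Perm D} {a b : D}

lemma mul_swap_apply_left (σ : Perm D) (a b : D) : (σ * swap a b) a = σ b := by simp

lemma mul_swap_apply_right (σ : Perm D) (a b : D) : (σ * swap a b) b = σ a := by simp

lemma mul_swap_apply_of_ne {x : D} (ha : x ≠ a) (hb : x ≠ b) : (σ * swap a b) x = σ x := by
  simp [swap_apply_of_ne_of_ne ha hb]

/-- The new permutation sends `a` to `σ b` and then follows the old cycle of `b`, which avoids `a`,
until it reaches `b`. -/
lemma sameCycle_mul_swap_self [Finite D] (h : ¬ SameCycle σ a b) :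
    SameCycle (σ * swap a b) a b := by
  have key : ∀ j : ℕ, SameCycle (σ * swap a b) a b ∨
      SameCycle (σ * swap a b) a ((σ ^ j) (σ b)) := by
    intro j
    induction j with
    | zero =>
      right
      have := SameCycle.step (σ * swap a b) a
      rwa [mul_swap_apply_left] at this
    | succ j ih =>
      rcases ih with ih | ih
      · exact Or.inl ih
      by_cases hb : (σ ^ j) (σ b) = b
      · rw [hb] at ih; exact Or.inl ih
      have ha : (σ ^ j) (σ b) ≠ a := by
        rintro ha
        apply h
        refine SameCycle.symm ⟨(j : ℤ) + 1, ?_⟩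
        rw [zpow_add, zpow_one, mul_apply]
        exact_mod_cast ha
      right
      have := SameCycle.step (σ * swap a b) ((σ ^ j) (σ b))
      rw [mul_swap_apply_of_ne ha hb] at this
      rw [pow_succ', mul_apply]
      exact ih.trans this
  obtain ⟨j, hj⟩ := (sameCycle_apply_left.2 (SameCycle.refl σ b)).exists_nat_pow_eq
  rcases key j with h | h
  · exact h
  · rwa [hj] at h

lemma sameCycle_mul_swap_iff [Finite D] (h : ¬ SameCycle σ a b) {x y : D} :
    SameCycle (σ * swap a b) x y ↔ SameCycle σ x y ∨
      ((SameCycle σ a x ∨ SameCycle σ b x) ∧ (SameCycle σ a y ∨ SameCycle σ b y)) := by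
  have hab := sameCycle_mul_swap_self h
  constructor
  · intro hxy
    refine SameCycle.rel_of_step (r := fun x y => SameCycle σ x y ∨
      ((SameCycle σ a x ∨ SameCycle σ b x) ∧ (SameCycle σ a y ∨ SameCycle σ b y))) ?_ ?_ hxy
    · refine ⟨fun x => Or.inl (SameCycle.refl _ _), ?_, ?_⟩
      · rintro x y (h | ⟨h1, h2⟩)
        · exact Or.inl h.symm
        · exact Or.inr ⟨h2, h1⟩
      · rintro x y z (h | ⟨h1, h2⟩) (h' | ⟨h1', h2'⟩)
        · exact Or.inl (h.trans h')
        · exact Or.inr ⟨h1'.imp (fun k => k.trans h.symm) (fun k => k.trans h.symm), h2'⟩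
        · exact Or.inr ⟨h1, h2.imp (fun k => k.trans h') (fun k => k.trans h')⟩
        · exact Or.inr ⟨h1, h2'⟩
    · intro x
      by_cases ha : x = a
      · subst ha
        right
        rw [mul_swap_apply_left]
        exact ⟨Or.inl (SameCycle.refl _ _), Or.inr (SameCycle.step _ _)⟩
      by_cases hb : x = b
      · subst hb
        right
        rw [mul_swap_apply_right]
        exact ⟨Or.inr (SameCycle.refl _ _), Or.inl (SameCycle.step _ _)⟩
      left
      rw [mul_swap_apply_of_ne ha hb]
      exact SameCycle.step _ _
  · have mono : ∀ {x y}, SameCycle σ x y → SameCycle (σ * swap a b) x y := by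
      intro x y hxy
      refine SameCycle.rel_of_step (SameCycle.equivalence _) ?_ hxy
      intro x
      by_cases ha : x = a
      · subst ha
        have := SameCycle.step (σ * swap x b) b
        rw [mul_swap_apply_right] at this
        exact hab.trans this
      by_cases hb : x = b
      · subst hb
        have := SameCycle.step (σ * swap a x) a
        rw [mul_swap_apply_left] at this
        exact hab.symm.trans this
      have := SameCycle.step (σ * swap a b) x
      rwa [mul_swap_apply_of_ne ha hb] at this
    rintro (h | ⟨h1, h2⟩)
    · exact mono h
    · have e1 : SameCycle (σ * swap a b) a x := h1.elim mono (fun k => hab.trans (mono k))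
      have e2 : SameCycle (σ * swap a b) a y := h2.elim mono (fun k => hab.trans (mono k))
      exact e1.symm.trans e2

lemma cycleCount_mul_swap [Finite D] (h : ¬ SameCycle σ a b) :
    cycleCount (σ * swap a b) + 1 = cycleCount σ := by
  classical
  -- The cycle of `b` is dropped and the cycle of `a` stands for the merged one, so the remaining
  -- old cycles correspond to the new cycles.
  let q : D → Quotient (SameCycle.setoid σ) := Quotient.mk _
  let f : {c : Quotient (SameCycle.setoid σ) // c ≠ q b} →
      Quotient (SameCycle.setoid (σ * swap a b)) := fun c =>
    Quotient.map' id (fun x y hxy => (sameCycle_mul_swap_iff h).2 (Or.inl hxy)) c.1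
  have hf : Function.Bijective f := by
    constructor
    · rintro ⟨c, hc⟩ ⟨d, hd⟩ hcd
      induction c using Quotient.inductionOn with | _ x => ?_
      induction d using Quotient.inductionOn with | _ y => ?_
      have hbx : ¬ SameCycle σ b x := fun k => hc (Quotient.sound k.symm)
      have hby : ¬ SameCycle σ b y := fun k => hd (Quotient.sound k.symm)
      have : SameCycle (σ * swap a b) x y := Quotient.exact hcd
      rw [sameCycle_mul_swap_iff h] at this
      apply Subtype.ext
      apply Quotient.sound
      show SameCycle σ x y
      rcases this with h | ⟨h1, h2⟩
      · exact h
      · exact (h1.resolve_right hbx).symm.trans (h2.resolve_right hby)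
    · intro c
      induction c using Quotient.inductionOn with | _ x => ?_
      by_cases hbx : SameCycle σ b x
      · refine ⟨⟨q a, fun k => h (Quotient.exact k)⟩, ?_⟩
        apply Quotient.sound
        show SameCycle (σ * swap a b) a x
        rw [sameCycle_mul_swap_iff h]
        exact Or.inr ⟨Or.inl (SameCycle.refl _ _), Or.inr hbx⟩
      · exact ⟨⟨q x, fun k => hbx (Quotient.exact k).symm⟩, rfl⟩
  have := Nat.card_congr (Equiv.ofBijective f hf)
  unfold cycleCount
  rw [← this]
  have : Fintype (Quotient (SameCycle.setoid σ)) := Fintype.ofFinite _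
  rw [Nat.card_eq_fintype_card, Nat.card_eq_fintype_card, Fintype.card_subtype_compl,
    Fintype.card_subtype_eq]
  have : 0 < Fintype.card (Quotient (SameCycle.setoid σ)) := Fintype.card_pos_iff.2 ⟨q b⟩
  omega

end Merge

/-! ### Cutting one cycle into two. -/

section Split

variable {σ : Perm D} {a b : D} {r : ℕ}

/-- If `b` is met after `r` steps from `a`, then cutting off the stretch from `σ a` to `b` leaves
no other point in the cycle of `b`. -/
lemma exists_pow_of_sameCycle_mul_swap [Finite D] (hab : a ≠ b) (hr : (σ ^ r) a = b)
    (hmin : ∀ j, 1 ≤ j → j < r → (σ ^ j) a ≠ b) {y : D} (hy : SameCycle (σ * swap a b) b y) :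
    ∃ j, 1 ≤ j ∧ j ≤ r ∧ y = (σ ^ j) a := by
  have hr1 : 1 ≤ r := by
    rcases Nat.eq_zero_or_pos r with h | h
    · subst h; exact absurd hr hab
    · exact h
  have hna : ∀ j, 1 ≤ j → j ≤ r → (σ ^ j) a ≠ a := by
    intro j h1 h2 h3
    rcases h2.lt_or_eq with h2 | h2
    · apply hmin (r - j) (by omega) (by omega)
      rw [← hr]
      conv_rhs => rw [show r = (r - j) + j by omega, pow_add, mul_apply, h3]
    · subst h2; exact hab (h3.symm.trans hr)
  obtain ⟨i, rfl⟩ := hy.exists_nat_pow_eq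
  clear hy
  induction i with
  | zero => exact ⟨r, hr1, le_rfl, by simp [hr]⟩
  | succ i ih =>
    obtain ⟨j, h1, h2, h3⟩ := ih
    rw [pow_succ', mul_apply, h3]
    rcases h2.lt_or_eq with h2 | h2
    · refine ⟨j + 1, by omega, by omega, ?_⟩
      rw [mul_swap_apply_of_ne (hna j h1 h2.le) (hmin j h1 h2), pow_succ', mul_apply]
    · subst h2
      refine ⟨1, le_rfl, hr1, ?_⟩
      rw [hr, mul_swap_apply_right, pow_one]

lemma exists_min_pow [Finite D] (h : SameCycle σ a b) :
    ∃ r, (σ ^ r) a = b ∧ ∀ j, 1 ≤ j → j < r → (σ ^ j) a ≠ b := by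
  classical
  have hex := h.exists_nat_pow_eq
  refine ⟨Nat.find hex, Nat.find_spec hex, fun j _ hj => Nat.find_min hex hj⟩

lemma not_sameCycle_mul_swap [Finite D] (hab : a ≠ b) (h : SameCycle σ a b) :
    ¬ SameCycle (σ * swap a b) a b := by
  obtain ⟨r, hr, hmin⟩ := exists_min_pow h
  intro hs
  obtain ⟨j, h1, h2, h3⟩ := exists_pow_of_sameCycle_mul_swap hab hr hmin hs.symm
  rcases h2.lt_or_eq with h2 | h2
  · apply hmin (r - j) (by omega) (by omega)
    rw [← hr]
    conv_rhs => rw [show r = (r - j) + j by omega, pow_add, mul_apply, ← h3]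
  · subst h2; exact hab (h3.trans hr)

/-- Multiplying by the transposition once more merges the two pieces again. -/
lemma cycleCount_mul_swap_of_sameCycle [Finite D] (hab : a ≠ b) (h : SameCycle σ a b) :
    cycleCount (σ * swap a b) = cycleCount σ + 1 := by
  have := cycleCount_mul_swap (not_sameCycle_mul_swap hab h)
  rw [mul_assoc, swap_mul_self, mul_one] at this
  exact this.symm

/-- How the cycles of `σ` arise from those of `σ * swap a b`, where `a` and `b` lie in one cycle. -/
lemma sameCycle_iff_mul_swap [Finite D] (hab : a ≠ b) (h : SameCycle σ a b) {x y : D} :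
    SameCycle σ x y ↔ SameCycle (σ * swap a b) x y ∨
      ((SameCycle (σ * swap a b) a x ∨ SameCycle (σ * swap a b) b x) ∧
        (SameCycle (σ * swap a b) a y ∨ SameCycle (σ * swap a b) b y)) := by
  have := sameCycle_mul_swap_iff (not_sameCycle_mul_swap hab h) (x := x) (y := y)
  rwa [mul_assoc, swap_mul_self, mul_one] at this

end Split

/-! ### Inserting a fixed point into a cycle. -/

section Insertion

variable {σ : Perm D} {a c : D}

omit [DecidableEq D] in
lemma SameCycle.eq_of_fixed (hc : σ c = c) {x : D} (h : SameCycle σ x c) : x = c :=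
  h.eq_of_right hc

lemma cycleCount_insert [Finite D] (hc : σ c = c) (hac : a ≠ c) :
    cycleCount (σ * swap a c) + 1 = cycleCount σ :=
  cycleCount_mul_swap (fun h => hac (h.eq_of_fixed hc))

lemma sameCycle_insert_iff [Finite D] (hc : σ c = c) (hac : a ≠ c) {x y : D} (hx : x ≠ c)
    (hy : y ≠ c) : SameCycle (σ * swap a c) x y ↔ SameCycle σ x y := by
  rw [sameCycle_mul_swap_iff (fun h => hac (h.eq_of_fixed hc))]
  constructor
  · rintro (h | ⟨h1, h2⟩)
    · exact h
    · have h1 := h1.resolve_right (fun k => hx (k.symm.eq_of_fixed hc))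
      have h2 := h2.resolve_right (fun k => hy (k.symm.eq_of_fixed hc))
      exact h1.symm.trans h2
  · exact Or.inl

lemma sameCycle_insert_self [Finite D] (hc : σ c = c) (hac : a ≠ c) :
    SameCycle (σ * swap a c) a c :=
  sameCycle_mul_swap_self (fun h => hac (h.eq_of_fixed hc))

end Insertion

omit [DecidableEq D] in
lemma optionCongr_zpow_some (σ : Perm D) (i : ℤ) (x : D) :
    ((optionCongr σ : Perm (Option D)) ^ i) (some x) = some ((σ ^ i) x) := by
  let φ : Perm D →* Perm (Option D) :=
    { toFun := fun τ => optionCongr τ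
      map_one' := by ext x; cases x <;> simp
      map_mul' := fun τ τ' => by ext x; cases x <;> simp }
  have h : (optionCongr σ : Perm (Option D)) ^ i = optionCongr (σ ^ i) :=
    (map_zpow φ σ i).symm
  rw [h]; simp

lemma sameCycle_optionCongr {σ : Perm D} {x y : D} :
    SameCycle (optionCongr σ : Perm (Option D)) (some x) (some y) ↔ SameCycle σ x y := by
  simp [SameCycle, optionCongr_zpow_some]

lemma cycleCount_optionCongr [Finite D] (σ : Perm D) :
    cycleCount (optionCongr σ : Perm (Option D)) = cycleCount σ + 1 := by
  let f : Option (Quotient (SameCycle.setoid σ)) →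
      Quotient (SameCycle.setoid (optionCongr σ : Perm (Option D))) := fun c =>
    c.elim (Quotient.mk _ none)
      (Quotient.map' some (fun x y hxy => sameCycle_optionCongr.2 hxy))
  have hnone : ∀ x : D, ¬ SameCycle (optionCongr σ : Perm (Option D)) none (some x) := by
    intro x h
    have := h.eq_of_left (by simp [Function.IsFixedPt])
    simp at this
  have hf : Function.Bijective f := by
    constructor
    · rintro (_ | c) (_ | d) h
      · rfl
      · induction d using Quotient.inductionOn with | _ x => ?_
        exact absurd (Quotient.exact h) (hnone x)
      · induction c using Quotient.inductionOn with | _ x => ?_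
        exact absurd (Quotient.exact h.symm) (hnone x)
      · induction c using Quotient.inductionOn with | _ x => ?_
        induction d using Quotient.inductionOn with | _ y => ?_
        exact congrArg some (Quotient.sound (sameCycle_optionCongr.1 (Quotient.exact h)))
    · intro c
      induction c using Quotient.inductionOn with | _ x => ?_
      cases x with
      | none => exact ⟨none, rfl⟩
      | some x => exact ⟨some (Quotient.mk _ x), rfl⟩
  unfold cycleCount
  rw [← Nat.card_congr (Equiv.ofBijective f hf), Finite.card_option]

omit [DecidableEq D] in
/-- Computing the number of cycles from an invariant that separates the cycles. -/
lemma cycleCount_eq_card {ι : Type*} (σ : Perm D) (c : D → ι)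
    (hs : Function.Surjective c) (hσ : ∀ x, c (σ x) = c x)
    (hc : ∀ x y, c x = c y → SameCycle σ x y) : cycleCount σ = Nat.card ι := by
  have hsc : ∀ x y, SameCycle σ x y → c x = c y := fun x y h =>
    SameCycle.rel_of_step (r := fun x y => c x = c y)
      ⟨fun _ => rfl, fun h => h.symm, fun h h' => h.trans h'⟩ (fun x => (hσ x).symm) h
  refine Nat.card_congr (Equiv.ofBijective (fun t => Quotient.liftOn' t c hsc) ⟨?_, ?_⟩)
  · intro s t h
    induction s using Quotient.inductionOn with | _ x => ?_
    induction t using Quotient.inductionOn with | _ y => ?_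
    exact Quotient.sound (hc x y h)
  · intro i
    obtain ⟨x, rfl⟩ := hs i
    exact ⟨Quotient.mk _ x, rfl⟩

end Equiv.Perm

/-! ### Local modifications of surface maps -/

namespace Equiv.Perm

variable {D : Type*} [DecidableEq D]

/-- Extension of a permutation by two fixed points. -/
abbrev addTwo (τ : Perm D) : Perm (Option (Option D)) := optionCongr (optionCongr τ)

/-- Insertion of the two new points behind `a` and behind `b`. -/
def insertTwo (τ : Perm D) (a b : D) : Perm (Option (Option D)) :=
  addTwo τ * swap (some (some a)) none * swap (some (some b)) (some none)

variable (τ : Perm D) (a b : D)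

lemma cycleCount_addTwo [Finite D] : cycleCount (addTwo τ) = cycleCount τ + 2 := by
  rw [cycleCount_optionCongr, cycleCount_optionCongr]

/-- The two additional fixed points raise the count by two, and each insertion merges one of them
into a cycle. -/
lemma cycleCount_insertTwo [Finite D] : cycleCount (insertTwo τ a b) = cycleCount τ := by
  have h1 := cycleCount_addTwo τ
  have h2 := cycleCount_insert (σ := addTwo τ) (a := some (some a)) (c := none)
    (by simp) (by simp)
  have h3 := cycleCount_insert (σ := addTwo τ * swap (some (some a)) none)
    (a := some (some b)) (c := some none) (by simp [swap_apply_def]) (by simp)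
  unfold insertTwo
  omega

lemma sameCycle_insertTwo [Finite D] {y z : D} :
    SameCycle (insertTwo τ a b) (some (some y)) (some (some z)) ↔ SameCycle τ y z := by
  unfold insertTwo
  rw [sameCycle_insert_iff (by simp [swap_apply_def]) (by simp) (by simp) (by simp),
    sameCycle_insert_iff (by simp) (by simp) (by simp) (by simp), sameCycle_optionCongr,
    sameCycle_optionCongr]

lemma sameCycle_insertTwo_none [Finite D] :
    SameCycle (insertTwo τ a b) (some (some a)) none := by
  unfold insertTwo
  rw [sameCycle_insert_iff (by simp [swap_apply_def]) (by simp) (by simp) (by simp)]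
  exact sameCycle_insert_self (by simp) (by simp)

lemma sameCycle_insertTwo_some_none [Finite D] :
    SameCycle (insertTwo τ a b) (some (some b)) (some none) := by
  unfold insertTwo
  exact sameCycle_insert_self (by simp [swap_apply_def]) (by simp)

end Equiv.Perm

namespace SurfaceMap

open Equiv Equiv.Perm

variable {D : Type} (M : SurfaceMap D)

lemma hasGenus_iff {g : ℕ} : M.HasGenus g ↔
    (cycleCount M.next : ℤ) - cycleCount M.rev + cycleCount (M.next * M.rev) = 2 - 2 * (g : ℤ) :=
  Iff.rfl

lemma tail_eq_iff {d e : D} : M.tail d = M.tail e ↔ SameCycle M.next d e :=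
  ⟨fun h => Quotient.exact h, fun h => Quotient.sound h⟩

lemma exists_tail (v : M.Vertex) : ∃ d, M.tail d = v := Quotient.exists_rep v

lemma head_rev (d : D) : M.head (M.rev d) = M.tail d := by
  unfold head; rw [M.rev_rev]

/-- The darts that can be reached from a dart by the two permutations. -/
def Linked {D : Type} (next rev : Perm D) (d e : D) : Prop :=
  ∃ w ∈ Subgroup.closure {next, rev}, w d = e

lemma linked_equivalence {D : Type} (next rev : Perm D) : Equivalence (Linked next rev) := by
  refine ⟨fun d => ⟨1, Subgroup.one_mem _, rfl⟩, ?_, ?_⟩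
  · rintro d e ⟨w, hw, rfl⟩
    exact ⟨w⁻¹, Subgroup.inv_mem _ hw, by simp⟩
  · rintro d e f ⟨w, hw, rfl⟩ ⟨w', hw', rfl⟩
    exact ⟨w' * w, Subgroup.mul_mem _ hw' hw, rfl⟩

lemma linked_of_sameCycle {D : Type} {next rev : Perm D} {d e : D} (h : SameCycle next d e) :
    Linked next rev d e :=
  SameCycle.rel_of_step (linked_equivalence next rev)
    (fun _ => ⟨next, Subgroup.subset_closure (by simp), rfl⟩) h

lemma linked_rev {D : Type} (next rev : Perm D) (d : D) : Linked next rev d (rev d) :=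
  ⟨rev, Subgroup.subset_closure (by simp), rfl⟩

/-- Used for all modified maps: it suffices that the old generators stay within linked classes and
that each new dart is linked to an old one. -/
lemma linked_of_map {D' : Type} {next rev : Perm D'} (ι : D → D')
    (h1 : ∀ y, Linked next rev (ι y) (ι (M.next y)))
    (h2 : ∀ y, Linked next rev (ι y) (ι (M.rev y)))
    (h3 : ∀ z, ∃ y, Linked next rev z (ι y)) (d e : D') : Linked next rev d e := by
  have hE := linked_equivalence next rev
  have key : ∀ w ∈ Subgroup.closure {M.next, M.rev}, ∀ y, Linked next rev (ι y) (ι (w y)) := by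
    intro w hw
    induction hw using Subgroup.closure_induction with
    | mem x hx =>
      rcases hx with rfl | rfl
      · exact h1
      · exact h2
    | one => exact fun y => hE.refl _
    | mul x y _ _ ihx ihy => exact fun z => hE.trans (ihy z) (ihx (y z))
    | inv x _ ih =>
      intro z
      have := ih (x⁻¹ z)
      rw [← mul_apply, mul_inv_cancel, one_apply] at this
      exact hE.symm this
  obtain ⟨y, hy⟩ := h3 d
  obtain ⟨z, hz⟩ := h3 e
  obtain ⟨w, hw, rfl⟩ := M.connected y z
  exact hE.trans hy (hE.trans (key w hw y) (hE.symm hz))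

variable [DecidableEq D]

/-- The orientation reversal on the darts of `M` and on the two darts of a new edge. -/
def revTwo : Perm (Option (Option D)) := addTwo M.rev * swap none (some none)

@[simp] lemma revTwo_some (d : D) : M.revTwo (some (some d)) = some (some (M.rev d)) := by
  simp [revTwo, swap_apply_def]

@[simp] lemma revTwo_none : M.revTwo none = some none := by simp [revTwo]

@[simp] lemma revTwo_some_none : M.revTwo (some none) = none := by simp [revTwo]

lemma revTwo_revTwo (d : Option (Option D)) : M.revTwo (M.revTwo d) = d := by
  rcases d with _ | _ | d <;> simp [M.rev_rev]

lemma revTwo_ne (d : Option (Option D)) : M.revTwo d ≠ d := by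
  rcases d with _ | _ | d <;> simp [M.rev_ne]

lemma cycleCount_revTwo [Finite D] : cycleCount M.revTwo = cycleCount M.rev + 1 := by
  have h1 := cycleCount_addTwo M.rev
  have h2 := cycleCount_insert (σ := addTwo M.rev) (a := none) (c := some none)
    (by simp) (by simp)
  unfold revTwo
  omega

variable {M} in
/-- Splitting of a vertex: the darts from the one behind `b` up to `a` go to a new vertex, which is
joined to the old one by a new edge. -/
def split [Finite D] {a b : D} (hab : a ≠ b) (h : SameCycle M.next a b) :
    SurfaceMap (Option (Option D)) where
  next := insertTwo (M.next * swap a b) a b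
  rev := M.revTwo
  rev_rev := M.revTwo_revTwo
  rev_ne := M.revTwo_ne
  connected := by
    set next' := insertTwo (M.next * swap a b) a b with hn
    have hE := linked_equivalence next' M.revTwo
    have e1 : Linked next' M.revTwo (some (some a)) none :=
      linked_of_sameCycle (sameCycle_insertTwo_none _ _ _)
    have e2 : Linked next' M.revTwo (some (some b)) (some none) :=
      linked_of_sameCycle (sameCycle_insertTwo_some_none _ _ _)
    have e3 : Linked next' M.revTwo none (some none) := by
      simpa using linked_rev next' M.revTwo none
    have e4 : Linked next' M.revTwo (some (some a)) (some (some b)) :=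
      hE.trans e1 (hE.trans e3 (hE.symm e2))
    have e5 : ∀ {y z}, SameCycle (M.next * swap a b) y z →
        Linked next' M.revTwo (some (some y)) (some (some z)) := fun h =>
      linked_of_sameCycle ((sameCycle_insertTwo _ _ _).2 h)
    refine M.linked_of_map (fun y => some (some y)) ?_ ?_ ?_
    · intro y
      -- A step of the old rotation may now lead from one half of the split vertex to the other; the
      -- new edge bridges the gap.
      rcases (sameCycle_iff_mul_swap hab h).1 (SameCycle.step M.next y) with k | ⟨k1, k2⟩
      · exact e5 k
      · have f : ∀ {z}, SameCycle (M.next * swap a b) a z ∨ SameCycle (M.next * swap a b) b z →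
            Linked next' M.revTwo (some (some a)) (some (some z)) := fun k =>
          k.elim e5 (fun k => hE.trans e4 (e5 k))
        exact hE.trans (hE.symm (f k1)) (f k2)
    · intro y
      simpa using linked_rev next' M.revTwo (some (some y))
    · rintro (_ | _ | y)
      · exact ⟨a, hE.symm e1⟩
      · exact ⟨b, hE.symm e2⟩
      · exact ⟨y, hE.refl _⟩

variable {M} in
-- There is one more vertex and one more edge. The face permutation is the old one with the two new
-- darts inserted behind `M.rev a` and `M.rev b`, so the number of faces is unchanged.
lemma split_hasGenus [Finite D] {a b : D} (hab : a ≠ b) (h : SameCycle M.next a b) {g : ℕ}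
    (hg : M.HasGenus g) : (split hab h).HasGenus g := by
  rw [hasGenus_iff] at hg ⊢
  have hφ : (split hab h).next * (split hab h).rev =
      insertTwo (M.next * M.rev) (M.rev a) (M.rev b) := by
    have hra : ∀ y, M.rev y = a ↔ y = M.rev a := fun y =>
      ⟨fun k => by rw [← k, M.rev_rev], fun k => by rw [k, M.rev_rev]⟩
    have hrb : ∀ y, M.rev y = b ↔ y = M.rev b := fun y =>
      ⟨fun k => by rw [← k, M.rev_rev], fun k => by rw [k, M.rev_rev]⟩
    have hne : M.rev a ≠ M.rev b := fun k => hab (M.rev.injective k)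
    refine Equiv.ext fun y => ?_
    rcases y with _ | _ | y
    · simp [split, insertTwo, swap_apply_def, hab, hab.symm, M.rev_rev]
    · simp [split, insertTwo, swap_apply_def, hab, hab.symm, M.rev_rev]
    · by_cases ha : y = M.rev a
      · subst ha
        simp [split, insertTwo, swap_apply_def, hab, hne, M.rev_rev]
      by_cases hb : y = M.rev b
      · subst hb
        simp [split, insertTwo, swap_apply_def, hab.symm, hne.symm, M.rev_rev]
      simp [split, insertTwo, swap_apply_def, ha, hb, hra, hrb]
  rw [hφ, cycleCount_insertTwo]
  have h1 : cycleCount (split hab h).next = cycleCount M.next + 1 := by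
    show cycleCount (insertTwo _ _ _) = _
    rw [cycleCount_insertTwo, cycleCount_mul_swap_of_sameCycle hab h]
  have h2 : cycleCount (split hab h).rev = cycleCount M.rev + 1 := M.cycleCount_revTwo
  rw [h1, h2]
  push_cast
  linarith

/-- Attaching a pendant edge behind the dart `p`. -/
def pendant [Finite D] (p : D) : SurfaceMap (Option (Option D)) where
  next := addTwo M.next * swap (some (some p)) (some none)
  rev := M.revTwo
  rev_rev := M.revTwo_revTwo
  rev_ne := M.revTwo_ne
  connected := by
    set next' := addTwo M.next * swap (some (some p)) (some none) with hn
    have hE := linked_equivalence next' M.revTwo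
    have e2 : Linked next' M.revTwo (some (some p)) (some none) :=
      linked_of_sameCycle (sameCycle_insert_self (by simp) (by simp))
    have e3 : Linked next' M.revTwo none (some none) := by
      simpa using linked_rev next' M.revTwo none
    refine M.linked_of_map (fun y => some (some y)) ?_ ?_ ?_
    · intro y
      apply linked_of_sameCycle
      rw [sameCycle_insert_iff (by simp) (by simp) (by simp) (by simp), sameCycle_optionCongr,
        sameCycle_optionCongr]
      exact SameCycle.step _ _
    · intro y
      simpa using linked_rev next' M.revTwo (some (some y))
    · rintro (_ | _ | y)
      · exact ⟨p, hE.trans e3 (hE.symm e2)⟩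
      · exact ⟨p, hE.symm e2⟩
      · exact ⟨y, hE.refl _⟩

lemma sameCycle_pendant_next [Finite D] {p y z : D} :
    SameCycle (M.pendant p).next (some (some y)) (some (some z)) ↔ SameCycle M.next y z := by
  show SameCycle (addTwo M.next * swap (some (some p)) (some none)) _ _ ↔ _
  rw [sameCycle_insert_iff (by simp) (by simp) (by simp) (by simp), sameCycle_optionCongr,
    sameCycle_optionCongr]

lemma sameCycle_pendant_next_self [Finite D] (p : D) :
    SameCycle (M.pendant p).next (some (some p)) (some none) :=
  sameCycle_insert_self (by simp) (by simp)

lemma not_sameCycle_pendant_next_none [Finite D] (p y : D) :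
    ¬ SameCycle (M.pendant p).next (some (some y)) none := by
  intro h
  have := h.eq_of_fixed (by simp [pendant, swap_apply_def])
  simp at this

/-- Again one vertex and one edge are gained, and both new darts are inserted into the face that
passes through `M.rev p`. -/
lemma pendant_hasGenus [Finite D] (p : D) {g : ℕ} (hg : M.HasGenus g) :
    (M.pendant p).HasGenus g := by
  rw [hasGenus_iff] at hg ⊢
  have hφ : (M.pendant p).next * (M.pendant p).rev =
      insertTwo (M.next * M.rev) (M.rev p) (M.rev p) := by
    have hra : ∀ y, M.rev y = p ↔ y = M.rev p := fun y =>
      ⟨fun k => by rw [← k, M.rev_rev], fun k => by rw [k, M.rev_rev]⟩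
    refine Equiv.ext fun y => ?_
    rcases y with _ | _ | y
    · simp [pendant, insertTwo, swap_apply_def, M.rev_rev]
    · simp [pendant, insertTwo, swap_apply_def, M.rev_rev]
    · by_cases ha : y = M.rev p
      · subst ha
        simp [pendant, insertTwo, swap_apply_def, M.rev_rev]
      simp [pendant, insertTwo, swap_apply_def, ha, hra]
  rw [hφ, cycleCount_insertTwo]
  have h1 : cycleCount (M.pendant p).next = cycleCount M.next + 1 := by
    have h1 := cycleCount_addTwo M.next
    have h2 := cycleCount_insert (σ := addTwo M.next) (a := some (some p)) (c := some none)
      (by simp) (by simp)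
    show cycleCount (addTwo M.next * swap (some (some p)) (some none)) = _
    omega
  have h2 : cycleCount (M.pendant p).rev = cycleCount M.rev + 1 := M.cycleCount_revTwo
  rw [h1, h2]
  push_cast
  linarith

variable {M} in
/-- Contraction of the edge of the dart `d`; the edge stays as a loop that bounds a face. -/
def contract [Finite D] {d : D} (h : ¬ SameCycle M.next d (M.rev d)) : SurfaceMap D where
  -- The dart `d` is now followed by `M.rev d`, so `next * rev` fixes `M.rev d`: this is the face
  -- bounded by the loop. Keeping the loop avoids any change of the set of darts.
  next := M.next * swap d (M.next.symm (M.rev d))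
  rev := M.rev
  rev_rev := M.rev_rev
  rev_ne := M.rev_ne
  connected := by
    have h' : ¬ SameCycle M.next d (M.next.symm (M.rev d)) := by
      rwa [sameCycle_symm_apply_right]
    refine M.linked_of_map id ?_ (fun y => linked_rev _ _ _)
      (fun z => ⟨z, (linked_equivalence _ _).refl _⟩)
    intro y
    apply linked_of_sameCycle
    rw [sameCycle_mul_swap_iff h']
    exact Or.inl (SameCycle.step _ _)

variable {M} in
lemma sameCycle_contract_next [Finite D] {d : D} (h : ¬ SameCycle M.next d (M.rev d)) {x y : D} :
    SameCycle (contract h).next x y ↔ SameCycle M.next x y ∨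
      ((SameCycle M.next d x ∨ SameCycle M.next (M.rev d) x) ∧
        (SameCycle M.next d y ∨ SameCycle M.next (M.rev d) y)) := by
  have h' : ¬ SameCycle M.next d (M.next.symm (M.rev d)) := by
    rwa [sameCycle_symm_apply_right]
  show SameCycle (M.next * swap d (M.next.symm (M.rev d))) x y ↔ _
  rw [sameCycle_mul_swap_iff h', sameCycle_symm_apply_left, sameCycle_symm_apply_left]

variable {M} in
-- Two vertices are merged, and the face permutation is multiplied by a transposition of two darts
-- of one face, which is thereby cut in two: the lost vertex is balanced by a new face.
lemma contract_hasGenus [Finite D] {d : D} (h : ¬ SameCycle M.next d (M.rev d)) {g : ℕ}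
    (hg : M.HasGenus g) : (contract h).HasGenus g := by
  rw [hasGenus_iff] at hg ⊢
  have h' : ¬ SameCycle M.next d (M.next.symm (M.rev d)) := by
    rwa [sameCycle_symm_apply_right]
  set p := M.next.symm (M.rev d) with hp
  have hφ : (contract h).next * (contract h).rev =
      (M.next * M.rev) * swap (M.rev d) (M.rev p) := by
    have : swap d p * M.rev = M.rev * swap (M.rev d) (M.rev p) := by
      rw [Equiv.mul_swap_eq_swap_mul, M.rev_rev, M.rev_rev]
    show M.next * swap d p * M.rev = _
    rw [mul_assoc, this, mul_assoc]
  have h1 : cycleCount (contract h).next + 1 = cycleCount M.next := cycleCount_mul_swap h'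
  have hne : M.rev d ≠ M.rev p := fun k => h' (by rw [M.rev.injective k])
  have hs : SameCycle (M.next * M.rev) (M.rev d) (M.rev p) := by
    refine SameCycle.symm ?_
    have := SameCycle.step (M.next * M.rev) (M.rev p)
    have e : (M.next * M.rev) (M.rev p) = M.rev d := by
      rw [mul_apply, M.rev_rev, hp, Equiv.apply_symm_apply]
    rwa [e] at this
  rw [hφ, cycleCount_mul_swap_of_sameCycle hne hs]
  have h2 : cycleCount (contract h).rev = cycleCount M.rev := rfl
  rw [h2]
  have : (cycleCount M.next : ℤ) = cycleCount (contract h).next + 1 := by exact_mod_cast h1.symm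
  push_cast
  linarith

/-- Extension of a permutation by four fixed points. -/
abbrev addFour (τ : Perm D) : Perm (Option (Option (Option (Option D)))) := addTwo (addTwo τ)

/-- Attaching a handle behind the dart `p`. -/
def handle [Finite D] (p : D) : SurfaceMap (Option (Option (Option (Option D)))) where
  next := addFour M.next * swap (some (some (some (some p)))) (some (some (some none))) *
    swap (some (some (some (some p)))) (some (some none)) *
    swap (some (some (some (some p)))) (some none) * swap (some (some (some (some p)))) none
  rev := addFour M.rev * swap none (some (some none)) * swap (some none) (some (some (some none)))
  rev_rev := by
    rintro (_ | _ | _ | _ | y) <;> simp [swap_apply_def, M.rev_rev]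
  rev_ne := by
    rintro (_ | _ | _ | _ | y) <;> simp [swap_apply_def, M.rev_ne]
  connected := by
    set P : Option (Option (Option (Option D))) := some (some (some (some p))) with hP
    set next' := addFour M.next * swap P (some (some (some none))) * swap P (some (some none)) *
      swap P (some none) * swap P none with hn
    set rev' := addFour M.rev * swap none (some (some none)) *
      swap (some none) (some (some (some none))) with hr
    have hE := linked_equivalence next' rev'
    have e1 : Linked next' rev' P none :=
      linked_of_sameCycle (sameCycle_insert_self (by simp [swap_apply_def, hP]) (by simp [hP]))
    have e2 : Linked next' rev' P (some none) := by
      apply linked_of_sameCycle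
      rw [sameCycle_insert_iff (by simp [swap_apply_def, hP]) (by simp [hP]) (by simp [hP])
        (by simp [hP])]
      exact sameCycle_insert_self (by simp [swap_apply_def, hP]) (by simp [hP])
    have e3 : Linked next' rev' none (some (some none)) := by
      simpa [hr, swap_apply_def] using linked_rev next' rev' none
    have e4 : Linked next' rev' (some none) (some (some (some none))) := by
      simpa [hr, swap_apply_def] using linked_rev next' rev' (some none)
    refine M.linked_of_map (fun y => some (some (some (some y)))) ?_ ?_ ?_
    · intro y
      apply linked_of_sameCycle
      rw [sameCycle_insert_iff (by simp [swap_apply_def, hP]) (by simp [hP]) (by simp [hP])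
        (by simp [hP]), sameCycle_insert_iff (by simp [swap_apply_def, hP]) (by simp [hP])
        (by simp [hP]) (by simp [hP]), sameCycle_insert_iff (by simp [swap_apply_def, hP])
        (by simp [hP]) (by simp [hP]) (by simp [hP]), sameCycle_insert_iff
        (by simp) (by simp [hP]) (by simp) (by simp),
        sameCycle_optionCongr, sameCycle_optionCongr, sameCycle_optionCongr, sameCycle_optionCongr]
      exact SameCycle.step _ _
    · intro y
      simpa [hr, swap_apply_def] using linked_rev next' rev' (some (some (some (some y))))
    · rintro (_ | _ | _ | _ | y)
      · exact ⟨p, hE.symm e1⟩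
      · exact ⟨p, hE.symm e2⟩
      · exact ⟨p, hE.symm (hE.trans e1 e3)⟩
      · exact ⟨p, hE.symm (hE.trans e2 e4)⟩
      · exact ⟨y, hE.refl _⟩

lemma sameCycle_handle_next [Finite D] {p y z : D} :
    SameCycle (M.handle p).next (some (some (some (some y)))) (some (some (some (some z)))) ↔
      SameCycle M.next y z := by
  unfold handle
  rw [sameCycle_insert_iff (by simp [swap_apply_def]) (by simp) (by simp) (by simp),
    sameCycle_insert_iff (by simp [swap_apply_def]) (by simp) (by simp) (by simp),
    sameCycle_insert_iff (by simp [swap_apply_def]) (by simp) (by simp) (by simp),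
    sameCycle_insert_iff (by simp) (by simp) (by simp) (by simp),
    sameCycle_optionCongr, sameCycle_optionCongr, sameCycle_optionCongr, sameCycle_optionCongr]

lemma cycleCount_insert_four [Finite D] (τ : Perm D) (p : D)
    {n1 n2 n3 n4 : Option (Option (Option (Option D)))}
    (h1 : addFour τ n1 = n1) (h2 : addFour τ n2 = n2) (h3 : addFour τ n3 = n3)
    (h4 : addFour τ n4 = n4) (h : [n1, n2, n3, n4, some (some (some (some p)))].Nodup) :
    cycleCount (addFour τ * swap (some (some (some (some p)))) n4 *
      swap (some (some (some (some p)))) n3 * swap (some (some (some (some p)))) n2 *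
      swap (some (some (some (some p)))) n1) = cycleCount τ := by
  set P : Option (Option (Option (Option D))) := some (some (some (some p)))
  simp only [List.nodup_cons, List.mem_cons, List.not_mem_nil, or_false, not_or,
    List.nodup_nil, not_false_eq_true, and_true] at h
  obtain ⟨⟨h12, h13, h14, h15⟩, ⟨h23, h24, h25⟩, ⟨h34, h35⟩, h45⟩ := h
  have f0 : cycleCount (addFour τ) = cycleCount τ + 4 := by
    rw [cycleCount_addTwo, cycleCount_addTwo]
  have f1 := cycleCount_insert (σ := addFour τ) h4 (Ne.symm h45)
  have f2 := cycleCount_insert (σ := addFour τ * swap P n4) (a := P) (c := n3)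
    (by rw [mul_swap_apply_of_ne h35 h34, h3]) (Ne.symm h35)
  have f3 := cycleCount_insert (σ := addFour τ * swap P n4 * swap P n3) (a := P) (c := n2)
    (by rw [mul_swap_apply_of_ne h25 h23, mul_swap_apply_of_ne h25 h24, h2]) (Ne.symm h25)
  have f4 := cycleCount_insert (σ := addFour τ * swap P n4 * swap P n3 * swap P n2) (a := P)
    (c := n1) (by rw [mul_swap_apply_of_ne h15 h12, mul_swap_apply_of_ne h15 h13,
      mul_swap_apply_of_ne h15 h14, h1]) (Ne.symm h15)
  omega

/-- Two edges cross at the vertex of `p`, their four darts alternating in the rotation. All four are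
inserted into one face, so vertices and faces keep their numbers and the Euler characteristic drops
by two. -/
lemma handle_hasGenus [Finite D] (p : D) {g : ℕ} (hg : M.HasGenus g) :
    (M.handle p).HasGenus (g + 1) := by
  rw [hasGenus_iff] at hg ⊢
  have hφ : (M.handle p).next * (M.handle p).rev = addFour (M.next * M.rev) *
      swap (some (some (some (some (M.rev p))))) (some none) *
      swap (some (some (some (some (M.rev p))))) (some (some none)) *
      swap (some (some (some (some (M.rev p))))) (some (some (some none))) *
      swap (some (some (some (some (M.rev p))))) none := by
    have hra : ∀ y, M.rev y = p ↔ y = M.rev p := fun y =>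
      ⟨fun k => by rw [← k, M.rev_rev], fun k => by rw [k, M.rev_rev]⟩
    refine Equiv.ext fun y => ?_
    rcases y with _ | _ | _ | _ | y
    · simp [handle, swap_apply_def]
    · simp [handle, swap_apply_def, M.rev_rev]
    · simp [handle, swap_apply_def]
    · simp [handle, swap_apply_def]
    · by_cases ha : y = M.rev p
      · subst ha
        simp [handle, swap_apply_def, M.rev_rev]
      simp [handle, swap_apply_def, ha, hra]
  rw [hφ, cycleCount_insert_four _ _ (by simp) (by simp) (by simp) (by simp) (by simp)]
  have h1 : cycleCount (M.handle p).next = cycleCount M.next :=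
    cycleCount_insert_four _ _ (by simp) (by simp) (by simp) (by simp) (by simp)
  have h2 : cycleCount (M.handle p).rev = cycleCount M.rev + 2 := by
    have f0 : cycleCount (addFour M.rev) = cycleCount M.rev + 4 := by
      rw [cycleCount_addTwo, cycleCount_addTwo]
    have f1 := cycleCount_insert (σ := addFour M.rev) (a := none) (c := some (some none))
      (by simp) (by simp)
    have f2 := cycleCount_insert (σ := addFour M.rev * swap none (some (some none)))
      (a := some none) (c := some (some (some none))) (by simp [swap_apply_def]) (by simp)
    show cycleCount (addFour M.rev * swap none (some (some none)) *
      swap (some none) (some (some (some none)))) = _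
    omega
  rw [h1, h2]
  push_cast
  linarith

end SurfaceMap

/-! ### Splitting and merging vertices of graphs -/

namespace SimpleGraph

variable {V : Type*}

/-- The non-isolated vertices of `C` can be placed on the closed orientable surface of genus `g`
such that the edges of `C` can be drawn without crossings. -/
def DrawableOn (C : SimpleGraph V) (g : ℕ) : Prop :=
  ∃ (D : Type) (_ : Finite D) (_ : Nonempty D) (M : SurfaceMap D), M.HasGenus g ∧
    ∃ f : V → M.Vertex, Set.InjOn f C.support ∧
      ∀ u v, C.Adj u v → ∃ d, M.tail d = f u ∧ M.head d = f v

/-- The vertex `v` is split: the vertex `x` takes over the neighbours of `v` in `A` and is joined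
to `v`. -/
def split (C : SimpleGraph V) (v : V) (A : Set V) (x : V) : SimpleGraph V where
  Adj p q := p ≠ q ∧ ((C.Adj p q ∧ ¬(p = v ∧ q ∈ A) ∧ ¬(q = v ∧ p ∈ A)) ∨
    (p = x ∧ (q ∈ A ∨ q = v)) ∨ (q = x ∧ (p ∈ A ∨ p = v)))
  symm := ⟨by
    rintro p q ⟨h, h1 | h1 | h1⟩
    · exact ⟨h.symm, Or.inl ⟨h1.1.symm, h1.2.2, h1.2.1⟩⟩
    · exact ⟨h.symm, Or.inr (Or.inr h1)⟩
    · exact ⟨h.symm, Or.inr (Or.inl h1)⟩⟩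
  loopless := ⟨fun _ h => h.1 rfl⟩

/-- The vertex `x` is merged into `v`. -/
def merge (C : SimpleGraph V) (v x : V) : SimpleGraph V where
  Adj p q := p ≠ q ∧ p ≠ x ∧ q ≠ x ∧
    (C.Adj p q ∨ (p = v ∧ C.Adj x q) ∨ (q = v ∧ C.Adj x p))
  symm := ⟨by
    rintro p q ⟨h, hp, hq, h1 | h1 | h1⟩
    · exact ⟨h.symm, hq, hp, Or.inl h1.symm⟩
    · exact ⟨h.symm, hq, hp, Or.inr (Or.inr h1)⟩
    · exact ⟨h.symm, hq, hp, Or.inr (Or.inl h1)⟩⟩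
  loopless := ⟨fun _ h => h.1 rfl⟩

lemma not_adj_of_notMem_support {C : SimpleGraph V} {x : V} (hx : x ∉ C.support) (u : V) :
    ¬ C.Adj x u := fun h => hx ⟨u, h⟩

lemma ne_of_notMem_support {C : SimpleGraph V} {x u : V} (hx : x ∉ C.support)
    (hu : u ∈ C.support) : u ≠ x := fun h => hx (h ▸ hu)

/-! ### Splitting and merging undo each other. -/

section

variable {C : SimpleGraph V} {v x : V} {A : Set V}

lemma merge_split (hx : x ∉ C.support) (hA : ∀ u ∈ A, C.Adj v u) (hvx : v ≠ x) :
    (C.split v A x).merge v x = C := by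
  have hxu := not_adj_of_notMem_support hx
  have hxA : ∀ u ∈ A, u ≠ x := fun u hu h => hxu v (h ▸ (hA u hu).symm)
  ext p q
  simp only [merge, split]
  constructor
  · rintro ⟨h, hp, hq, h1 | h1 | h1⟩
    · rcases h1.2 with h2 | h2 | h2
      · exact h2.1
      · exact absurd h2.1 hp
      · exact absurd h2.1 hq
    · obtain ⟨rfl, -, h2 | h2 | h2⟩ := h1
      · exact absurd h2.1 (hxu _)
      · rcases h2.2 with h3 | h3
        · exact hA _ h3
        · exact absurd h3.symm h
      · exact absurd h2.1 hq
    · obtain ⟨rfl, -, h2 | h2 | h2⟩ := h1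
      · exact absurd h2.1 (hxu _)
      · rcases h2.2 with h3 | h3
        · exact (hA _ h3).symm
        · exact absurd h3 h
      · exact absurd h2.1 hp
  · intro h
    have hp : p ≠ x := fun k => hxu q (k ▸ h)
    have hq : q ≠ x := fun k => hxu p (k ▸ h.symm)
    refine ⟨h.ne, hp, hq, ?_⟩
    by_cases h1 : p = v ∧ q ∈ A
    · exact Or.inr (Or.inl ⟨h1.1, hq.symm, Or.inr (Or.inl ⟨trivial, Or.inl h1.2⟩)⟩)
    by_cases h2 : q = v ∧ p ∈ A
    · exact Or.inr (Or.inr ⟨h2.1, hp.symm, Or.inr (Or.inl ⟨trivial, Or.inl h2.2⟩)⟩)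
    exact Or.inl ⟨h.ne, Or.inl ⟨h, h1, h2⟩⟩

/-- Non-adjacency of `v` and `w` is essential: otherwise suppressing `x` would create a double edge,
which a simple graph forgets. -/
lemma split_merge {w : V} (hx : C.neighborSet x = {v, w}) (hvw : ¬ C.Adj v w) (hne : v ≠ w) :
    (C.merge v x).split v {w} x = C := by
  have hxu : ∀ u, C.Adj x u ↔ u = v ∨ u = w := fun u => by
    rw [← mem_neighborSet, hx]; simp
  have hvx : v ≠ x := fun h => by
    have := (hxu v).2 (Or.inl rfl)
    exact this.ne h.symm
  have hwx : w ≠ x := fun h => by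
    have := (hxu w).2 (Or.inr rfl)
    exact this.ne h.symm
  ext p q
  simp only [merge, split, Set.mem_singleton_iff]
  constructor
  · rintro ⟨h, h1 | h1 | h1⟩
    · obtain ⟨⟨-, hp, hq, h2 | h2 | h2⟩, h3, h4⟩ := h1
      · exact h2
      · obtain ⟨rfl, h5⟩ := h2
        rcases (hxu q).1 h5 with h6 | h6
        · exact absurd h6.symm h
        · exact absurd ⟨rfl, h6⟩ h3
      · obtain ⟨rfl, h5⟩ := h2
        rcases (hxu p).1 h5 with h6 | h6
        · exact absurd h6 h
        · exact absurd ⟨rfl, h6⟩ h4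
    · obtain ⟨rfl, h2⟩ := h1
      exact (hxu q).2 h2.symm
    · obtain ⟨rfl, h2⟩ := h1
      exact ((hxu p).2 h2.symm).symm
  · intro h
    refine ⟨h.ne, ?_⟩
    by_cases hp : p = x
    · exact Or.inr (Or.inl ⟨hp, ((hxu q).1 (hp ▸ h)).symm⟩)
    by_cases hq : q = x
    · exact Or.inr (Or.inr ⟨hq, ((hxu p).1 (hq ▸ h.symm)).symm⟩)
    refine Or.inl ⟨⟨h.ne, hp, hq, Or.inl h⟩, ?_, ?_⟩
    · rintro ⟨rfl, rfl⟩
      exact hvw h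
    · rintro ⟨rfl, rfl⟩
      exact hvw h.symm

lemma split_support_subset (hA : ∀ u ∈ A, C.Adj v u) (hv : v ∈ C.support) :
    (C.split v A x).support ⊆ insert x C.support := by
  rintro p ⟨q, -, h1 | h1 | h1⟩
  · exact Or.inr ⟨q, h1.1⟩
  · exact Or.inl h1.1
  · rcases h1.2 with h2 | h2
    · exact Or.inr ⟨v, (hA p h2).symm⟩
    · rw [h2]; exact Or.inr hv

lemma subset_split_support (hv : v ≠ x) (hxA : x ∉ A) (hA : ∀ u ∈ A, C.Adj v u) :
    insert v (insert x C.support) ⊆ (C.split v A x).support := by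
  rintro p (rfl | rfl | ⟨q, h⟩)
  · exact ⟨x, hv, Or.inr (Or.inr ⟨rfl, Or.inr rfl⟩)⟩
  · exact ⟨v, hv.symm, Or.inr (Or.inl ⟨rfl, Or.inr rfl⟩)⟩
  · by_cases hp : p = v
    · exact ⟨x, hp ▸ hv, Or.inr (Or.inr ⟨rfl, Or.inr hp⟩)⟩
    by_cases hpA : p ∈ A
    · exact ⟨x, fun k => hxA (k ▸ hpA), Or.inr (Or.inr ⟨rfl, Or.inl hpA⟩)⟩
    exact ⟨q, h.ne, Or.inl ⟨h, fun k => hp k.1, fun k => hpA k.2⟩⟩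

end

open Equiv Equiv.Perm

/-- Drawing a split vertex, given a suitable cut of the cyclic order of the darts at the vertex. -/
lemma drawableOn_split_of_map {C : SimpleGraph V} {g : ℕ} {v x : V} {A : Set V}
    (hx : x ∉ C.support) (hA : ∀ u ∈ A, C.Adj v u) (hv : v ∈ C.support)
    {D : Type} [Finite D] [DecidableEq D] {M : SurfaceMap D} (hM : M.HasGenus g)
    {f : V → M.Vertex} (hf : Set.InjOn f C.support) {δ : V → V → D}
    (hδ : ∀ u w, C.Adj u w → M.tail (δ u w) = f u ∧ M.head (δ u w) = f w)
    {p b : D} (hp : M.tail p = f v) (hb : M.tail b = f v) (hpb : p ≠ b)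
    (hcut : ∀ u, C.Adj v u → (u ∈ A ↔ SameCycle (M.next * swap p b) b (δ v u))) :
    (C.split v A x).DrawableOn g := by
  classical
  have hs : SameCycle M.next p b := M.tail_eq_iff.1 (hp.trans hb.symm)
  set σ := M.next * swap p b with hσ
  have hσn : ∀ {y z}, SameCycle σ y z → SameCycle M.next y z := fun h =>
    (sameCycle_iff_mul_swap hpb hs).2 (Or.inl h)
  let M' := SurfaceMap.split hpb hs
  have hM' : ∀ y z, M'.tail (some (some y)) = M'.tail (some (some z)) ↔ SameCycle σ y z :=
    fun y z => M'.tail_eq_iff.trans (sameCycle_insertTwo _ _ _)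
  have hnone : M'.tail none = M'.tail (some (some p)) :=
    M'.tail_eq_iff.2 (sameCycle_insertTwo_none _ _ _).symm
  have hsnone : M'.tail (some none) = M'.tail (some (some b)) :=
    M'.tail_eq_iff.2 (sameCycle_insertTwo_some_none _ _ _).symm
  -- The dart `y u` marks the place of `u` in the new map: `p` stays with `v`, `b` lies at the
  -- vertex that becomes `x`, and elsewhere any dart of the old place serves.
  let y : V → D := fun u => if u = v then p else if u = x then b else (M.exists_tail (f u)).choose
  have hvx : v ≠ x := ne_of_notMem_support hx hv
  have hyv : y v = p := by simp [y]
  have hyx : y x = b := by simp [y, hvx.symm]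
  have hyt : ∀ u, u ≠ x → M.tail (y u) = f u := by
    intro u hu
    by_cases h : u = v
    · rw [h, hyv, hp]
    · have : y u = (M.exists_tail (f u)).choose := by simp [y, h, hu]
      rw [this]
      exact (M.exists_tail (f u)).choose_spec
  have hother : ∀ u d, u ∈ C.support → u ≠ v → M.tail d = f u →
      M'.tail (some (some d)) = M'.tail (some (some (y u))) := by
    intro u d hu huv hd
    rw [hM']
    have hux := ne_of_notMem_support hx hu
    have h1 : SameCycle M.next d (y u) := M.tail_eq_iff.1 (hd.trans (hyt u hux).symm)
    -- Only the cycle through `p` and `b`, the place of `v`, has been cut.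
    rcases (sameCycle_iff_mul_swap hpb hs).1 h1 with k | ⟨k, -⟩
    · exact k
    · exfalso
      apply huv
      apply hf hu hv
      rw [← hd]
      rcases k with k | k
      · rw [← hp]; exact M.tail_eq_iff.2 (hσn k).symm
      · rw [← hb]; exact M.tail_eq_iff.2 (hσn k).symm
  have hrev : ∀ d, M'.head (some (some d)) = M'.tail (some (some (M.rev d))) := fun d => by
    show M'.tail (M.revTwo (some (some d))) = _
    rw [M.revTwo_some]
  refine ⟨_, inferInstance, ⟨none⟩, M', SurfaceMap.split_hasGenus hpb hs hM,
    fun u => M'.tail (some (some (y u))), ?_, ?_⟩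
  · have key : ∀ u, u ∈ C.support → M'.tail (some (some (y u))) ≠ M'.tail (some (some (y x))) := by
      intro u hu h
      have hux := ne_of_notMem_support hx hu
      rw [hM', hyx] at h
      have : u = v := by
        apply hf hu hv
        rw [← hyt u hux, ← hb]
        exact M.tail_eq_iff.2 (hσn h)
      rw [this, hyv] at h
      exact not_sameCycle_mul_swap hpb hs h
    intro u1 h1 u2 h2 h
    rcases split_support_subset hA hv h1 with e1 | h1
    · rcases split_support_subset hA hv h2 with e2 | h2
      · exact e1.trans e2.symm
      · exact absurd h.symm (e1 ▸ key _ h2)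
    · rcases split_support_subset hA hv h2 with e2 | h2
      · exact absurd h (e2 ▸ key _ h1)
      · apply hf h1 h2
        rw [← hyt u1 (ne_of_notMem_support hx h1), ← hyt u2 (ne_of_notMem_support hx h2)]
        exact M.tail_eq_iff.2 (hσn ((hM' _ _).1 h))
  · have hsym : ∀ u w, (∃ d, M'.tail d = M'.tail (some (some (y u))) ∧
        M'.head d = M'.tail (some (some (y w)))) → ∃ d, M'.tail d = M'.tail (some (some (y w))) ∧
        M'.head d = M'.tail (some (some (y u))) := by
      rintro u w ⟨d, h1, h2⟩
      exact ⟨M'.rev d, h2, by rw [M'.head_rev, h1]⟩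
    have hxv : ∃ d, M'.tail d = M'.tail (some (some (y x))) ∧
        M'.head d = M'.tail (some (some (y v))) :=
      ⟨some none, by rw [hyx, hsnone], by
        show M'.tail (M.revTwo (some none)) = _
        rw [M.revTwo_some_none, hnone, hyv]⟩
    have hxA : ∀ u ∈ A, ∃ d, M'.tail d = M'.tail (some (some (y x))) ∧
        M'.head d = M'.tail (some (some (y u))) := by
      intro u hu
      have hvu := hA u hu
      refine ⟨some (some (δ v u)), ?_, ?_⟩
      · rw [hM', hyx]
        exact ((hcut u hvu).1 hu).symm
      · rw [hrev]
        exact hother u _ ⟨v, hvu.symm⟩ hvu.ne.symm (hδ v u hvu).2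
    have hvA : ∀ u, C.Adj v u → u ∉ A → ∃ d, M'.tail d = M'.tail (some (some (y v))) ∧
        M'.head d = M'.tail (some (some (y u))) := by
      intro u hvu hu
      refine ⟨some (some (δ v u)), ?_, ?_⟩
      · rw [hM', hyv]
        have hnb := fun k => hu ((hcut u hvu).2 k)
        have h1 : SameCycle M.next p (δ v u) :=
          M.tail_eq_iff.1 (hp.trans (hδ v u hvu).1.symm)
        rcases (sameCycle_iff_mul_swap hpb hs).1 h1 with k | ⟨-, k⟩
        · exact k.symm
        · exact (k.resolve_right hnb).symm
      · rw [hrev]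
        exact hother u _ ⟨v, hvu.symm⟩ hvu.ne.symm (hδ v u hvu).2
    rintro u w ⟨hne, h | h | h⟩
    · obtain ⟨huw, h1, h2⟩ := h
      by_cases hu : u = v
      · subst hu
        exact hvA w huw (fun k => h1 ⟨rfl, k⟩)
      by_cases hw : w = v
      · subst hw
        exact hsym _ _ (hvA u huw.symm (fun k => h2 ⟨rfl, k⟩))
      refine ⟨some (some (δ u w)), hother u _ ⟨w, huw⟩ hu (hδ u w huw).1, ?_⟩
      rw [hrev]
      exact hother w _ ⟨u, huw.symm⟩ hw (hδ u w huw).2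
    · obtain ⟨rfl, h | rfl⟩ := h
      · exact hxA w h
      · exact hxv
    · obtain ⟨rfl, h | rfl⟩ := h
      · exact hsym _ _ (hxA u h)
      · exact hsym _ _ hxv

/-- A choice of darts for the edges of a drawn graph. -/
lemma exists_darts {C : SimpleGraph V} {D : Type} [Nonempty D] {M : SurfaceMap D}
    {f : V → M.Vertex} (h : ∀ u v, C.Adj u v → ∃ d, M.tail d = f u ∧ M.head d = f v) :
    ∃ δ : V → V → D, ∀ u w, C.Adj u w → M.tail (δ u w) = f u ∧ M.head (δ u w) = f w := by
  classical
  refine ⟨fun u w => if huw : C.Adj u w then (h u w huw).choose else Classical.arbitrary D, ?_⟩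
  intro u w huw
  simp only [huw, dif_pos]
  exact (h u w huw).choose_spec

lemma darts_injective {C : SimpleGraph V} {D : Type} {M : SurfaceMap D} {f : V → M.Vertex}
    (hf : Set.InjOn f C.support) {δ : V → V → D}
    (hδ : ∀ u w, C.Adj u w → M.tail (δ u w) = f u ∧ M.head (δ u w) = f w) {v u w : V}
    (hu : C.Adj v u) (hw : C.Adj v w) (h : δ v u = δ v w) : u = w := by
  apply hf ⟨v, hu.symm⟩ ⟨v, hw.symm⟩
  rw [← (hδ v u hu).2, ← (hδ v w hw).2, h]

/-- Subdividing an edge. -/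
lemma DrawableOn.subdivide {C : SimpleGraph V} {g : ℕ} (h : C.DrawableOn g) {v w u x : V}
    (hx : x ∉ C.support) (hw : C.Adj v w) (hu : C.Adj v u) (huw : u ≠ w) :
    (C.split v {w} x).DrawableOn g := by
  classical
  obtain ⟨D, _, _, M, hM, f, hf, hd⟩ := h
  obtain ⟨δ, hδ⟩ := exists_darts hd
  set b := δ v w
  -- With `p` directly before `b`, the cut takes the single dart `b` to the new vertex.
  set p := M.next.symm b with hp
  have hnp : M.next p = b := by simp [hp]
  have hb : M.tail b = f v := (hδ v w hw).1
  have hpb' : SameCycle M.next p b := by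
    have := SameCycle.step M.next p
    rwa [hnp] at this
  have hpt : M.tail p = f v := (M.tail_eq_iff.2 hpb').trans hb
  -- If `p = b`, then `b` is the only dart at the place of `v`, but `u` needs another one.
  have hpb : p ≠ b := by
    intro h
    have hfix : M.next b = b := by
      have := hnp
      rwa [h] at this
    have : SameCycle M.next (δ v u) b := M.tail_eq_iff.1 ((hδ v u hu).1.trans hb.symm)
    exact huw (darts_injective hf hδ hu hw (this.eq_of_fixed hfix))
  refine drawableOn_split_of_map hx (by simpa using hw) ⟨w, hw⟩ hM hf hδ hpt hb hpb ?_
  intro t ht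
  rw [Set.mem_singleton_iff]
  constructor
  · rintro rfl
    exact SameCycle.refl _ _
  · intro k
    obtain ⟨j, h1, h2, h3⟩ := exists_pow_of_sameCycle_mul_swap (r := 1) hpb (by simpa using hnp)
      (fun j _ _ => by omega) k
    obtain rfl : j = 1 := by omega
    rw [pow_one, hnp] at h3
    exact darts_injective hf hδ ht hw h3

/-- A vertex of degree at least three can be split such that the new vertex takes over a given
neighbour and a suitable second one. -/
lemma DrawableOn.split_pair {C : SimpleGraph V} {g : ℕ} (h : C.DrawableOn g) {v a x : V}
    (hx : x ∉ C.support) (ha : C.Adj v a) (hc : ∀ t, ∃ c, C.Adj v c ∧ c ≠ a ∧ c ≠ t) :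
    ∃ b, C.Adj v b ∧ b ≠ a ∧ (C.split v {a, b} x).DrawableOn g := by
  classical
  obtain ⟨D, _, _, M, hM, f, hf, hd⟩ := h
  obtain ⟨δ, hδ⟩ := exists_darts hd
  set p := M.next.symm (δ v a) with hp
  have hnp : M.next p = δ v a := by simp [hp]
  have hpt : M.tail p = f v := by
    rw [← (hδ v a ha).1, ← hnp]
    exact M.tail_eq_iff.2 (SameCycle.step _ _)
  have hmeet : ∀ u, C.Adj v u → ∃ r, 1 ≤ r ∧ (M.next ^ r) p = δ v u := by
    intro u hu
    have : SameCycle M.next p (δ v u) := M.tail_eq_iff.1 (hpt.trans (hδ v u hu).1.symm)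
    obtain ⟨r, h1, -, h3⟩ := this.exists_pow_eq''
    exact ⟨r, h1, h3⟩
  have hex : ∃ r, 1 ≤ r ∧ ∃ u, C.Adj v u ∧ u ≠ a ∧ (M.next ^ r) p = δ v u := by
    obtain ⟨c, hc1, hc2, -⟩ := hc a
    obtain ⟨r, h1, h2⟩ := hmeet c hc1
    exact ⟨r, h1, c, hc1, hc2, h2⟩
  -- Turning at `v` from the dart of `a`, the first other neighbour met is `b`. The stretch up to
  -- its dart contains the chosen darts of `a` and `b` and no other chosen ones, so it can be cut
  -- off.
  obtain ⟨hr1, b, hb, hba, hrb⟩ := Nat.find_spec hex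
  have hmin : ∀ j, 1 ≤ j → j < Nat.find hex → ∀ u, C.Adj v u → u ≠ a → (M.next ^ j) p ≠ δ v u :=
    fun j h1 h2 u h3 h4 h5 => Nat.find_min hex h2 ⟨h1, u, h3, h4, h5⟩
  set r := Nat.find hex
  -- Otherwise the rotation returns to `p` after `r` steps, and these steps meet every dart at `v`
  -- but no third neighbour, contrary to `hc`.
  have hpb : p ≠ δ v b := by
    intro h
    obtain ⟨c, hc1, hc2, hc3⟩ := hc b
    obtain ⟨j, h1, h2⟩ := hmeet c hc1
    have hper : ∀ i, (M.next ^ (r * i)) p = p := by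
      intro i
      induction i with
      | zero => simp
      | succ i ih => rw [mul_add, mul_one, pow_add, mul_apply, hrb, ← h, ih]
    have hj : (M.next ^ (j % r)) p = δ v c := by
      rw [← h2]
      conv_rhs => rw [← Nat.mod_add_div j r, pow_add, mul_apply, hper]
    rcases Nat.eq_zero_or_pos (j % r) with h0 | h0
    · rw [h0, pow_zero, one_apply, h] at hj
      exact hc3 (darts_injective hf hδ hb hc1 hj).symm
    · exact hmin _ h0 (Nat.mod_lt _ (by omega)) c hc1 hc2 hj
  have hbt := (hδ v b hb).1
  refine ⟨b, hb, hba, drawableOn_split_of_map hx ?_ ⟨a, ha⟩ hM hf hδ hpt hbt hpb ?_⟩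
  · rintro u (rfl | rfl)
    · exact ha
    · exact hb
  intro u hu
  rw [Set.mem_insert_iff, Set.mem_singleton_iff]
  constructor
  · rintro (rfl | rfl)
    · have := SameCycle.step (M.next * swap p (δ v b)) (δ v b)
      rwa [mul_swap_apply_right, hnp] at this
    · exact SameCycle.refl _ _
  · intro k
    obtain ⟨j, h1, h2, h3⟩ := exists_pow_of_sameCycle_mul_swap hpb hrb
      (fun j h1 h2 => hmin j h1 h2 b hb hba) k
    by_cases hua : u = a
    · exact Or.inl hua
    rcases h2.lt_or_eq with h2 | h2
    · exact absurd h3.symm (hmin j h1 h2 u hu hua)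
    · rw [h2, hrb] at h3
      exact Or.inr (darts_injective hf hδ hu hb h3)

/-- Attaching a pendant edge. -/
lemma DrawableOn.pendant {C : SimpleGraph V} {g : ℕ} (h : C.DrawableOn g) {v x : V}
    (hx : x ∉ C.support) (hv : v ∈ C.support) : (C.split v ∅ x).DrawableOn g := by
  classical
  obtain ⟨D, _, _, M, hM, f, hf, hd⟩ := h
  obtain ⟨p, hp⟩ := M.exists_tail (f v)
  let M' := M.pendant p
  have hM' : ∀ y z, M'.tail (some (some y)) = M'.tail (some (some z)) ↔ M.tail y = M.tail z :=
    fun y z => M'.tail_eq_iff.trans (M.sameCycle_pendant_next.trans M.tail_eq_iff.symm)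
  let y : V → D := fun u => (M.exists_tail (f u)).choose
  have hy : ∀ u, M.tail (y u) = f u := fun u => (M.exists_tail (f u)).choose_spec
  let f' : V → M'.Vertex := fun u => if u = x then M'.tail none else M'.tail (some (some (y u)))
  have hfx : f' x = M'.tail none := by simp [f']
  have hfu : ∀ u, u ∈ C.support → f' u = M'.tail (some (some (y u))) := fun u hu => by
    simp [f', ne_of_notMem_support hx hu]
  have hne : ∀ u, u ∈ C.support → f' u ≠ f' x := fun u hu h => by
    rw [hfx, hfu u hu] at h
    exact M.not_sameCycle_pendant_next_none p _ (M'.tail_eq_iff.1 h)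
  have hxv : ∃ d, M'.tail d = f' x ∧ M'.head d = f' v := by
    refine ⟨none, hfx.symm, ?_⟩
    show M'.tail (M.revTwo none) = _
    rw [M.revTwo_none, hfu v hv]
    refine Eq.trans ?_ ((hM' p (y v)).2 (by rw [hp, hy]))
    exact M'.tail_eq_iff.2 (M.sameCycle_pendant_next_self p).symm
  have hA : ∀ u ∈ (∅ : Set V), C.Adj v u := fun u hu => absurd hu (Set.notMem_empty u)
  refine ⟨_, inferInstance, ⟨none⟩, M', M.pendant_hasGenus p hM, f', ?_, ?_⟩
  · intro u1 h1 u2 h2 h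
    rcases split_support_subset hA hv h1 with e1 | h1
    · rcases split_support_subset hA hv h2 with e2 | h2
      · exact e1.trans e2.symm
      · exact absurd h.symm (e1 ▸ hne _ h2)
    · rcases split_support_subset hA hv h2 with e2 | h2
      · exact absurd h (e2 ▸ hne _ h1)
      · apply hf h1 h2
        rw [hfu _ h1, hfu _ h2, hM', hy, hy] at h
        exact h
  · rintro u w ⟨hne, h | h | h⟩
    · obtain ⟨d, h1, h2⟩ := hd u w h.1
      refine ⟨some (some d), ?_, ?_⟩
      · rw [hfu u ⟨w, h.1⟩, hM', h1, hy]
      · show M'.tail (M.revTwo (some (some d))) = _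
        rw [M.revTwo_some, hfu w ⟨u, h.1.symm⟩, hM', hy]
        exact h2
    · obtain ⟨rfl, h | rfl⟩ := h
      · exact absurd h (Set.notMem_empty _)
      · exact hxv
    · obtain ⟨rfl, h | rfl⟩ := h
      · exact absurd h (Set.notMem_empty _)
      · obtain ⟨d, h1, h2⟩ := hxv
        exact ⟨M'.rev d, h2, by rw [M'.head_rev, h1]⟩

/-- Merging back a split vertex. -/
lemma DrawableOn.of_split {C : SimpleGraph V} {g : ℕ} {v x : V} {A : Set V}
    (h : (C.split v A x).DrawableOn g) (hx : x ∉ C.support) (hA : ∀ u ∈ A, C.Adj v u)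
    (hvx : v ≠ x) : C.DrawableOn g := by
  classical
  obtain ⟨D, _, hne, M, hM, f, hf, hd⟩ := h
  have hxA : x ∉ A := fun h => not_adj_of_notMem_support hx v (hA x h).symm
  have hsub := subset_split_support hvx hxA hA
  have hvs : v ∈ (C.split v A x).support := hsub (Or.inl rfl)
  have hxs : x ∈ (C.split v A x).support := hsub (Or.inr (Or.inl rfl))
  have hCs : ∀ {u}, u ∈ C.support → u ∈ (C.split v A x).support := fun h =>
    hsub (Or.inr (Or.inr h))
  obtain ⟨d, hd1, hd2⟩ := hd v x ⟨hvx, Or.inr (Or.inr ⟨rfl, Or.inr rfl⟩)⟩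
  have hnc : ¬ SameCycle M.next d (M.rev d) := by
    intro h
    have : M.tail d = M.head d := M.tail_eq_iff.2 h
    rw [hd1, hd2] at this
    exact hvx (hf hvs hxs this)
  let M' := SurfaceMap.contract hnc
  have hM' : ∀ y z, M'.tail y = M'.tail z ↔ M.tail y = M.tail z ∨
      ((M.tail y = f v ∨ M.tail y = f x) ∧ (M.tail z = f v ∨ M.tail z = f x)) := by
    intro y z
    rw [M'.tail_eq_iff, SurfaceMap.sameCycle_contract_next hnc, ← M.tail_eq_iff, ← M.tail_eq_iff,
      ← M.tail_eq_iff, ← M.tail_eq_iff, ← M.tail_eq_iff]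
    have : M.tail (M.rev d) = f x := hd2
    rw [hd1, this, eq_comm (a := f v), eq_comm (a := f x), eq_comm (a := f v), eq_comm (a := f x)]
  let y : V → D := fun u => (M.exists_tail (f u)).choose
  have hy : ∀ u, M.tail (y u) = f u := fun u => (M.exists_tail (f u)).choose_spec
  have hvA : ∀ u ∈ A, ∃ d, M'.tail d = M'.tail (y v) ∧ M'.head d = M'.tail (y u) := by
    intro u hu
    have hux : u ≠ x := fun h => hxA (h ▸ hu)
    obtain ⟨e, he1, he2⟩ := hd x u ⟨hux.symm, Or.inr (Or.inl ⟨rfl, Or.inl hu⟩)⟩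
    refine ⟨e, ?_, ?_⟩
    · rw [hM', hy]
      exact Or.inr ⟨Or.inr he1, Or.inl rfl⟩
    · refine (hM' (M.rev e) (y u)).2 (Or.inl ?_)
      rw [hy]
      exact he2
  refine ⟨D, inferInstance, hne, M', SurfaceMap.contract_hasGenus hnc hM,
    fun u => M'.tail (y u), ?_, ?_⟩
  · intro u1 h1 u2 h2 h
    have e1 := ne_of_notMem_support hx h1
    have e2 := ne_of_notMem_support hx h2
    have k : ∀ u, u ∈ C.support → M.tail (y u) = f v ∨ M.tail (y u) = f x → u = v := by
      intro u hu hk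
      rw [hy] at hk
      rcases hk with hk | hk
      · exact hf (hCs hu) hvs hk
      · exact absurd (hf (hCs hu) hxs hk) (ne_of_notMem_support hx hu)
    rcases (hM' _ _).1 h with h | ⟨h3, h4⟩
    · rw [hy, hy] at h
      exact hf (hCs h1) (hCs h2) h
    · rw [k u1 h1 h3, k u2 h2 h4]
  · intro u w huw
    by_cases c1 : u = v ∧ w ∈ A
    · obtain ⟨rfl, c⟩ := c1
      exact hvA w c
    by_cases c2 : w = v ∧ u ∈ A
    · obtain ⟨rfl, c⟩ := c2
      obtain ⟨e, he1, he2⟩ := hvA u c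
      exact ⟨M'.rev e, he2, by rw [M'.head_rev, he1]⟩
    obtain ⟨e, he1, he2⟩ := hd u w ⟨huw.ne, Or.inl ⟨huw, c1, c2⟩⟩
    refine ⟨e, (hM' _ _).2 (Or.inl (by rw [hy]; exact he1)),
      (hM' (M.rev e) _).2 (Or.inl (by rw [hy]; exact he2))⟩

/-- A handle attached at any corner leaves the old darts and their vertices as they were. -/
lemma DrawableOn.succ {C : SimpleGraph V} {g : ℕ} (h : C.DrawableOn g) :
    C.DrawableOn (g + 1) := by
  classical
  obtain ⟨D, _, ⟨p⟩, M, hM, f, hf, hd⟩ := h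
  let M' := M.handle p
  have hM' : ∀ y z, M'.tail (some (some (some (some y)))) =
      M'.tail (some (some (some (some z)))) ↔ M.tail y = M.tail z :=
    fun y z => M'.tail_eq_iff.trans (M.sameCycle_handle_next.trans M.tail_eq_iff.symm)
  let y : V → D := fun u => (M.exists_tail (f u)).choose
  have hy : ∀ u, M.tail (y u) = f u := fun u => (M.exists_tail (f u)).choose_spec
  refine ⟨_, inferInstance, ⟨none⟩, M', M.handle_hasGenus p hM,
    fun u => M'.tail (some (some (some (some (y u))))), ?_, ?_⟩
  · intro u1 h1 u2 h2 h
    have := (hM' _ _).1 h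
    rw [hy, hy] at this
    exact hf h1 h2 this
  · intro u w huw
    obtain ⟨d, h1, h2⟩ := hd u w huw
    refine ⟨some (some (some (some d))), (hM' _ _).2 (by rw [hy, h1]), ?_⟩
    have : M'.head (some (some (some (some d)))) = M'.tail (some (some (some (some (M.rev d))))) := by
      show M'.tail (M'.rev _) = _
      congr 1
    rw [this, hM', hy]
    exact h2

lemma DrawableOn.mono_genus {C : SimpleGraph V} {g : ℕ} (h : C.DrawableOn 0) :
    C.DrawableOn g := by
  induction g with
  | zero => exact h
  | succ g ih => exact ih.succ

/-- Drawings can be transported along injections. -/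
lemma DrawableOn.of_injOn {W : Type*} {C : SimpleGraph V} {C' : SimpleGraph W} {g : ℕ}
    (h : C'.DrawableOn g) (φ : V → W) (hφ : Set.InjOn φ C.support)
    (hadj : ∀ u v, C.Adj u v → C'.Adj (φ u) (φ v)) : C.DrawableOn g := by
  obtain ⟨D, h1, h2, M, hM, f, hf, hd⟩ := h
  refine ⟨D, h1, h2, M, hM, f ∘ φ, ?_, fun u v huv => hd _ _ (hadj u v huv)⟩
  refine hf.comp hφ ?_
  rintro u ⟨v, huv⟩
  exact ⟨φ v, hadj u v huv⟩

/-- `DrawableOn` ignores isolated vertices, so that cores can be treated as graphs on the whole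
vertex set. For graphs without isolated vertices the two notions agree. -/
lemma embeddableOnSurface_iff {C : SimpleGraph V} {g : ℕ} (hs : C.support = Set.univ) :
    C.EmbeddableOnSurface g ↔ C.DrawableOn g := by
  constructor
  · rintro ⟨D, h1, h2, M, hM, f, hf, hd⟩
    exact ⟨D, h1, h2, M, hM, f, hf.injOn, hd⟩
  · rintro ⟨D, h1, h2, M, hM, f, hf, hd⟩
    rw [hs, Set.injOn_univ] at hf
    exact ⟨D, h1, h2, M, hM, f, hf, hd⟩

end SimpleGraph

/-! ### Graphs that are their own core -/

namespace SimpleGraph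

variable {V : Type*}

/-- The degree of a vertex, as the cardinality of its set of neighbours. -/
noncomputable def ndeg (C : SimpleGraph V) (v : V) : ℕ := (C.neighborSet v).ncard

/-- Up to isolated vertices, `C` has minimum degree at least two and all its components are
complex. -/
structure IsCoreGraph (C : SimpleGraph V) : Prop where
  two_le : ∀ v ∈ C.support, 2 ≤ C.ndeg v
  exists_reachable : ∀ v ∈ C.support, ∃ w, C.Reachable v w ∧ 3 ≤ C.ndeg w

/-- Every edge of the kernel is subdivided by at least two vertices. -/
def IsFat (C : SimpleGraph V) : Prop :=
  ∀ v w, 3 ≤ C.ndeg v → C.Adj v w → C.ndeg w = 2 ∧ ∀ v', 3 ≤ C.ndeg v' → C.Adj v' w → v' = v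

/-! ### Degrees, support and connectivity of a split graph. -/

section Split

variable {C : SimpleGraph V} {v x : V} {A : Set V}

lemma ndeg_eq_zero (hx : x ∉ C.support) : C.ndeg x = 0 := by
  have : C.neighborSet x = ∅ := by
    ext u
    simpa using not_adj_of_notMem_support hx u
  rw [ndeg, this, Set.ncard_empty]

lemma mem_support_of_ndeg_pos (h : 0 < C.ndeg v) : v ∈ C.support := by
  by_contra hv
  rw [ndeg_eq_zero hv] at h
  exact lt_irrefl _ h

variable (hx : x ∉ C.support) (hA : ∀ u ∈ A, C.Adj v u) (hvx : v ≠ x)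
include hx hA hvx

lemma neighborSet_split_new : (C.split v A x).neighborSet x = insert v A := by
  have hxu := not_adj_of_notMem_support hx
  ext q
  simp only [mem_neighborSet, split, Set.mem_insert_iff]
  constructor
  · rintro ⟨h, h1 | h1 | h1⟩
    · exact absurd h1.1 (hxu q)
    · exact h1.2.symm
    · exact absurd h1.1.symm h
  · intro h
    refine ⟨?_, Or.inr (Or.inl ⟨trivial, h.symm⟩)⟩
    rintro rfl
    rcases h with h | h
    · exact hvx h.symm
    · exact hxu v (hA x h).symm

lemma neighborSet_split_old : (C.split v A x).neighborSet v = insert x (C.neighborSet v \ A) := by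
  ext q
  simp only [mem_neighborSet, split, Set.mem_insert_iff, Set.mem_sdiff]
  constructor
  · rintro ⟨h, h1 | h1 | h1⟩
    · exact Or.inr ⟨h1.1, fun k => h1.2.1 ⟨trivial, k⟩⟩
    · exact absurd h1.1 hvx
    · exact Or.inl h1.1
  · rintro (rfl | ⟨h, h1⟩)
    · exact ⟨hvx, Or.inr (Or.inr ⟨rfl, Or.inr trivial⟩)⟩
    · exact ⟨h.ne, Or.inl ⟨h, fun k => h1 k.2, fun k => h.ne k.1.symm⟩⟩

lemma neighborSet_split_moved {u : V} (hu : u ∈ A) :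
    (C.split v A x).neighborSet u = insert x (C.neighborSet u \ {v}) := by
  have hux : u ≠ x := fun k => not_adj_of_notMem_support hx v (k ▸ (hA u hu).symm)
  have huv : u ≠ v := (hA u hu).ne.symm
  ext q
  simp only [mem_neighborSet, split, Set.mem_insert_iff, Set.mem_sdiff, Set.mem_singleton_iff]
  constructor
  · rintro ⟨h, h1 | h1 | h1⟩
    · exact Or.inr ⟨h1.1, fun k => h1.2.2 ⟨k, hu⟩⟩
    · exact absurd h1.1 hux
    · exact Or.inl h1.1
  · rintro (rfl | ⟨h, h1⟩)
    · exact ⟨hux, Or.inr (Or.inr ⟨rfl, Or.inl hu⟩)⟩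
    · exact ⟨h.ne, Or.inl ⟨h, fun k => huv k.1, fun k => h1 k.1⟩⟩

omit hx hA hvx in
lemma neighborSet_split_of_notMem {u : V} (hu : u ∉ A) (huv : u ≠ v) (hux : u ≠ x) :
    (C.split v A x).neighborSet u = C.neighborSet u := by
  ext q
  simp only [mem_neighborSet, split]
  constructor
  · rintro ⟨h, h1 | h1 | h1⟩
    · exact h1.1
    · exact absurd h1.1 hux
    · rcases h1.2 with h2 | h2
      · exact absurd h2 hu
      · exact absurd h2 huv
  · intro h
    exact ⟨h.ne, Or.inl ⟨h, fun k => huv k.1, fun k => hu k.2⟩⟩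

lemma ndeg_split_new [Finite V] : (C.split v A x).ndeg x = A.ncard + 1 := by
  rw [ndeg, neighborSet_split_new hx hA hvx, Set.ncard_insert_of_notMem]
  exact fun h => (hA v h).ne rfl

lemma ndeg_split_old [Finite V] : (C.split v A x).ndeg v + A.ncard = C.ndeg v + 1 := by
  have hsub : A ⊆ C.neighborSet v := fun u hu => hA u hu
  rw [ndeg, neighborSet_split_old hx hA hvx, Set.ncard_insert_of_notMem, ndeg,
    ← Set.ncard_sdiff_add_ncard_of_subset hsub]
  · ring
  · rintro ⟨h, -⟩
    exact not_adj_of_notMem_support hx v (C.symm.symm _ _ h)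

lemma ndeg_split_of_ne [Finite V] {u : V} (huv : u ≠ v) (hux : u ≠ x) :
    (C.split v A x).ndeg u = C.ndeg u := by
  by_cases hu : u ∈ A
  · rw [ndeg, neighborSet_split_moved hx hA hvx hu, Set.ncard_insert_of_notMem,
      Set.ncard_sdiff_singleton_add_one, ndeg]
    · exact (hA u hu).symm
    · rintro ⟨h, -⟩
      exact not_adj_of_notMem_support hx u (C.symm.symm _ _ h)
  · rw [ndeg, neighborSet_split_of_notMem hu huv hux, ndeg]

lemma sum_ndeg_split [Fintype V] : ∑ u, (C.split v A x).ndeg u = ∑ u, C.ndeg u + 2 := by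
  classical
  have h1 := ndeg_split_new hx hA hvx
  have h2 := ndeg_split_old hx hA hvx
  have h3 := ndeg_eq_zero hx
  have key : ∀ f : V → ℕ, ∑ u, f u = f v + (f x + ∑ u ∈ (Finset.univ.erase v).erase x, f u) := by
    intro f
    rw [Finset.add_sum_erase _ _ (by simp [hvx.symm]), Finset.add_sum_erase _ _ (by simp)]
  rw [key, key fun u => C.ndeg u, Finset.sum_congr rfl (g := fun u => C.ndeg u)]
  · omega
  · intro u hu
    simp only [Finset.mem_erase] at hu
    exact ndeg_split_of_ne hx hA hvx hu.2.1 hu.1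

lemma reachable_split {p q : V} (h : C.Reachable p q) : (C.split v A x).Reachable p q := by
  obtain ⟨w⟩ := h
  induction w with
  | nil => exact Reachable.refl _
  | @cons a b c hab _ ih =>
    refine Reachable.trans ?_ ih
    have hvx' : (C.split v A x).Adj v x := ⟨hvx, Or.inr (Or.inr ⟨rfl, Or.inr rfl⟩)⟩
    have hxA : ∀ u ∈ A, (C.split v A x).Adj x u := fun u hu => by
      rw [← mem_neighborSet, neighborSet_split_new hx hA hvx]; exact Or.inr hu
    by_cases h1 : a = v ∧ b ∈ A
    · rw [h1.1]
      exact hvx'.reachable.trans (hxA b h1.2).reachable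
    by_cases h2 : b = v ∧ a ∈ A
    · rw [h2.1]
      exact (hvx'.reachable.trans (hxA a h2.2).reachable).symm
    exact Adj.reachable ⟨hab.ne, Or.inl ⟨hab, h1, h2⟩⟩

lemma reachable_of_split {p q : V} (h : (C.split v A x).Reachable p q) (hp : p ≠ x) (hq : q ≠ x) :
    C.Reachable p q := by
  classical
  -- Sending `x` to `v` projects walks of the split graph to walks of `C`.
  have key : ∀ p q, (C.split v A x).Walk p q →
      C.Reachable (if p = x then v else p) (if q = x then v else q) := by
    intro p q w
    induction w with
    | nil => exact Reachable.refl _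
    | @cons a b c hab _ ih =>
      refine Reachable.trans ?_ ih
      obtain ⟨hne, h1 | ⟨rfl, h1⟩ | ⟨rfl, h1⟩⟩ := hab
      · have ha : a ≠ x := fun k => not_adj_of_notMem_support hx b (k ▸ h1.1)
        have hb : b ≠ x := fun k => not_adj_of_notMem_support hx a (k ▸ h1.1.symm)
        rw [if_neg ha, if_neg hb]
        exact h1.1.reachable
      · rw [if_pos rfl, if_neg hne.symm]
        rcases h1 with h1 | h1
        · exact (hA b h1).reachable
        · rw [h1]
      · rw [if_pos rfl, if_neg hne]
        rcases h1 with h1 | h1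
        · exact (hA a h1).symm.reachable
        · rw [h1]
  obtain ⟨w⟩ := h
  have := key p q w
  rwa [if_neg hp, if_neg hq] at this

lemma support_split (hv : v ∈ C.support) : (C.split v A x).support = insert x C.support := by
  apply le_antisymm
  · exact split_support_subset hA hv
  · refine le_trans ?_ (subset_split_support hvx ?_ hA)
    · exact Set.subset_insert _ _
    · exact fun h => not_adj_of_notMem_support hx v (hA x h).symm

/-- After the split `v` has degree `C.ndeg v + 1 - A.ncard` and `x` has degree `A.ncard + 1`. The
condition `h3` keeps `v` a kernel vertex if it was one, so that every component still contains one.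
-/
lemma IsCoreGraph.split [Finite V] (h : C.IsCoreGraph) (hv : v ∈ C.support) (hA1 : 1 ≤ A.ncard)
    (hA2 : A.ncard + 1 ≤ C.ndeg v) (h3 : 3 ≤ C.ndeg v → A.ncard + 2 ≤ C.ndeg v) :
    (C.split v A x).IsCoreGraph := by
  have e1 := ndeg_split_new hx hA hvx
  have e2 := ndeg_split_old hx hA hvx
  have key : ∀ u ∈ C.support, ∃ w, (C.split v A x).Reachable u w ∧ 3 ≤ (C.split v A x).ndeg w := by
    intro u hu
    obtain ⟨w, hw, hw3⟩ := h.exists_reachable u hu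
    refine ⟨w, reachable_split hx hA hvx hw, ?_⟩
    by_cases hwv : w = v
    · rw [hwv] at hw3 ⊢
      have := h3 hw3
      omega
    · have hwx : w ≠ x := ne_of_notMem_support hx (mem_support_of_ndeg_pos (by omega))
      rwa [ndeg_split_of_ne hx hA hvx hwv hwx]
  constructor
  · intro u hu
    rw [support_split hx hA hvx hv] at hu
    by_cases hux : u = x
    · rw [hux]; omega
    have hu := hu.resolve_left hux
    by_cases huv : u = v
    · rw [huv]
      omega
    · rw [ndeg_split_of_ne hx hA hvx huv hux]
      exact h.two_le u hu
  · intro u hu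
    rw [support_split hx hA hvx hv] at hu
    rcases hu with rfl | hu
    · obtain ⟨w, hw, hw3⟩ := key v hv
      refine ⟨w, Reachable.trans (Adj.reachable ?_) hw, hw3⟩
      exact ⟨hvx.symm, Or.inr (Or.inl ⟨rfl, Or.inr rfl⟩)⟩
    · exact key u hu

end Split

/-! ### Subdivision as the split that moves a single neighbour. -/

section Subdivide

variable {C : SimpleGraph V} {v w x : V} (hx : x ∉ C.support) (h : C.Adj v w)
include hx h

lemma ne_of_adj_of_notMem : v ≠ x := ne_of_notMem_support hx ⟨w, h⟩

lemma subdivide_adj_left : (C.split v {w} x).Adj v x :=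
  ⟨ne_of_adj_of_notMem hx h, Or.inr (Or.inr ⟨rfl, Or.inr rfl⟩)⟩

lemma subdivide_adj_right : (C.split v {w} x).Adj w x :=
  ⟨ne_of_adj_of_notMem hx h.symm, Or.inr (Or.inr ⟨rfl, Or.inl rfl⟩)⟩

lemma neighborSet_subdivide_new : (C.split v {w} x).neighborSet x = {v, w} :=
  neighborSet_split_new hx (by simpa using h) (ne_of_adj_of_notMem hx h)

lemma ndeg_subdivide_new [Finite V] : (C.split v {w} x).ndeg x = 2 := by
  rw [ndeg_split_new hx (by simpa using h) (ne_of_adj_of_notMem hx h)]; simp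

lemma ndeg_subdivide [Finite V] {u : V} (hu : u ≠ x) : (C.split v {w} x).ndeg u = C.ndeg u := by
  have hA : ∀ u ∈ ({w} : Set V), C.Adj v u := by simpa using h
  by_cases huv : u = v
  · have := ndeg_split_old hx hA (ne_of_adj_of_notMem hx h)
    rw [Set.ncard_singleton] at this
    rw [huv]; omega
  · exact ndeg_split_of_ne hx hA (ne_of_adj_of_notMem hx h) huv hu

lemma three_le_ndeg_subdivide [Finite V] {u : V} :
    3 ≤ (C.split v {w} x).ndeg u ↔ 3 ≤ C.ndeg u := by
  by_cases hu : u = x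
  · rw [hu, ndeg_subdivide_new hx h, ndeg_eq_zero hx]; simp
  · rw [ndeg_subdivide hx h hu]

lemma support_subdivide : (C.split v {w} x).support = insert x C.support :=
  support_split hx (by simpa using h) (ne_of_adj_of_notMem hx h) ⟨w, h⟩

lemma sum_ndeg_subdivide [Fintype V] : ∑ u, (C.split v {w} x).ndeg u = ∑ u, C.ndeg u + 2 :=
  sum_ndeg_split hx (by simpa using h) (ne_of_adj_of_notMem hx h)

lemma merge_subdivide : (C.split v {w} x).merge v x = C :=
  merge_split hx (by simpa using h) (ne_of_adj_of_notMem hx h)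

omit hx h in
lemma subdivide_adj_iff {p q : V} (hp : p ≠ x) (hq : q ≠ x) :
    (C.split v {w} x).Adj p q ↔ C.Adj p q ∧ ¬(p = v ∧ q = w) ∧ ¬(q = v ∧ p = w) := by
  constructor
  · rintro ⟨-, h1 | h1 | h1⟩
    · exact h1
    · exact absurd h1.1 hp
    · exact absurd h1.1 hq
  · rintro h1
    exact ⟨h1.1.ne, Or.inl h1⟩

lemma subdivide_adj_new_iff {p : V} : (C.split v {w} x).Adj x p ↔ p = v ∨ p = w := by
  rw [← mem_neighborSet, neighborSet_subdivide_new hx h]; simp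

lemma isCoreGraph_subdivide_iff [Finite V] : (C.split v {w} x).IsCoreGraph ↔ C.IsCoreGraph := by
  have hA : ∀ u ∈ ({w} : Set V), C.Adj v u := by simpa using h
  have hvx := ne_of_adj_of_notMem hx h
  constructor
  · intro h'
    constructor
    · intro u hu
      rw [← ndeg_subdivide hx h (ne_of_notMem_support hx hu)]
      apply h'.two_le
      rw [support_subdivide hx h]
      exact Or.inr hu
    · intro u hu
      obtain ⟨t, ht, ht3⟩ := h'.exists_reachable u (by
        rw [support_subdivide hx h]; exact Or.inr hu)
      rw [three_le_ndeg_subdivide hx h] at ht3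
      exact ⟨t, reachable_of_split hx hA hvx ht (ne_of_notMem_support hx hu)
        (ne_of_notMem_support hx (mem_support_of_ndeg_pos (by omega))), ht3⟩
  · intro h'
    have := h'.two_le v ⟨w, h⟩
    refine h'.split hx hA hvx ⟨w, h⟩ (by simp) (by simpa using this) (by simp)

end Subdivide

lemma IsCoreGraph.exists_ne_adj [Finite V] {C : SimpleGraph V} (hC : C.IsCoreGraph) {v w : V}
    (h : C.Adj v w) : ∃ u, C.Adj v u ∧ u ≠ w := by
  have := hC.two_le v ⟨w, h⟩
  obtain ⟨u, hu, huw⟩ := Set.exists_ne_of_one_lt_ncard (s := C.neighborSet v) (by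
    unfold ndeg at this; omega) w
  exact ⟨u, hu, huw⟩

/-- The cores with `s` vertices, `s + l` edges and `q` vertices of degree at least three. -/
structure IsCoreOf [Fintype V] (g l s q : ℕ) (C : SimpleGraph V) : Prop where
  core : C.IsCoreGraph
  drawable : C.DrawableOn g
  support_ncard : C.support.ncard = s
  kernel_ncard : {v | 3 ≤ C.ndeg v}.ncard = q
  sum_ndeg : ∑ v, C.ndeg v = 2 * (s + l)

/-- Subdivision changes the number of vertices only. The equivalence lets double counting arguments
both insert and suppress vertices of degree two. -/
lemma isCoreOf_subdivide_iff [Fintype V] {C : SimpleGraph V} {v w x : V} (hx : x ∉ C.support)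
    (h : C.Adj v w) {g l s q : ℕ} :
    IsCoreOf g l (s + 1) q (C.split v {w} x) ↔ IsCoreOf g l s q C := by
  have hK : {u | 3 ≤ (C.split v {w} x).ndeg u} = {u | 3 ≤ C.ndeg u} := by
    ext u; exact three_le_ndeg_subdivide hx h
  have hS : (C.split v {w} x).support.ncard = C.support.ncard + 1 := by
    rw [support_subdivide hx h, Set.ncard_insert_of_notMem hx]
  have hsum := sum_ndeg_subdivide hx h
  constructor
  · rintro ⟨h1, h2, h3, h4, h5⟩
    refine ⟨(isCoreGraph_subdivide_iff hx h).1 h1, h2.of_split hx (by simpa using h)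
      (ne_of_adj_of_notMem hx h), by omega, by rwa [hK] at h4, by omega⟩
  · rintro ⟨h1, h2, h3, h4, h5⟩
    obtain ⟨u, hu, huw⟩ := h1.exists_ne_adj h
    refine ⟨(isCoreGraph_subdivide_iff hx h).2 h1, h2.subdivide hx h hu huw, by omega,
      by rwa [hK], by omega⟩

/-- A vertex of degree two can be suppressed, unless its neighbours are adjacent. -/
lemma exists_eq_subdivide {C : SimpleGraph V} {x v w : V} (hN : C.neighborSet x = {v, w})
    (hvw : v ≠ w) (hn : ¬ C.Adj v w) : x ∉ (C.merge v x).support ∧ (C.merge v x).Adj v w ∧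
      (C.merge v x).split v {w} x = C := by
  have hxu : ∀ u, C.Adj x u ↔ u = v ∨ u = w := fun u => by
    rw [← mem_neighborSet, hN]; simp
  have hv := (hxu v).2 (Or.inl rfl)
  have hw := (hxu w).2 (Or.inr rfl)
  refine ⟨?_, ?_, split_merge hN hn hvw⟩
  · rintro ⟨u, h⟩
    exact h.2.1 rfl
  · exact ⟨hvw, hv.ne.symm, hw.ne.symm, Or.inr (Or.inl ⟨rfl, hw⟩)⟩

lemma exists_neighborSet_eq {C : SimpleGraph V} {x v : V} (h : C.ndeg x = 2) (hv : C.Adj x v) :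
    ∃ w, v ≠ w ∧ C.neighborSet x = {v, w} := by
  obtain ⟨a, b, hab, hN⟩ := Set.ncard_eq_two.1 h
  have : v ∈ ({a, b} : Set V) := hN ▸ hv
  rcases this with rfl | rfl
  · exact ⟨b, hab, hN⟩
  · exact ⟨a, hab.symm, by rw [hN, Set.pair_comm]⟩

/-- In a core the neighbours of a vertex of degree two are not adjacent if they, too, have degree
two. -/
lemma IsCoreGraph.not_adj {C : SimpleGraph V} (hC : C.IsCoreGraph) {x v w : V}
    (hx : C.neighborSet x = {v, w}) (hne : v ≠ w) (hv : C.ndeg v = 2) (hw : C.ndeg w = 2) :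
    ¬ C.Adj v w := by
  intro hvw
  have hxu : ∀ u, C.Adj x u ↔ u = v ∨ u = w := fun u => by
    rw [← mem_neighborSet, hx]; simp
  have hxv := (hxu v).2 (Or.inl rfl)
  have hxw := (hxu w).2 (Or.inr rfl)
  have hN : ∀ a b, C.ndeg a = 2 → C.Adj a x → C.Adj a b → b ≠ x → ∀ u, C.Adj a u → u = x ∨ u = b := by
    intro a b ha h1 h2 h3 u hu
    obtain ⟨c, hc, hN⟩ := exists_neighborSet_eq ha h1
    have hb : b ∈ ({x, c} : Set V) := hN ▸ h2
    have hu : u ∈ ({x, c} : Set V) := hN ▸ hu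
    rcases hb.resolve_left h3 with rfl
    exact hu
  have hx2 : C.ndeg x = 2 := by rw [ndeg, hx]; exact Set.ncard_pair hne
  obtain ⟨t, ⟨p⟩, ht⟩ := hC.exists_reachable x ⟨v, hxv⟩
  -- If `v` and `w` were adjacent, the triangle `x, v, w` would be closed under adjacency and hence
  -- be a component without a kernel vertex.
  have key : ∀ a b, C.Walk a b → (a = x ∨ a = v ∨ a = w) → (b = x ∨ b = v ∨ b = w) := by
    intro a b p
    induction p with
    | nil => exact id
    | @cons a b c hab _ ih =>
      intro ha
      apply ih
      rcases ha with rfl | rfl | rfl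
      · exact Or.inr ((hxu b).1 hab)
      · rcases hN _ w hv hxv.symm hvw hxw.ne.symm b hab with h | h
        · exact Or.inl h
        · exact Or.inr (Or.inr h)
      · rcases hN _ v hw hxw.symm hvw.symm hxv.ne.symm b hab with h | h
        · exact Or.inl h
        · exact Or.inr (Or.inl h)
  rcases key x t p (Or.inl rfl) with rfl | rfl | rfl <;> omega

end SimpleGraph

/-! ### Double counting -/

section Fibers

variable {α β : Type*} [Finite β]

lemma ncard_eq_sum_fiber [Fintype α] (R : Set (α × β)) :
    R.ncard = ∑ a, {b | (a, b) ∈ R}.ncard := by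
  have e : R ≃ Σ a, {b // (a, b) ∈ R} :=
    { toFun := fun p => ⟨p.1.1, p.1.2, p.2⟩
      invFun := fun p => ⟨(p.1, p.2.1), p.2.2⟩
      left_inv := fun _ => rfl
      right_inv := fun _ => rfl }
  rw [← Nat.card_coe_set_eq, Nat.card_congr e, Nat.card_sigma]
  rfl

lemma ncard_eq_sum_fiber_of_mem [Fintype α] {R : Set (α × β)} {A : Set α} [DecidablePred (· ∈ A)]
    (hR : ∀ p ∈ R, p.1 ∈ A) : R.ncard = ∑ a with a ∈ A, {b | (a, b) ∈ R}.ncard := by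
  rw [ncard_eq_sum_fiber, Finset.sum_filter]
  refine Finset.sum_congr rfl fun a _ => ?_
  split_ifs with h
  · rfl
  · have : {b | (a, b) ∈ R} = ∅ := by
      ext b; simpa using fun k => h (hR _ k)
    rw [this, Set.ncard_empty]

lemma card_filter_mem_eq_ncard [Fintype α] (A : Set α) [DecidablePred (· ∈ A)] :
    (Finset.univ.filter (· ∈ A)).card = A.ncard := by
  rw [← Set.ncard_coe_finset]
  congr 1
  ext; simp

variable [Finite α]

lemma ncard_eq_mul_of_fiber {R : Set (α × β)} {A : Set α} {c : ℕ} (hR : ∀ p ∈ R, p.1 ∈ A)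
    (hc : ∀ a ∈ A, {b | (a, b) ∈ R}.ncard = c) : R.ncard = A.ncard * c := by
  classical
  have := Fintype.ofFinite α
  rw [ncard_eq_sum_fiber_of_mem hR, Finset.sum_congr rfl (g := fun _ => c)]
  · rw [Finset.sum_const, card_filter_mem_eq_ncard, smul_eq_mul]
  · intro a ha
    exact hc a (by simpa using ha)

lemma ncard_le_mul_of_fiber {R : Set (α × β)} {A : Set α} {c : ℕ} (hR : ∀ p ∈ R, p.1 ∈ A)
    (hc : ∀ a ∈ A, {b | (a, b) ∈ R}.ncard ≤ c) : R.ncard ≤ A.ncard * c := by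
  classical
  have := Fintype.ofFinite α
  rw [ncard_eq_sum_fiber_of_mem hR, ← card_filter_mem_eq_ncard A, ← smul_eq_mul]
  exact Finset.sum_le_card_nsmul _ _ _ fun a ha => hc a (by simpa using ha)

lemma mul_le_ncard_of_fiber {R : Set (α × β)} {A : Set α} {c : ℕ} (hR : ∀ p ∈ R, p.1 ∈ A)
    (hc : ∀ a ∈ A, c ≤ {b | (a, b) ∈ R}.ncard) : A.ncard * c ≤ R.ncard := by
  classical
  have := Fintype.ofFinite α
  rw [ncard_eq_sum_fiber_of_mem hR, ← card_filter_mem_eq_ncard A, ← smul_eq_mul]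
  exact Finset.card_nsmul_le_sum _ _ _ fun a ha => hc a (by simpa using ha)

lemma ncard_injective_compl (S : Set α) (k : ℕ) :
    {y : Fin k → α | Function.Injective y ∧ ∀ i, y i ∉ S}.ncard =
      (Nat.card α - S.ncard).descFactorial k := by
  classical
  have := Fintype.ofFinite α
  have e : {y : Fin k → α | Function.Injective y ∧ ∀ i, y i ∉ S} ≃ (Fin k ↪ (Sᶜ : Set α)) :=
    { toFun := fun y => ⟨fun i => ⟨y.1 i, y.2.2 i⟩, fun i j h => y.2.1 (congrArg Subtype.val h)⟩
      invFun := fun y => ⟨fun i => y i, fun i j h => y.injective (Subtype.ext h), fun i => (y i).2⟩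
      left_inv := fun _ => rfl
      right_inv := fun _ => rfl }
  rw [← Nat.card_coe_set_eq, Nat.card_congr e, Nat.card_eq_fintype_card,
    Fintype.card_embedding_eq, Fintype.card_fin, ← Nat.card_eq_fintype_card, Nat.card_coe_set_eq,
    Set.ncard_compl]

end Fibers

/-! ### Numbers of darts in cores, and counting subdivisions. -/

namespace SimpleGraph

variable {V : Type*} [Fintype V] {C : SimpleGraph V} {g l s q : ℕ}

lemma ncard_darts (P : Set V) [DecidablePred (· ∈ P)] :
    {p : V × V | p.1 ∈ P ∧ C.Adj p.1 p.2}.ncard = ∑ v with v ∈ P, C.ndeg v := by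
  rw [ncard_eq_sum_fiber_of_mem (A := P) (fun p hp => hp.1)]
  refine Finset.sum_congr rfl fun v hv => ?_
  have hv : v ∈ P := by simpa using hv
  simp only [Set.mem_ofPred_eq, hv, true_and]
  rfl

omit [Fintype V] in
lemma support_eq_union (hC : C.IsCoreGraph) :
    C.support = {v | 3 ≤ C.ndeg v} ∪ {v | C.ndeg v = 2} := by
  ext v
  simp only [Set.mem_union, Set.mem_ofPred_eq]
  constructor
  · intro hv
    have := hC.two_le v hv
    omega
  · intro h
    exact mem_support_of_ndeg_pos (by omega)

namespace IsCoreOf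

variable (h : IsCoreOf g l s q C)
include h

lemma ncard_two : {v | C.ndeg v = 2}.ncard + q = s := by
  rw [← h.support_ncard, support_eq_union h.core, Set.ncard_union_eq, h.kernel_ncard, add_comm]
  rw [Set.disjoint_left]
  intro v h1 h2
  simp only [Set.mem_ofPred_eq] at h1 h2
  omega

/-- The `s - q` vertices of degree two contribute `2 * (s - q)` to the degree sum `2 * (s + l)`. In
other words, the kernel has `l + q` edges. -/
lemma sum_kernel [DecidablePred (· ∈ {v | 3 ≤ C.ndeg v})] :
    ∑ v with v ∈ {v | 3 ≤ C.ndeg v}, C.ndeg v = 2 * (l + q) := by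
  classical
  have h1 := h.sum_ndeg
  have h2 := h.ncard_two
  rw [← Finset.sum_filter_add_sum_filter_not _ (fun v => v ∈ {v | 3 ≤ C.ndeg v})] at h1
  have h3 : ∑ v with ¬ v ∈ {v | 3 ≤ C.ndeg v}, C.ndeg v = 2 * {v | C.ndeg v = 2}.ncard := by
    rw [← card_filter_mem_eq_ncard, mul_comm, ← smul_eq_mul, ← Finset.sum_const]
    symm
    apply Finset.sum_subset_zero_on_sdiff
    · intro v hv
      simp only [Finset.mem_filter, Finset.mem_univ, Set.mem_ofPred_eq, true_and] at hv ⊢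
      omega
    · intro v hv
      simp only [Finset.mem_filter, Finset.mem_univ, Set.mem_ofPred_eq, true_and,
        Finset.mem_sdiff] at hv
      by_contra h0
      have := h.core.two_le v (mem_support_of_ndeg_pos (Nat.pos_of_ne_zero h0))
      omega
    · intro v hv
      simp only [Finset.mem_filter, Finset.mem_univ, Set.mem_ofPred_eq, true_and] at hv
      exact hv.symm
  rw [h3] at h1
  omega

lemma ncard_kernel_darts :
    {p : V × V | p.1 ∈ {v | 3 ≤ C.ndeg v} ∧ C.Adj p.1 p.2}.ncard = 2 * (l + q) := by
  classical
  rw [ncard_darts, h.sum_kernel]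

lemma kernel_le : q ≤ 2 * l := by
  classical
  have h1 := h.sum_kernel
  have h2 : {v | 3 ≤ C.ndeg v}.ncard * 3 ≤ ∑ v with v ∈ {v | 3 ≤ C.ndeg v}, C.ndeg v := by
    rw [← card_filter_mem_eq_ncard, ← smul_eq_mul]
    exact Finset.card_nsmul_le_sum _ _ _ fun v hv => by simpa using hv
  rw [h1, h.kernel_ncard] at h2
  omega

/-- The deficiency `2 * l - q` is the sum of the excesses of the kernel degrees over three, and only
vertices of degree at least four have a positive excess. -/
lemma le_ncard_large_darts :
    2 * l - q ≤ {p : V × V | p.1 ∈ {v | 4 ≤ C.ndeg v} ∧ C.Adj p.1 p.2}.ncard := by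
  classical
  rw [ncard_darts]
  have h1 := h.sum_kernel
  have h2 : ∑ v with v ∈ {v | 3 ≤ C.ndeg v}, (C.ndeg v - 3) + 3 * q = 2 * (l + q) := by
    rw [← h1, ← h.kernel_ncard, ← card_filter_mem_eq_ncard, mul_comm, ← smul_eq_mul,
      ← Finset.sum_const, ← Finset.sum_add_distrib]
    refine Finset.sum_congr rfl fun v hv => ?_
    have : 3 ≤ C.ndeg v := by simpa using hv
    omega
  have h3 : ∑ v with v ∈ {v | 3 ≤ C.ndeg v}, (C.ndeg v - 3) ≤
      ∑ v with v ∈ {v | 4 ≤ C.ndeg v}, C.ndeg v := by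
    rw [Finset.sum_filter, Finset.sum_filter]
    refine Finset.sum_le_sum fun v _ => ?_
    simp only [Set.mem_ofPred_eq]
    split_ifs <;> omega
  omega

variable (hF : C.IsFat)
include hF

/-- In a fat core no edge joins two kernel vertices, so the darts leaving kernel vertices and those
entering them are disjoint sets of `2 * (l + q)` darts each. -/
lemma ncard_inner_darts :
    {p : V × V | C.Adj p.1 p.2 ∧ C.ndeg p.1 = 2 ∧ C.ndeg p.2 = 2}.ncard + 4 * (l + q) =
      2 * (s + l) := by
  classical
  have h1 := h.ncard_kernel_darts
  have h2 : {p : V × V | p.2 ∈ {v | 3 ≤ C.ndeg v} ∧ C.Adj p.1 p.2}.ncard = 2 * (l + q) := by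
    rw [← h1]
    refine Set.ncard_congr (fun p _ => p.swap) ?_ ?_ ?_
    · rintro ⟨v, w⟩ hp; exact ⟨hp.1, hp.2.symm⟩
    · rintro p p' _ _ hpp; exact Prod.swap_injective hpp
    · rintro ⟨v, w⟩ hp; exact ⟨(w, v), ⟨hp.1, hp.2.symm⟩, rfl⟩
  have h3 : {p : V × V | p.1 ∈ (Set.univ : Set V) ∧ C.Adj p.1 p.2}.ncard = 2 * (s + l) := by
    rw [ncard_darts, ← h.sum_ndeg]; simp
  have h4 : {p : V × V | p.1 ∈ (Set.univ : Set V) ∧ C.Adj p.1 p.2} =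
      {p : V × V | C.Adj p.1 p.2 ∧ C.ndeg p.1 = 2 ∧ C.ndeg p.2 = 2} ∪
        ({p : V × V | p.1 ∈ {v | 3 ≤ C.ndeg v} ∧ C.Adj p.1 p.2} ∪
          {p : V × V | p.2 ∈ {v | 3 ≤ C.ndeg v} ∧ C.Adj p.1 p.2}) := by
    ext ⟨v, w⟩
    simp only [Set.mem_univ, true_and, Set.mem_union, Set.mem_ofPred_eq]
    constructor
    · intro hvw
      have a1 := h.core.two_le v ⟨w, hvw⟩
      have a2 := h.core.two_le w ⟨v, hvw.symm⟩
      by_cases b1 : 3 ≤ C.ndeg v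
      · exact Or.inr (Or.inl ⟨b1, hvw⟩)
      by_cases b2 : 3 ≤ C.ndeg w
      · exact Or.inr (Or.inr ⟨b2, hvw⟩)
      exact Or.inl ⟨hvw, by omega, by omega⟩
    · rintro (hp | hp | hp)
      · exact hp.1
      · exact hp.2
      · exact hp.2
  rw [h4, Set.ncard_union_eq, Set.ncard_union_eq, h1, h2] at h3
  · omega
  · rw [Set.disjoint_left]
    rintro ⟨v, w⟩ ⟨a1, a2⟩ ⟨b1, b2⟩
    simp only [Set.mem_ofPred_eq] at a1 b1
    have := (hF v w a1 a2).1
    omega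
  · rw [Set.disjoint_left]
    rintro ⟨v, w⟩ ⟨a1, a2, a3⟩ (⟨b1, b2⟩ | ⟨b1, b2⟩) <;>
    · simp only [Set.mem_ofPred_eq] at a2 a3 b1
      omega

/-- In a fat core the `2 * (l + q)` kernel darts lead to distinct vertices of degree two; all other
vertices of degree two are inner. -/
lemma ncard_inner :
    {x | C.ndeg x = 2 ∧ ∀ u, C.Adj x u → C.ndeg u = 2}.ncard + 2 * (l + q) + q = s := by
  have h1 := h.ncard_two
  have h2 : (Prod.snd '' {p : V × V | p.1 ∈ {v | 3 ≤ C.ndeg v} ∧ C.Adj p.1 p.2}).ncard =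
      2 * (l + q) := by
    rw [Set.InjOn.ncard_image, h.ncard_kernel_darts]
    rintro ⟨v, w⟩ ⟨a1, a2⟩ ⟨v', w'⟩ ⟨b1, b2⟩ heq
    simp only at heq
    subst heq
    rw [(hF v w a1 a2).2 v' b1 b2]
  have h3 : {v | C.ndeg v = 2} = {x | C.ndeg x = 2 ∧ ∀ u, C.Adj x u → C.ndeg u = 2} ∪
      (Prod.snd '' {p : V × V | p.1 ∈ {v | 3 ≤ C.ndeg v} ∧ C.Adj p.1 p.2}) := by
    ext x
    simp only [Set.mem_ofPred_eq, Set.mem_union, Set.mem_image, Prod.exists, exists_eq_right]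
    constructor
    · intro hx
      by_cases hu : ∀ u, C.Adj x u → C.ndeg u = 2
      · exact Or.inl ⟨hx, hu⟩
      · push Not at hu
        obtain ⟨u, hu1, hu2⟩ := hu
        have := h.core.two_le u ⟨x, hu1.symm⟩
        exact Or.inr ⟨u, by omega, hu1.symm⟩
    · rintro (hx | ⟨u, hu1, hu2⟩)
      · exact hx.1
      · exact (hF u x hu1 hu2).1
  rw [h3, Set.ncard_union_eq, h2] at h1
  · omega
  · rw [Set.disjoint_left]
    rintro x ⟨a1, a2⟩ ⟨⟨u, w⟩, ⟨b1, b2⟩, rfl⟩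
    have := a2 u b2.symm
    simp only [Set.mem_ofPred_eq] at b1
    omega

end IsCoreOf

lemma isFat_subdivide_iff {v w x : V} (hx : x ∉ C.support) (h : C.Adj v w) (hv : C.ndeg v = 2)
    (hw : C.ndeg w = 2) : (C.split v {w} x).IsFat ↔ C.IsFat := by
  have hadj : ∀ t u, 3 ≤ C.ndeg t → ((C.split v {w} x).Adj t u ↔ C.Adj t u) := by
    intro t u ht
    have htx : t ≠ x := ne_of_notMem_support hx (mem_support_of_ndeg_pos (by omega))
    have htv : t ≠ v := by rintro rfl; omega
    have htw : t ≠ w := by rintro rfl; omega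
    by_cases hux : u = x
    · subst hux
      rw [adj_comm, subdivide_adj_new_iff hx h, adj_comm]
      exact ⟨fun k => (k.elim htv htw).elim, fun k => absurd k (not_adj_of_notMem_support hx t)⟩
    · rw [subdivide_adj_iff htx hux]
      exact ⟨fun k => k.1, fun k => ⟨k, fun e => htv e.1, fun e => htw e.2⟩⟩
  unfold IsFat
  constructor
  · intro hf t u ht htu
    have h3 := (three_le_ndeg_subdivide hx h (u := t)).2 ht
    have hux : u ≠ x := ne_of_notMem_support hx ⟨t, htu.symm⟩
    obtain ⟨h1, h2⟩ := hf t u h3 ((hadj t u ht).2 htu)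
    rw [ndeg_subdivide hx h hux] at h1
    exact ⟨h1, fun t' ht' htu' => h2 t' ((three_le_ndeg_subdivide hx h).2 ht')
      ((hadj t' u ht').2 htu')⟩
  · intro hf t u ht htu
    rw [three_le_ndeg_subdivide hx h] at ht
    rw [hadj t u ht] at htu
    have hux : u ≠ x := ne_of_notMem_support hx ⟨t, htu.symm⟩
    obtain ⟨h1, h2⟩ := hf t u ht htu
    rw [ndeg_subdivide hx h hux]
    refine ⟨h1, fun t' ht' htu' => ?_⟩
    rw [three_le_ndeg_subdivide hx h] at ht'
    exact h2 t' ht' ((hadj t' u ht').1 htu')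

/-- Subdividing edges far from the kernel vertices. -/
lemma fat_subdivide_count (g l q B : ℕ) :
    {C : SimpleGraph V | IsCoreOf g l (2 * l + 3 * q + B) q C ∧ C.IsFat}.ncard *
      (2 * (l + q + B) * (Nat.card V - (2 * l + 3 * q + B))) =
    {C : SimpleGraph V | IsCoreOf g l (2 * l + 3 * q + B + 1) q C ∧ C.IsFat}.ncard *
      (2 * (B + 1)) := by
  set s := 2 * l + 3 * q + B with hs
  -- A fat core with an inner dart and an unused vertex corresponds to a larger fat core with an
  -- inner vertex `x` and one of its two neighbours. The inner darts number `2 * (l + q + B)` before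
  -- the subdivision, the inner vertices `B + 1` after it.
  set R₁ : Set (SimpleGraph V × ((V × V) × V)) := {t | (IsCoreOf g l s q t.1 ∧ t.1.IsFat) ∧
    (t.1.Adj t.2.1.1 t.2.1.2 ∧ t.1.ndeg t.2.1.1 = 2 ∧ t.1.ndeg t.2.1.2 = 2) ∧
      t.2.2 ∉ t.1.support} with hR₁
  set R₂ : Set (SimpleGraph V × (V × V)) := {t | (IsCoreOf g l (s + 1) q t.1 ∧ t.1.IsFat) ∧
    t.2.1 ∈ {x | t.1.ndeg x = 2 ∧ ∀ u, t.1.Adj x u → t.1.ndeg u = 2} ∧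
      t.1.Adj t.2.1 t.2.2} with hR₂
  have e₁ : R₁.ncard = {C : SimpleGraph V | IsCoreOf g l s q C ∧ C.IsFat}.ncard *
      (2 * (l + q + B) * (Nat.card V - s)) := by
    refine ncard_eq_mul_of_fiber (fun p hp => hp.1) ?_
    rintro C ⟨hC, hF⟩
    have : {b | (C, b) ∈ R₁} =
        {p : V × V | C.Adj p.1 p.2 ∧ C.ndeg p.1 = 2 ∧ C.ndeg p.2 = 2} ×ˢ C.supportᶜ := by
      ext b
      simp [hR₁, hC, hF]
    rw [this, Set.ncard_prod, Set.ncard_compl, hC.support_ncard]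
    have := hC.ncard_inner_darts hF
    congr 1
    omega
  have e₂ : R₂.ncard = {C : SimpleGraph V | IsCoreOf g l (s + 1) q C ∧ C.IsFat}.ncard *
      (2 * (B + 1)) := by
    refine ncard_eq_mul_of_fiber (fun p hp => hp.1) ?_
    rintro C ⟨hC, hF⟩
    have : {b | (C, b) ∈ R₂} =
        {p : V × V | p.1 ∈ {x | C.ndeg x = 2 ∧ ∀ u, C.Adj x u → C.ndeg u = 2} ∧
          C.Adj p.1 p.2} := by
      ext b
      simp [hR₂, hC, hF]
    classical
    rw [this, ncard_darts, Finset.sum_congr rfl (g := fun _ => 2), Finset.sum_const,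
      card_filter_mem_eq_ncard, smul_eq_mul, mul_comm]
    · have := hC.ncard_inner hF
      congr 1
      omega
    · intro x hx
      have : C.ndeg x = 2 ∧ ∀ u, C.Adj x u → C.ndeg u = 2 := by simpa using hx
      exact this.1
  rw [← e₁, ← e₂]
  refine Set.ncard_congr (fun t _ => (t.1.split t.2.1.1 {t.2.1.2} t.2.2, (t.2.2, t.2.1.1))) ?_ ?_ ?_
  · rintro ⟨C, ⟨v, w⟩, x⟩ ⟨⟨hC, hF⟩, ⟨hvw, hv, hw⟩, hx⟩
    simp only at hC hF hvw hv hw hx ⊢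
    refine ⟨⟨(isCoreOf_subdivide_iff hx hvw).2 hC, (isFat_subdivide_iff hx hvw hv hw).2 hF⟩,
      ⟨ndeg_subdivide_new hx hvw, ?_⟩, (subdivide_adj_new_iff hx hvw).2 (Or.inl rfl)⟩
    intro u hu
    rw [subdivide_adj_new_iff hx hvw] at hu
    rcases hu with rfl | rfl
    · rwa [ndeg_subdivide hx hvw (ne_of_adj_of_notMem hx hvw)]
    · rwa [ndeg_subdivide hx hvw (ne_of_adj_of_notMem hx hvw.symm)]
  · rintro ⟨C, ⟨v, w⟩, x⟩ ⟨C', ⟨v', w'⟩, x'⟩ ⟨-, ⟨hvw, -⟩, hx⟩ ⟨-, ⟨hvw', -⟩, hx'⟩ heq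
    simp only [Prod.mk.injEq] at heq hvw hx hvw' hx'
    obtain ⟨h1, rfl, rfl⟩ := heq
    have hCC : C = C' := by
      rw [← merge_subdivide hx hvw, h1, merge_subdivide hx' hvw']
    have hww : w = w' := by
      have : (C'.split v {w'} x).Adj x w := by
        rw [← h1]; exact (subdivide_adj_new_iff hx hvw).2 (Or.inr rfl)
      rw [subdivide_adj_new_iff hx' hvw'] at this
      exact this.resolve_left hvw.ne.symm
    rw [hCC, hww]
  · rintro ⟨C, x, v⟩ ⟨⟨hC, hF⟩, ⟨hx2, hx⟩, hxv⟩
    simp only at hC hF hx2 hx hxv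
    obtain ⟨w, hne, hN⟩ := exists_neighborSet_eq hx2 hxv
    have hxw : C.Adj x w := by
      have : w ∈ C.neighborSet x := by rw [hN]; exact Or.inr rfl
      exact this
    obtain ⟨h1, h2, h3⟩ := exists_eq_subdivide hN hne
      (hC.core.not_adj hN hne (hx v hxv) (hx w hxw))
    set C₀ := C.merge v x
    have hv2 : C₀.ndeg v = 2 := by
      rw [← ndeg_subdivide h1 h2 (ne_of_adj_of_notMem h1 h2), h3, hx v hxv]
    have hw2 : C₀.ndeg w = 2 := by
      rw [← ndeg_subdivide h1 h2 (ne_of_adj_of_notMem h1 h2.symm), h3, hx w hxw]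
    refine ⟨(C₀, (v, w), x), ⟨⟨?_, ?_⟩, ⟨h2, hv2, hw2⟩, h1⟩, by simp only [h3]⟩
    · rw [← isCoreOf_subdivide_iff h1 h2, h3]; exact hC
    · rw [← isFat_subdivide_iff h1 h2 hv2 hw2, h3]; exact hF

/-- A set of kernel darts that lead to distinct vertices of degree two. -/
structure IsMarking (C : SimpleGraph V) (J : Set (V × V)) : Prop where
  three_le : ∀ p ∈ J, 3 ≤ C.ndeg p.1
  adj : ∀ p ∈ J, C.Adj p.1 p.2
  eq_two : ∀ p ∈ J, C.ndeg p.2 = 2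
  injOn : Set.InjOn Prod.snd J

/-- Subdividing edges next to kernel vertices. -/
lemma marked_subdivide_count (g l q s i : ℕ) :
    {t : SimpleGraph V × Set (V × V) | IsCoreOf g l s q t.1 ∧ t.1.IsMarking t.2 ∧
      t.2.ncard = i}.ncard * ((2 * (l + q) - i) * (Nat.card V - s)) ≤
    {t : SimpleGraph V × Set (V × V) | IsCoreOf g l (s + 1) q t.1 ∧ t.1.IsMarking t.2 ∧
      t.2.ncard = i + 1}.ncard * (i + 1) := by
  set R₁ : Set ((SimpleGraph V × Set (V × V)) × ((V × V) × V)) :=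
    {t | (IsCoreOf g l s q t.1.1 ∧ t.1.1.IsMarking t.1.2 ∧ t.1.2.ncard = i) ∧
      ((3 ≤ t.1.1.ndeg t.2.1.1 ∧ t.1.1.Adj t.2.1.1 t.2.1.2) ∧ t.2.1 ∉ t.1.2) ∧
      t.2.2 ∉ t.1.1.support} with hR₁
  set R₂ : Set ((SimpleGraph V × Set (V × V)) × (V × V)) :=
    {t | (IsCoreOf g l (s + 1) q t.1.1 ∧ t.1.1.IsMarking t.1.2 ∧ t.1.2.ncard = i + 1) ∧
      t.2 ∈ t.1.2} with hR₂
  have e₁ : R₁.ncard = {t : SimpleGraph V × Set (V × V) | IsCoreOf g l s q t.1 ∧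
      t.1.IsMarking t.2 ∧ t.2.ncard = i}.ncard * ((2 * (l + q) - i) * (Nat.card V - s)) := by
    refine ncard_eq_mul_of_fiber (fun p hp => hp.1) ?_
    rintro ⟨C, J⟩ ⟨hC, hJ, hi⟩
    simp only at hC hJ hi
    have : {b | ((C, J), b) ∈ R₁} =
        ({p : V × V | p.1 ∈ {v | 3 ≤ C.ndeg v} ∧ C.Adj p.1 p.2} \ J) ×ˢ C.supportᶜ := by
      ext b
      simp [hR₁, hC, hJ, hi]
    rw [this, Set.ncard_prod, Set.ncard_compl, hC.support_ncard, Set.ncard_sdiff,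
      hC.ncard_kernel_darts, hi]
    exact fun p hp => ⟨hJ.three_le p hp, hJ.adj p hp⟩
  have e₂ : R₂.ncard = {t : SimpleGraph V × Set (V × V) | IsCoreOf g l (s + 1) q t.1 ∧
      t.1.IsMarking t.2 ∧ t.2.ncard = i + 1}.ncard * (i + 1) := by
    refine ncard_eq_mul_of_fiber (fun p hp => hp.1) ?_
    rintro ⟨C, J⟩ ⟨hC, hJ, hi⟩
    simp only at hC hJ hi
    rw [← hi]
    congr 1
    ext b
    simp [hR₂, hC, hJ, hi]
  rw [← e₁, ← e₂]
  -- The map is merely injective: suppressing a marked vertex could create a double edge. Marks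
  -- record which kernel darts have already been treated.
  refine Set.ncard_le_ncard_of_injOn (fun t => ((t.1.1.split t.2.1.1 {t.2.1.2} t.2.2,
    insert (t.2.1.1, t.2.2) t.1.2), (t.2.1.1, t.2.2))) ?_ ?_
  · rintro ⟨⟨C, J⟩, ⟨v, w⟩, x⟩ ⟨⟨hC, hJ, hi⟩, ⟨⟨hv, hvw⟩, hJv⟩, hx⟩
    simp only at hC hJ hi hv hvw hJv hx ⊢
    have hxJ : ∀ p ∈ J, p.2 ≠ x := fun p hp => ne_of_notMem_support hx ⟨_, (hJ.adj p hp).symm⟩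
    have hxJ' : ∀ p ∈ J, p.1 ≠ x := fun p hp => ne_of_notMem_support hx ⟨_, hJ.adj p hp⟩
    refine ⟨⟨(isCoreOf_subdivide_iff hx hvw).2 hC, ⟨?_, ?_, ?_, ?_⟩, ?_⟩, Set.mem_insert _ _⟩
    · rintro p (rfl | hp)
      · exact (three_le_ndeg_subdivide hx hvw).2 hv
      · exact (three_le_ndeg_subdivide hx hvw).2 (hJ.three_le p hp)
    · rintro p (rfl | hp)
      · exact subdivide_adj_left hx hvw
      · show (C.split v {w} x).Adj p.1 p.2
        rw [subdivide_adj_iff (hxJ' p hp) (hxJ p hp)]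
        refine ⟨hJ.adj p hp, ?_, ?_⟩
        · rintro ⟨h1, h2⟩
          apply hJv
          rwa [← h1, ← h2]
        · rintro ⟨h1, h2⟩
          have := hJ.eq_two p hp
          rw [h1] at this
          omega
    · rintro p (rfl | hp)
      · exact ndeg_subdivide_new hx hvw
      · show (C.split v {w} x).ndeg p.2 = 2
        rw [ndeg_subdivide hx hvw (hxJ p hp)]
        exact hJ.eq_two p hp
    · rw [Set.injOn_insert]
      · refine ⟨hJ.injOn, ?_⟩
        rintro ⟨p, hp, h⟩
        exact hxJ p hp h
      · exact fun h => hxJ _ h rfl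
    · show (insert (v, x) J).ncard = i + 1
      rw [Set.ncard_insert_of_notMem (fun h => hxJ _ h rfl), hi]
  · rintro ⟨⟨C, J⟩, ⟨v, w⟩, x⟩ ⟨⟨-, hJ, -⟩, ⟨⟨-, hvw⟩, -⟩, hx⟩ ⟨⟨C', J'⟩, ⟨v', w'⟩, x'⟩
      ⟨⟨-, hJ', -⟩, ⟨⟨-, hvw'⟩, -⟩, hx'⟩ heq
    simp only [Prod.mk.injEq] at heq hvw hx hvw' hx' hJ hJ'
    obtain ⟨⟨h1, h2⟩, rfl, rfl⟩ := heq
    have hCC : C = C' := by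
      rw [← merge_subdivide hx hvw, h1, merge_subdivide hx' hvw']
    have hww : w = w' := by
      have : (C'.split v {w'} x).Adj x w := by
        rw [← h1]; exact (subdivide_adj_new_iff hx hvw).2 (Or.inr rfl)
      rw [subdivide_adj_new_iff hx' hvw'] at this
      exact this.resolve_left hvw.ne.symm
    have n1 : (v, x) ∉ J := fun k => hx ⟨_, (hJ.adj _ k).symm⟩
    have n2 : (v, x) ∉ J' := fun k => hx' ⟨_, (hJ'.adj _ k).symm⟩
    have hJJ : J = J' := by
      rw [← Set.insert_sdiff_self_of_notMem n1, h2, Set.insert_sdiff_self_of_notMem n2]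
    rw [hCC, hww, hJJ]

/-- The kernel darts are marked one at a time, starting from the empty marking; `i.factorial`
accounts for the order, which the marked set forgets. -/
lemma marked_count_le (g l q s i : ℕ) :
    {C : SimpleGraph V | IsCoreOf g l s q C}.ncard * ((2 * (l + q)).descFactorial i *
      (Nat.card V - s).descFactorial i) ≤
    {t : SimpleGraph V × Set (V × V) | IsCoreOf g l (s + i) q t.1 ∧ t.1.IsMarking t.2 ∧
      t.2.ncard = i}.ncard * i.factorial := by
  induction i with
  | zero =>
    simp only [Nat.descFactorial_zero, mul_one, Nat.factorial_zero, add_zero]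
    refine Set.ncard_le_ncard_of_injOn (fun C => (C, ∅)) ?_ ?_
    · intro C hC
      exact ⟨hC, ⟨by simp, by simp, by simp, by simp⟩, by simp⟩
    · intro C _ C' _ h
      exact congrArg Prod.fst h
  | succ i ih =>
    have h := marked_subdivide_count (V := V) g l q (s + i) i
    rw [Nat.descFactorial_succ, Nat.descFactorial_succ, Nat.factorial_succ]
    calc _ = ({C : SimpleGraph V | IsCoreOf g l s q C}.ncard * ((2 * (l + q)).descFactorial i *
          (Nat.card V - s).descFactorial i)) *
          ((2 * (l + q) - i) * (Nat.card V - s - i)) := by ring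
      _ ≤ _ := Nat.mul_le_mul_right _ ih
      _ = (_ * ((2 * (l + q) - i) * (Nat.card V - (s + i)))) * i.factorial := by
          rw [Nat.sub_sub]; ring
      _ ≤ _ := Nat.mul_le_mul_right _ h
      _ = _ := by rw [add_assoc]; ring

/-- Once `2 * (l + q)` kernel darts are marked, all of them are. The core is then fat and determines
its marking, so marked cores are no more numerous than fat ones, and the factorials cancel. -/
lemma core_count_le_fat (g l q s : ℕ) :
    {C : SimpleGraph V | IsCoreOf g l s q C}.ncard *
      (Nat.card V - s).descFactorial (2 * (l + q)) ≤
    {C : SimpleGraph V | IsCoreOf g l (s + 2 * (l + q)) q C ∧ C.IsFat}.ncard := by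
  have h := marked_count_le (V := V) g l q s (2 * (l + q))
  rw [Nat.descFactorial_self] at h
  have hpos := Nat.factorial_pos (2 * (l + q))
  have h' : {C : SimpleGraph V | IsCoreOf g l s q C}.ncard *
      (Nat.card V - s).descFactorial (2 * (l + q)) ≤ {t : SimpleGraph V × Set (V × V) |
        IsCoreOf g l (s + 2 * (l + q)) q t.1 ∧ t.1.IsMarking t.2 ∧
          t.2.ncard = 2 * (l + q)}.ncard := by
    refine le_of_mul_le_mul_right ?_ hpos
    calc _ = _ := by ring
      _ ≤ _ := h
  refine h'.trans (Set.ncard_le_ncard_of_injOn Prod.fst ?_ ?_)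
  all_goals
    have key : ∀ (C : SimpleGraph V) (J : Set (V × V)), IsCoreOf g l (s + 2 * (l + q)) q C →
        C.IsMarking J → J.ncard = 2 * (l + q) →
        J = {p : V × V | p.1 ∈ {v | 3 ≤ C.ndeg v} ∧ C.Adj p.1 p.2} := by
      intro C J hC hJ hi
      apply Set.eq_of_subset_of_ncard_le
      · exact fun p hp => ⟨hJ.three_le p hp, hJ.adj p hp⟩
      · rw [hC.ncard_kernel_darts, hi]
      · exact Set.toFinite _
  · rintro ⟨C, J⟩ ⟨hC, hJ, hi⟩
    refine ⟨hC, ?_⟩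
    have hk := key C J hC hJ hi
    intro v w hv hvw
    simp only at hv hvw
    have hm : ∀ v, 3 ≤ C.ndeg v → C.Adj v w → (v, w) ∈ J := by
      intro v h1 h2
      rw [hk]; exact ⟨h1, h2⟩
    refine ⟨hJ.eq_two _ (hm v hv hvw), fun v' hv' hvw' => ?_⟩
    exact congrArg Prod.fst (hJ.injOn (hm v' hv' hvw') (hm v hv hvw) rfl)
  · rintro ⟨C, J⟩ ⟨hC, hJ, hi⟩ ⟨C', J'⟩ ⟨hC', hJ', hi'⟩ heq
    simp only at heq hC hJ hi hC' hJ' hi'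
    subst heq
    rw [key C J hC hJ hi, key C J' hC' hJ' hi']

end SimpleGraph

/-! ### Splitting kernel vertices -/

namespace SimpleGraph

/-! ### Splitting a vertex by a path with two inner vertices, so that fat cores stay fat. -/

section Expand

variable {V : Type*}

/-- The vertex `v` is split by a path `v, y 1, y 2, y 0` whose end takes over the neighbours of `v`
in `A`. -/
def expand (C : SimpleGraph V) (v : V) (A : Set V) (y : Fin 3 → V) : SimpleGraph V :=
  ((C.split v A (y 0)).split v {y 0} (y 1)).split (y 1) {y 0} (y 2)

variable {C : SimpleGraph V} {v : V} {A : Set V} {y : Fin 3 → V}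
  (hy : ∀ i, y i ∉ C.support) (hyi : Function.Injective y) (hA : ∀ u ∈ A, C.Adj v u)
  (hv : v ∈ C.support)
include hy hyi hA hv

lemma expand_adj_split : (C.split v A (y 0)).Adj v (y 0) :=
  ⟨ne_of_notMem_support (hy 0) hv, Or.inr (Or.inr ⟨rfl, Or.inr rfl⟩)⟩

lemma expand_notMem_one : y 1 ∉ (C.split v A (y 0)).support := by
  rw [support_split (hy 0) hA (ne_of_notMem_support (hy 0) hv) hv]
  rintro (h | h)
  · exact absurd (hyi h) (by decide)
  · exact hy 1 h

lemma expand_adj_subdivide : ((C.split v A (y 0)).split v {y 0} (y 1)).Adj (y 1) (y 0) :=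
  (subdivide_adj_right (expand_notMem_one hy hyi hA hv) (expand_adj_split hy hyi hA hv)).symm

lemma expand_notMem_two : y 2 ∉ ((C.split v A (y 0)).split v {y 0} (y 1)).support := by
  rw [support_subdivide (expand_notMem_one hy hyi hA hv) (expand_adj_split hy hyi hA hv),
    support_split (hy 0) hA (ne_of_notMem_support (hy 0) hv) hv]
  rintro (h | h | h)
  · exact absurd (hyi h) (by decide)
  · exact absurd (hyi h) (by decide)
  · exact hy 2 h

lemma expand_adj_two_iff {u : V} : (C.expand v A y).Adj (y 2) u ↔ u = y 1 ∨ u = y 0 :=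
  subdivide_adj_new_iff (expand_notMem_two hy hyi hA hv) (expand_adj_subdivide hy hyi hA hv)

lemma expand_adj_one_iff {u : V} (hu : u ≠ y 2) :
    (C.expand v A y).Adj (y 1) u ↔ u = v := by
  have h1 : y 1 ≠ y 2 := fun h => absurd (hyi h) (by decide)
  unfold expand
  rw [subdivide_adj_iff h1 hu,
    subdivide_adj_new_iff (expand_notMem_one hy hyi hA hv) (expand_adj_split hy hyi hA hv)]
  constructor
  · rintro ⟨h | h, h2, -⟩
    · exact h
    · exact absurd ⟨rfl, h⟩ h2
  · rintro rfl
    have h0 : u ≠ y 0 := ne_of_notMem_support (hy 0) hv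
    have h1 : u ≠ y 1 := ne_of_notMem_support (hy 1) hv
    exact ⟨Or.inl rfl, fun k => h0 k.2, fun k => h1 k.1⟩

lemma expand_adj_iff {t u : V} (ht1 : t ≠ y 1) (ht2 : t ≠ y 2) (hu1 : u ≠ y 1) (hu2 : u ≠ y 2) :
    (C.expand v A y).Adj t u ↔ (C.Adj t u ∧ ¬(t = v ∧ u ∈ A) ∧ ¬(u = v ∧ t ∈ A)) ∨
      (t = y 0 ∧ u ∈ A) ∨ (u = y 0 ∧ t ∈ A) := by
  have hv0 : v ≠ y 0 := ne_of_notMem_support (hy 0) hv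
  have hA0 : ∀ u ∈ A, u ≠ y 0 := fun u hu => ne_of_notMem_support (hy 0) ⟨v, (hA u hu).symm⟩
  have hC0 : ∀ {a b}, C.Adj a b → a ≠ y 0 := fun h => ne_of_notMem_support (hy 0) ⟨_, h⟩
  unfold expand
  rw [subdivide_adj_iff ht2 hu2, subdivide_adj_iff ht1 hu1]
  constructor
  · rintro ⟨⟨⟨hne, h | ⟨rfl, h | rfl⟩ | ⟨rfl, h | rfl⟩⟩, h2, h3⟩, -⟩
    · exact Or.inl h
    · exact Or.inr (Or.inl ⟨rfl, h⟩)
    · exact absurd ⟨rfl, rfl⟩ h3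
    · exact Or.inr (Or.inr ⟨rfl, h⟩)
    · exact absurd ⟨rfl, rfl⟩ h2
  · intro h
    refine ⟨⟨?_, ?_, ?_⟩, fun k => ht1 k.1, fun k => hu1 k.1⟩
    · rcases h with h | ⟨rfl, h⟩ | ⟨rfl, h⟩
      · exact ⟨h.1.ne, Or.inl h⟩
      · exact ⟨(hA0 u h).symm, Or.inr (Or.inl ⟨rfl, Or.inl h⟩)⟩
      · exact ⟨hA0 t h, Or.inr (Or.inr ⟨rfl, Or.inl h⟩)⟩
    · rintro ⟨rfl, rfl⟩
      rcases h with h | ⟨h, -⟩ | ⟨-, h⟩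
      · exact hC0 h.1.symm rfl
      · exact hv0 h
      · exact (hA _ h).ne rfl
    · rintro ⟨rfl, rfl⟩
      rcases h with h | ⟨-, h⟩ | ⟨h, -⟩
      · exact hC0 h.1 rfl
      · exact (hA _ h).ne rfl
      · exact hv0 h

lemma merge_expand : (((C.expand v A y).merge (y 1) (y 2)).merge v (y 1)).merge v (y 0) = C := by
  unfold expand
  rw [merge_subdivide (expand_notMem_two hy hyi hA hv) (expand_adj_subdivide hy hyi hA hv),
    merge_subdivide (expand_notMem_one hy hyi hA hv) (expand_adj_split hy hyi hA hv),
    merge_split (hy 0) hA (ne_of_notMem_support (hy 0) hv)]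

lemma expand_adj_zero_iff {u : V} (hu : u ≠ y 2) :
    (C.expand v A y).Adj (y 0) u ↔ u ∈ A := by
  have h01 : y 0 ≠ y 1 := fun h => absurd (hyi h) (by decide)
  have h02 : y 0 ≠ y 2 := fun h => absurd (hyi h) (by decide)
  by_cases hu1 : u = y 1
  · subst hu1
    rw [adj_comm, expand_adj_one_iff hy hyi hA hv h02]
    exact ⟨fun h => absurd h.symm (ne_of_notMem_support (hy 0) hv),
      fun h => absurd rfl (ne_of_notMem_support (hy 1) ⟨v, (hA _ h).symm⟩)⟩
  · rw [expand_adj_iff hy hyi hA hv h01 h02 hu1 hu]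
    constructor
    · rintro (h | h | h)
      · exact absurd h.1 (not_adj_of_notMem_support (hy 0) u)
      · exact h.2
      · exact absurd rfl (ne_of_notMem_support (hy 0) ⟨v, (hA _ h.2).symm⟩)
    · exact fun h => Or.inr (Or.inl ⟨rfl, h⟩)

end Expand

variable {V : Type*} [Fintype V] {C : SimpleGraph V} {g l s q : ℕ}

/-- Moving two neighbours gives `x` degree three and lowers the degree of `v` by one, which leaves
at least three: exactly one kernel vertex is gained. -/
lemma IsCoreOf.split {v a b x : V} (h : IsCoreOf g l s q C) (hx : x ∉ C.support)
    (hv : 4 ≤ C.ndeg v) (ha : C.Adj v a) (hb : C.Adj v b) (hab : a ≠ b)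
    (hd : (C.split v {a, b} x).DrawableOn g) :
    IsCoreOf g l (s + 1) (q + 1) (C.split v {a, b} x) := by
  have hA : ∀ u ∈ ({a, b} : Set V), C.Adj v u := by
    rintro u (rfl | rfl)
    exacts [ha, hb]
  have hvs : v ∈ C.support := ⟨a, ha⟩
  have hvx := ne_of_notMem_support hx hvs
  have h2 : ({a, b} : Set V).ncard = 2 := Set.ncard_pair hab
  have e1 := ndeg_split_new hx hA hvx
  have e2 := ndeg_split_old hx hA hvx
  refine ⟨h.core.split hx hA hvx hvs (by omega) (by omega) (by omega), hd, ?_, ?_, ?_⟩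
  · rw [support_split hx hA hvx hvs, Set.ncard_insert_of_notMem hx, h.support_ncard]
  · have : {u | 3 ≤ (C.split v {a, b} x).ndeg u} = insert x {u | 3 ≤ C.ndeg u} := by
      ext u
      simp only [Set.mem_ofPred_eq, Set.mem_insert_iff]
      by_cases hux : u = x
      · subst hux; simp; omega
      by_cases huv : u = v
      · subst huv; constructor
        · intro _; right; omega
        · intro _; omega
      · rw [ndeg_split_of_ne hx hA hvx huv hux]; simp [hux]
    rw [this, Set.ncard_insert_of_notMem, h.kernel_ncard]
    simp [ndeg_eq_zero hx]
  · rw [sum_ndeg_split hx hA hvx, h.sum_ndeg]; ring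

section

variable {v a b : V} {y : Fin 3 → V} (h : IsCoreOf g l s q C) (hF : C.IsFat)
  (hy : ∀ i, y i ∉ C.support) (hyi : Function.Injective y) (hv : 4 ≤ C.ndeg v) (ha : C.Adj v a)
  (hb : C.Adj v b) (hab : a ≠ b) (hd : (C.split v {a, b} (y 0)).DrawableOn g)
include hy hyi ha hb

lemma adj_pair : ∀ u ∈ ({a, b} : Set V), C.Adj v u := by
  rintro u (rfl | rfl)
  exacts [ha, hb]

lemma ndeg_expand_zero (hab : a ≠ b) : (C.expand v {a, b} y).ndeg (y 0) = 3 := by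
  have hA : ∀ u ∈ ({a, b} : Set V), C.Adj v u := adj_pair hy hyi ha hb
  have hvs : v ∈ C.support := ⟨a, ha⟩
  rw [expand, ndeg_subdivide (expand_notMem_two hy hyi hA hvs) (expand_adj_subdivide hy hyi hA hvs)
    (fun h => absurd (hyi h) (by decide)), ndeg_subdivide (expand_notMem_one hy hyi hA hvs)
    (expand_adj_split hy hyi hA hvs) (fun h => absurd (hyi h) (by decide)),
    ndeg_split_new (hy 0) hA (ne_of_notMem_support (hy 0) hvs), Set.ncard_pair hab]

include hab h hv hd

lemma IsCoreOf.expand : IsCoreOf g l (s + 3) (q + 1) (C.expand v {a, b} y) := by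
  have hA : ∀ u ∈ ({a, b} : Set V), C.Adj v u := adj_pair hy hyi ha hb
  have hvs : v ∈ C.support := ⟨a, ha⟩
  rw [SimpleGraph.expand, isCoreOf_subdivide_iff (expand_notMem_two hy hyi hA hvs)
    (expand_adj_subdivide hy hyi hA hvs), isCoreOf_subdivide_iff (expand_notMem_one hy hyi hA hvs)
    (expand_adj_split hy hyi hA hvs)]
  exact h.split (hy 0) hv ha hb hab hd

include hF

/-- The new kernel edge is subdivided by `y 1` and `y 2`. The moved darts now start at `y 0` but
lead to the same vertices of degree two as before. -/
lemma IsFat.expand : (C.expand v {a, b} y).IsFat := by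
  set A : Set V := {a, b} with hAdef
  have hA : ∀ u ∈ A, C.Adj v u := adj_pair hy hyi ha hb
  have hvs : v ∈ C.support := ⟨a, ha⟩
  have hv0 := ne_of_notMem_support (hy 0) hvs
  have hv1 := ne_of_notMem_support (hy 1) hvs
  have hv2 := ne_of_notMem_support (hy 2) hvs
  have h01 : y 0 ≠ y 1 := fun h => absurd (hyi h) (by decide)
  have h02 : y 0 ≠ y 2 := fun h => absurd (hyi h) (by decide)
  have h12 : y 1 ≠ y 2 := fun h => absurd (hyi h) (by decide)
  have n1 := expand_notMem_one hy hyi hA hvs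
  have a1 := expand_adj_split hy hyi hA hvs
  have n2 := expand_notMem_two hy hyi hA hvs
  have a2 := expand_adj_subdivide hy hyi hA hvs
  have d2 : (C.expand v A y).ndeg (y 2) = 2 := ndeg_subdivide_new n2 a2
  have d1 : (C.expand v A y).ndeg (y 1) = 2 := by
    rw [SimpleGraph.expand, ndeg_subdivide n2 a2 h12, ndeg_subdivide_new n1 a1]
  have dC : ∀ u ∈ C.support, u ≠ v → (C.expand v A y).ndeg u = C.ndeg u := by
    intro u hu huv
    rw [SimpleGraph.expand, ndeg_subdivide n2 a2 (ne_of_notMem_support (hy 2) hu),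
      ndeg_subdivide n1 a1 (ne_of_notMem_support (hy 1) hu), ndeg_split_of_ne (hy 0) hA hv0 huv
      (ne_of_notMem_support (hy 0) hu)]
  have hK : ∀ t, 3 ≤ (C.expand v A y).ndeg t → t ≠ y 1 ∧ t ≠ y 2 ∧
      (t = y 0 ∨ (t ≠ y 0 ∧ 3 ≤ C.ndeg t)) := by
    intro t ht
    have t1 : t ≠ y 1 := by rintro rfl; omega
    have t2 : t ≠ y 2 := by rintro rfl; omega
    refine ⟨t1, t2, ?_⟩
    by_cases t0 : t = y 0
    · exact Or.inl t0
    refine Or.inr ⟨t0, ?_⟩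
    by_cases tv : t = v
    · rw [tv]; omega
    rw [SimpleGraph.expand, ndeg_subdivide n2 a2 t2, ndeg_subdivide n1 a1 t1,
      ndeg_split_of_ne (hy 0) hA hv0 tv t0] at ht
    exact ht
  have hAK : ∀ u ∈ A, C.ndeg u = 2 := fun u hu => (hF v u (by omega) (hA u hu)).1
  -- The darts leaving kernel vertices are the two end darts of the new path, the moved darts and
  -- the untouched ones. Fatness is then checked for each pair of kinds.
  have hadj : ∀ t u, 3 ≤ (C.expand v A y).ndeg t → (C.expand v A y).Adj t u →
      (u = y 2 ∧ t = y 0) ∨ (u = y 1 ∧ t = v) ∨ (t = y 0 ∧ u ∈ A) ∨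
        (3 ≤ C.ndeg t ∧ C.Adj t u ∧ ¬(t = v ∧ u ∈ A)) := by
    intro t u ht htu
    obtain ⟨t1, t2, t3⟩ := hK t ht
    by_cases u2 : u = y 2
    · rw [u2, adj_comm, expand_adj_two_iff hy hyi hA hvs] at htu
      exact Or.inl ⟨u2, htu.resolve_left t1⟩
    by_cases u1 : u = y 1
    · rw [u1, adj_comm, expand_adj_one_iff hy hyi hA hvs t2] at htu
      exact Or.inr (Or.inl ⟨u1, htu⟩)
    rw [expand_adj_iff hy hyi hA hvs t1 t2 u1 u2] at htu
    rcases htu with k | k | k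
    · refine Or.inr (Or.inr (Or.inr ⟨?_, k.1, k.2.1⟩))
      rcases t3 with t3 | t3
      · exact absurd (t3 ▸ k.1) (not_adj_of_notMem_support (hy 0) u)
      · exact t3.2
    · exact Or.inr (Or.inr (Or.inl k))
    · exfalso
      rcases t3 with t3 | t3
      · exact hy 0 ⟨v, by rw [← t3]; exact (hA t k.2).symm⟩
      · have := hAK t k.2
        omega
  intro t u ht htu
  have hu2 : ∀ t, 3 ≤ C.ndeg t → C.Adj t u → (C.expand v A y).ndeg u = 2 := by
    intro t ht htu
    have := (hF t u ht htu).1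
    rw [dC u ⟨t, htu.symm⟩ (by rintro rfl; omega), this]
  have hCy : ∀ i, ¬ C.Adj t (y i) := fun i k => not_adj_of_notMem_support (hy i) t k.symm
  have hCy' : ∀ t' i, ¬ C.Adj t' (y i) := fun t' i k => not_adj_of_notMem_support (hy i) t' k.symm
  have hAy : ∀ i, y i ∉ A := fun i k => hy i ⟨v, (hA _ k).symm⟩
  rcases hadj t u ht htu with ⟨rfl, k⟩ | ⟨rfl, k⟩ | ⟨k1, k2⟩ | ⟨k1, k2, k3⟩
  · refine ⟨d2, fun t' ht' htu' => ?_⟩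
    rcases hadj t' _ ht' htu' with ⟨-, m⟩ | ⟨m, -⟩ | ⟨-, m⟩ | ⟨-, m, -⟩
    · rw [m, k]
    · exact absurd m h12.symm
    · exact absurd m (hAy 2)
    · exact absurd m (hCy' _ 2)
  · refine ⟨d1, fun t' ht' htu' => ?_⟩
    rcases hadj t' _ ht' htu' with ⟨m, -⟩ | ⟨-, m⟩ | ⟨-, m⟩ | ⟨-, m, -⟩
    · exact absurd m h12
    · rw [m, k]
    · exact absurd m (hAy 1)
    · exact absurd m (hCy' _ 1)
  · refine ⟨hu2 v (by omega) (hA u k2), fun t' ht' htu' => ?_⟩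
    rcases hadj t' _ ht' htu' with ⟨m, -⟩ | ⟨m, -⟩ | ⟨m, -⟩ | ⟨m1, m2, m3⟩
    · exact absurd (m ▸ k2) (hAy 2)
    · exact absurd (m ▸ k2) (hAy 1)
    · rw [m, k1]
    · exact absurd ⟨(hF v u (by omega) (hA u k2)).2 t' m1 m2, k2⟩ m3
  · refine ⟨hu2 t k1 k2, fun t' ht' htu' => ?_⟩
    rcases hadj t' _ ht' htu' with ⟨m, -⟩ | ⟨m, -⟩ | ⟨m1, m2⟩ | ⟨m1, m2, m3⟩
    · exact absurd (m ▸ k2) (hCy 2)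
    · exact absurd (m ▸ k2) (hCy 1)
    · exact absurd ⟨(hF v u (by omega) (hA u m2)).2 t k1 k2, m2⟩ k3
    · exact (hF t u k1 k2).2 t' m1 m2

end

/-- Splitting kernel vertices of degree at least four. -/
lemma fat_split_count (g l q s : ℕ) :
    {C : SimpleGraph V | IsCoreOf g l s q C ∧ C.IsFat}.ncard *
      ((2 * l - q) * (Nat.card V - s).descFactorial 3) ≤
    {C : SimpleGraph V | IsCoreOf g l (s + 3) (q + 1) C ∧ C.IsFat}.ncard * (9 * (q + 1)) := by
  classical
  have hb : ∀ (C : SimpleGraph V) (v a x : V), ∃ b, IsCoreOf g l s q C → 4 ≤ C.ndeg v →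
      C.Adj v a → x ∉ C.support → C.Adj v b ∧ b ≠ a ∧ (C.split v {a, b} x).DrawableOn g := by
    intro C v a x
    by_cases hh : IsCoreOf g l s q C ∧ 4 ≤ C.ndeg v ∧ C.Adj v a ∧ x ∉ C.support
    · obtain ⟨h1, h2, h3, h4⟩ := hh
      obtain ⟨b, hb⟩ := h1.drawable.split_pair h4 h3 (by
        intro t
        have : 0 < (C.neighborSet v \ {a, t}).ncard := by
          have e1 := Set.ncard_le_ncard_sdiff_add_ncard (C.neighborSet v) {a, t}
          have e2 := Set.ncard_insert_le a {t}
          rw [Set.ncard_singleton] at e2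
          unfold ndeg at h2
          omega
        obtain ⟨c, hc1, hc2⟩ := (Set.ncard_pos).1 this
        exact ⟨c, hc1, fun k => hc2 (Or.inl k), fun k => hc2 (Or.inr k)⟩)
      exact ⟨b, fun _ _ _ _ => hb⟩
    · exact ⟨v, fun h1 h2 h3 h4 => absurd ⟨h1, h2, h3, h4⟩ hh⟩
  choose b hb using hb
  set R₁ : Set (SimpleGraph V × ((V × V) × (Fin 3 → V))) := {t |
    (IsCoreOf g l s q t.1 ∧ t.1.IsFat) ∧ (t.2.1.1 ∈ {v | 4 ≤ t.1.ndeg v} ∧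
      t.1.Adj t.2.1.1 t.2.1.2) ∧ (Function.Injective t.2.2 ∧ ∀ i, t.2.2 i ∉ t.1.support)} with hR₁
  -- The image records `y 0` together with its neighbours `y 2` and `a`. As `y 0` has degree three,
  -- there are at most nine such pairs for each of at most `q + 1` vertices.
  set R₂ : Set (SimpleGraph V × (V × (V × V))) := {t |
    (IsCoreOf g l (s + 3) (q + 1) t.1 ∧ t.1.IsFat) ∧ t.1.ndeg t.2.1 = 3 ∧
      t.1.Adj t.2.1 t.2.2.1 ∧ t.1.Adj t.2.1 t.2.2.2} with hR₂
  have e₁ : {C : SimpleGraph V | IsCoreOf g l s q C ∧ C.IsFat}.ncard *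
      ((2 * l - q) * (Nat.card V - s).descFactorial 3) ≤ R₁.ncard := by
    refine mul_le_ncard_of_fiber (fun p hp => hp.1) ?_
    rintro C ⟨hC, hF⟩
    have : {b | (C, b) ∈ R₁} = {p : V × V | p.1 ∈ {v | 4 ≤ C.ndeg v} ∧ C.Adj p.1 p.2} ×ˢ
        {y : Fin 3 → V | Function.Injective y ∧ ∀ i, y i ∉ C.support} := by
      ext b
      simp [hR₁, hC, hF]
    rw [this, Set.ncard_prod, ncard_injective_compl, hC.support_ncard]
    exact Nat.mul_le_mul_right _ hC.le_ncard_large_darts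
  have e₂ : R₂.ncard ≤ {C : SimpleGraph V | IsCoreOf g l (s + 3) (q + 1) C ∧ C.IsFat}.ncard *
      (9 * (q + 1)) := by
    refine ncard_le_mul_of_fiber (fun p hp => hp.1) ?_
    rintro C ⟨hC, hF⟩
    have : {b | (C, b) ∈ R₂} = {p : V × (V × V) | C.ndeg p.1 = 3 ∧ C.Adj p.1 p.2.1 ∧
        C.Adj p.1 p.2.2} := by
      ext b
      simp [hR₂, hC, hF]
    rw [this]
    have h9 : {p : V × (V × V) | C.ndeg p.1 = 3 ∧ C.Adj p.1 p.2.1 ∧ C.Adj p.1 p.2.2}.ncard =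
        {v | C.ndeg v = 3}.ncard * 9 := by
      refine ncard_eq_mul_of_fiber (fun p hp => hp.1) ?_
      intro v hv
      have h3 : C.ndeg v = 3 := hv
      have : {b : V × V | (v, b) ∈ {p : V × (V × V) | C.ndeg p.1 = 3 ∧ C.Adj p.1 p.2.1 ∧
          C.Adj p.1 p.2.2}} = C.neighborSet v ×ˢ C.neighborSet v := by
        ext b
        simp [h3]
      rw [this, Set.ncard_prod]
      unfold ndeg at h3
      rw [h3]
    rw [h9, mul_comm, ← hC.kernel_ncard]
    apply Nat.mul_le_mul_left
    refine Set.ncard_le_ncard ?_ ?_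
    · intro v hv
      exact le_of_eq (Eq.symm hv)
    · exact Set.toFinite _
  refine le_trans e₁ (le_trans ?_ e₂)
  refine Set.ncard_le_ncard_of_injOn (fun t =>
    (t.1.expand t.2.1.1 {t.2.1.2, b t.1 t.2.1.1 t.2.1.2 (t.2.2 0)} t.2.2,
      (t.2.2 0, (t.2.2 2, t.2.1.2)))) ?_ ?_
  · rintro ⟨C, ⟨v, a⟩, y⟩ ⟨⟨hC, hF⟩, ⟨hv, ha⟩, hyi, hy⟩
    simp only [Set.mem_ofPred_eq] at hC hF hv ha hyi hy ⊢
    obtain ⟨hb1, hb2, hb3⟩ := hb C v a (y 0) hC hv ha (hy 0)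
    have hA : ∀ u ∈ ({a, b C v a (y 0)} : Set V), C.Adj v u := adj_pair hy hyi ha hb1
    refine ⟨⟨hC.expand hy hyi hv ha hb1 hb2.symm hb3,
      IsFat.expand hC hF hy hyi hv ha hb1 hb2.symm hb3⟩,
      ndeg_expand_zero hy hyi ha hb1 hb2.symm, ?_, ?_⟩
    · rw [adj_comm, expand_adj_two_iff hy hyi hA ⟨a, ha⟩]
      exact Or.inr rfl
    · rw [expand_adj_zero_iff hy hyi hA ⟨a, ha⟩ (ne_of_notMem_support (hy 2) ⟨v, ha.symm⟩)]
      exact Or.inl rfl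
  · rintro ⟨C, ⟨v, a⟩, y⟩ ⟨⟨hC, hF⟩, ⟨hv, ha⟩, hyi, hy⟩ ⟨C', ⟨v', a'⟩, y'⟩
      ⟨⟨hC', hF'⟩, ⟨hv', ha'⟩, hyi', hy'⟩ heq
    simp only [Set.mem_ofPred_eq, Prod.mk.injEq] at hC hF hv ha hyi hy hC' hF' hv' ha' hyi' hy' heq
    obtain ⟨h1, h2, h3, rfl⟩ := heq
    obtain ⟨hb1, hb2, hb3⟩ := hb C v a (y 0) hC hv ha (hy 0)
    obtain ⟨hb1', hb2', hb3'⟩ := hb C' v' a (y' 0) hC' hv' ha' (hy' 0)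
    have hA : ∀ u ∈ ({a, b C v a (y 0)} : Set V), C.Adj v u := adj_pair hy hyi ha hb1
    have hA' : ∀ u ∈ ({a, b C' v' a (y' 0)} : Set V), C'.Adj v' u :=
      adj_pair hy' hyi' ha' hb1'
    have hvs : v ∈ C.support := ⟨a, ha⟩
    have hvs' : v' ∈ C'.support := ⟨a, ha'⟩
    -- The preimage is recovered along the path: `y 1` is the other neighbour of `y 2`, `v` is the
    -- other neighbour of `y 1`, and merging returns `C`.
    have h4 : y 1 = y' 1 := by
      have k := (expand_adj_two_iff hy hyi hA hvs (u := y 1)).2 (Or.inl rfl)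
      rw [h1, h3, expand_adj_two_iff hy' hyi' hA' hvs', ← h2] at k
      exact k.resolve_right (fun h => absurd (hyi h) (by decide))
    have h5 : v = v' := by
      have k := (expand_adj_one_iff hy hyi hA hvs (ne_of_notMem_support (hy 2) hvs)).2 rfl
      rw [h1, h4, expand_adj_one_iff hy' hyi' hA' hvs'
        (h3 ▸ ne_of_notMem_support (hy 2) hvs)] at k
      exact k
    have h6 : C = C' := by
      rw [← merge_expand hy hyi hA hvs, h1, h2, h3, h4, h5, merge_expand hy' hyi' hA' hvs']
    have h7 : y = y' := by
      ext i
      fin_cases i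
      exacts [h2, h4, h3]
    rw [h5, h6, h7]

end SimpleGraph

/-! ### Relabelling -/

namespace SimpleGraph

section Map

variable {V W : Type*} (φ : W ↪ V) {C : SimpleGraph W}

lemma neighborSet_map_apply (w : W) : (C.map φ).neighborSet (φ w) = φ '' C.neighborSet w := by
  ext u
  simp only [mem_neighborSet, map_adj, Set.mem_image]
  constructor
  · rintro ⟨a, b, h, h1, rfl⟩
    rw [φ.injective h1] at h
    exact ⟨b, h, rfl⟩
  · rintro ⟨b, h, rfl⟩
    exact ⟨w, b, h, rfl, rfl⟩

lemma ndeg_map_apply (w : W) : (C.map φ).ndeg (φ w) = C.ndeg w := by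
  rw [ndeg, neighborSet_map_apply, Set.ncard_image_of_injective _ φ.injective, ndeg]

lemma support_map_eq : (C.map φ).support = φ '' C.support := by
  ext u
  simp only [mem_support, map_adj, Set.mem_image]
  constructor
  · rintro ⟨v, a, b, h, rfl, rfl⟩
    exact ⟨a, ⟨b, h⟩, rfl⟩
  · rintro ⟨a, ⟨b, h⟩, rfl⟩
    exact ⟨φ b, a, b, h, rfl, rfl⟩

lemma exists_eq_of_ndeg_map_pos {v : V} (h : 0 < (C.map φ).ndeg v) : ∃ w, φ w = v := by
  have := mem_support_of_ndeg_pos h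
  rw [support_map_eq] at this
  obtain ⟨w, -, rfl⟩ := this
  exact ⟨w, rfl⟩

lemma reachable_map_iff {a b : W} : (C.map φ).Reachable (φ a) (φ b) ↔ C.Reachable a b := by
  constructor
  · rintro ⟨p⟩
    have key : ∀ u v, (C.map φ).Walk u v → ∀ a b, u = φ a → v = φ b → C.Reachable a b := by
      intro u v p
      induction p with
      | nil => rintro a b rfl h; rw [φ.injective h]
      | @cons u v w huv _ ih =>
        rintro a b rfl h
        obtain ⟨a', c, hac, h1, rfl⟩ := (map_adj φ C _ _).1 huv
        rw [φ.injective h1] at hac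
        exact hac.reachable.trans (ih c b rfl h)
    exact key _ _ p a b rfl rfl
  · intro h
    exact h.map (Embedding.map φ C).toHom

lemma isCoreGraph_map_iff : (C.map φ).IsCoreGraph ↔ C.IsCoreGraph := by
  constructor
  · intro h
    constructor
    · intro v hv
      rw [← ndeg_map_apply φ]
      exact h.two_le _ (by rw [support_map_eq]; exact ⟨v, hv, rfl⟩)
    · intro v hv
      obtain ⟨u, h1, h2⟩ := h.exists_reachable (φ v) (by rw [support_map_eq]; exact ⟨v, hv, rfl⟩)
      obtain ⟨w, rfl⟩ := exists_eq_of_ndeg_map_pos φ (show 0 < (C.map φ).ndeg u by omega)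
      exact ⟨w, (reachable_map_iff φ).1 h1, by rwa [ndeg_map_apply] at h2⟩
  · intro h
    constructor
    · intro v hv
      rw [support_map_eq] at hv
      obtain ⟨w, hw, rfl⟩ := hv
      rw [ndeg_map_apply]
      exact h.two_le w hw
    · intro v hv
      rw [support_map_eq] at hv
      obtain ⟨w, hw, rfl⟩ := hv
      obtain ⟨u, h1, h2⟩ := h.exists_reachable w hw
      exact ⟨φ u, (reachable_map_iff φ).2 h1, by rwa [ndeg_map_apply]⟩

lemma isFat_map_iff : (C.map φ).IsFat ↔ C.IsFat := by
  have hadj : ∀ a b, (C.map φ).Adj (φ a) (φ b) ↔ C.Adj a b := fun a b => map_adj_apply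
  constructor
  · intro h v w hv hvw
    obtain ⟨h1, h2⟩ := h (φ v) (φ w) (by rwa [ndeg_map_apply]) ((hadj _ _).2 hvw)
    rw [ndeg_map_apply] at h1
    refine ⟨h1, fun v' hv' hvw' => φ.injective ?_⟩
    exact h2 (φ v') (by rwa [ndeg_map_apply]) ((hadj _ _).2 hvw')
  · rintro h v w hv ⟨-, v, w, hvw, rfl, rfl⟩
    rw [ndeg_map_apply] at hv ⊢
    obtain ⟨h1, h2⟩ := h v w hv hvw
    refine ⟨h1, ?_⟩
    rintro v' hv' ⟨-, v', w', hvw', rfl, h3⟩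
    rw [ndeg_map_apply] at hv'
    rw [φ.injective h3] at hvw'
    rw [h2 v' hv' hvw']

lemma drawableOn_map_iff {g : ℕ} : (C.map φ).DrawableOn g ↔ C.DrawableOn g := by
  constructor
  · intro h
    exact h.of_injOn φ φ.injective.injOn fun u v huv => map_adj_apply.2 huv
  · intro h
    -- `Function.invFun` needs an inhabited `W`; for empty `W` there is nothing to draw and the
    -- given surface serves.
    rcases isEmpty_or_nonempty W with hW | hW
    · obtain ⟨D, h1, ⟨p⟩, M, hM, -⟩ := h
      refine ⟨D, h1, ⟨p⟩, M, hM, fun _ => M.tail p, ?_, ?_⟩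
      · rintro u ⟨v, -, a, -⟩
        exact (hW.false a).elim
      · rintro u v ⟨-, a, -⟩
        exact (hW.false a).elim
    · have hinv := Function.leftInverse_invFun φ.injective
      refine h.of_injOn (Function.invFun φ) ?_ ?_
      · rw [support_map_eq]
        rintro _ ⟨a, -, rfl⟩ _ ⟨b, -, rfl⟩ hab
        rw [hinv, hinv] at hab
        rw [hab]
      · rintro u v ⟨-, a, b, hab, rfl, rfl⟩
        rwa [hinv, hinv]

lemma isCoreOf_map_iff [Fintype V] [Fintype W] {g l s q : ℕ} :
    IsCoreOf g l s q (C.map φ) ↔ IsCoreOf g l s q C := by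
  have e1 : (C.map φ).support.ncard = C.support.ncard := by
    rw [support_map_eq, Set.ncard_image_of_injective _ φ.injective]
  have e2 : {v | 3 ≤ (C.map φ).ndeg v} = φ '' {w | 3 ≤ C.ndeg w} := by
    ext v
    constructor
    · intro hv
      have hv : 3 ≤ (C.map φ).ndeg v := hv
      obtain ⟨w, rfl⟩ := exists_eq_of_ndeg_map_pos φ (show 0 < (C.map φ).ndeg v by omega)
      rw [ndeg_map_apply] at hv
      exact ⟨w, hv, rfl⟩
    · rintro ⟨w, hw, rfl⟩
      have hw : 3 ≤ C.ndeg w := hw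
      rwa [← ndeg_map_apply φ] at hw
  have e3 : {v | 3 ≤ (C.map φ).ndeg v}.ncard = {w | 3 ≤ C.ndeg w}.ncard := by
    rw [e2, Set.ncard_image_of_injective _ φ.injective]
  have e4 : ∑ v, (C.map φ).ndeg v = ∑ w, C.ndeg w := by
    rw [← Finset.sum_subset (Finset.subset_univ (Finset.univ.map φ))]
    · rw [Finset.sum_map]
      exact Finset.sum_congr rfl fun w _ => ndeg_map_apply φ w
    · intro v _ hv
      by_contra h
      obtain ⟨w, rfl⟩ := exists_eq_of_ndeg_map_pos φ (Nat.pos_of_ne_zero h)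
      simp at hv
  constructor
  · rintro ⟨h1, h2, h3, h4, h5⟩
    exact ⟨(isCoreGraph_map_iff φ).1 h1, (drawableOn_map_iff φ).1 h2, e1 ▸ h3, e3 ▸ h4, e4 ▸ h5⟩
  · rintro ⟨h1, h2, h3, h4, h5⟩
    exact ⟨(isCoreGraph_map_iff φ).2 h1, (drawableOn_map_iff φ).2 h2, e1.trans h3, e3.trans h4,
      e4.trans h5⟩

lemma map_comap_of_support_subset {C : SimpleGraph V} (h : C.support ⊆ Set.range φ) :
    (C.comap φ).map φ = C := by
  ext u v
  rw [map_adj]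
  constructor
  · rintro ⟨a, b, hab, rfl, rfl⟩
    exact hab
  · intro huv
    obtain ⟨a, rfl⟩ := h ⟨v, huv⟩
    obtain ⟨b, rfl⟩ := h ⟨_, huv.symm⟩
    exact ⟨a, b, huv, rfl, rfl⟩

end Map

lemma ncard_sets_of_ncard (V : Type*) [Finite V] (s : ℕ) :
    {S : Set V | S.ncard = s}.ncard = (Nat.card V).choose s := by
  classical
  have := Fintype.ofFinite V
  have h : (Finset.powersetCard s (Finset.univ : Finset V)).card = (Nat.card V).choose s := by
    rw [Finset.card_powersetCard, Finset.card_univ, Nat.card_eq_fintype_card]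
  rw [← h, ← Set.ncard_coe_finset]
  symm
  refine Set.ncard_congr (fun S _ => (S : Set V)) ?_ ?_ ?_
  · intro S hS
    simpa using hS
  · intro S T _ _ h
    exact Finset.coe_injective h
  · intro S hS
    refine ⟨S.toFinite.toFinset, ?_, by simp⟩
    have hS : S.ncard = s := hS
    rw [Finset.mem_coe, Finset.mem_powersetCard]
    exact ⟨Finset.subset_univ _, by rw [← hS, Set.ncard_eq_toFinset_card S S.toFinite]⟩

/-- The number of cores with a given support depends on the size of the support only. -/
lemma ncard_isCoreOf_support {V : Type*} [Fintype V] (g l s q : ℕ)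
    (P : SimpleGraph V → Prop) (P' : SimpleGraph (Fin s) → Prop)
    (hP : ∀ (φ : Fin s ↪ V) (C : SimpleGraph (Fin s)), P (C.map φ) ↔ P' C) {S : Set V}
    (hS : S.ncard = s) :
    {C : SimpleGraph V | S = C.support ∧ IsCoreOf g l s q C ∧ P C}.ncard =
      {C : SimpleGraph (Fin s) | IsCoreOf g l s q C ∧ P' C}.ncard := by
  have hc : Nat.card S = Nat.card (Fin s) := by rw [Nat.card_coe_set_eq, hS, Nat.card_fin]
  obtain ⟨e⟩ : Nonempty (Fin s ≃ S) := Finite.card_eq.1 hc.symm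
  let φ : Fin s ↪ V := e.toEmbedding.trans (Function.Embedding.subtype _)
  have hφ : Set.range φ = S := by
    ext v
    constructor
    · rintro ⟨i, rfl⟩; exact (e i).2
    · intro hv; exact ⟨e.symm ⟨v, hv⟩, by simp [φ]⟩
  symm
  refine Set.ncard_congr (fun C _ => C.map φ) ?_ ?_ ?_
  · rintro C ⟨h1, h2⟩
    refine ⟨?_, (isCoreOf_map_iff φ).2 h1, (hP φ C).2 h2⟩
    have hu : C.support = Set.univ := by
      apply Set.eq_of_subset_of_ncard_le (Set.subset_univ _)
      rw [h1.support_ncard, Set.ncard_univ, Nat.card_fin]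
    rw [support_map_eq, hu, Set.image_univ, hφ]
  · intro C C' _ _ h
    exact map_injective φ h
  · rintro C ⟨h1, h2, h3⟩
    have hm := map_comap_of_support_subset φ (C := C) (by rw [hφ, h1])
    refine ⟨C.comap φ, ⟨?_, ?_⟩, hm⟩
    · rw [← isCoreOf_map_iff φ, hm]; exact h2
    · rw [← hP φ, hm]; exact h3

/-- Up to the choice of the support, the number of cores does not depend on the vertex set. -/
lemma ncard_isCoreOf_and (V : Type*) [Fintype V] (g l s q : ℕ)
    (P : SimpleGraph V → Prop) (P' : SimpleGraph (Fin s) → Prop)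
    (hP : ∀ (φ : Fin s ↪ V) (C : SimpleGraph (Fin s)), P (C.map φ) ↔ P' C) :
    {C : SimpleGraph V | IsCoreOf g l s q C ∧ P C}.ncard =
      (Nat.card V).choose s * {C : SimpleGraph (Fin s) | IsCoreOf g l s q C ∧ P' C}.ncard := by
  set R : Set (Set V × SimpleGraph V) := {t | t.1 = t.2.support ∧ IsCoreOf g l s q t.2 ∧ P t.2}
    with hR
  have e₁ : {C : SimpleGraph V | IsCoreOf g l s q C ∧ P C}.ncard = R.ncard := by
    refine Set.ncard_congr (fun C _ => (C.support, C)) ?_ ?_ ?_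
    · intro C hC; exact ⟨rfl, hC⟩
    · intro C C' _ _ h; exact congrArg Prod.snd h
    · rintro ⟨S, C⟩ ⟨h1, h2⟩
      exact ⟨C, h2, by rw [← h1]⟩
  rw [e₁, ← ncard_sets_of_ncard]
  refine ncard_eq_mul_of_fiber ?_ ?_
  · rintro ⟨S, C⟩ ⟨h1, h, -⟩
    have h1 : S = C.support := h1
    show S.ncard = s
    rw [h1]
    exact h.support_ncard
  · exact fun S hS => ncard_isCoreOf_support g l s q P P' hP hS

/-- The number of cores on `s` labelled vertices. -/
noncomputable def coreCount (g l s q : ℕ) : ℕ :=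
  {C : SimpleGraph (Fin s) | IsCoreOf g l s q C}.ncard

/-- The number of cores on `s` labelled vertices in which every edge of the kernel is subdivided by
at least two vertices. -/
noncomputable def fatCount (g l s q : ℕ) : ℕ :=
  {C : SimpleGraph (Fin s) | IsCoreOf g l s q C ∧ C.IsFat}.ncard

lemma ncard_isCoreOf (V : Type*) [Fintype V] (g l s q : ℕ) :
    {C : SimpleGraph V | IsCoreOf g l s q C}.ncard =
      (Nat.card V).choose s * coreCount g l s q := by
  have := ncard_isCoreOf_and V g l s q (fun _ => True) (fun _ => True) (fun _ _ => Iff.rfl)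
  simp only [and_true] at this
  exact this

lemma ncard_isCoreOf_of_support {V : Type*} [Fintype V] (g l : ℕ) {s : ℕ} (q : ℕ) {S : Set V}
    (hS : S.ncard = s) :
    {C : SimpleGraph V | S = C.support ∧ IsCoreOf g l s q C}.ncard = coreCount g l s q := by
  have := ncard_isCoreOf_support g l s q (fun _ => True) (fun _ => True) (fun _ _ => Iff.rfl) hS
  simp only [and_true] at this
  exact this

lemma ncard_isFat (V : Type*) [Fintype V] (g l s q : ℕ) :
    {C : SimpleGraph V | IsCoreOf g l s q C ∧ C.IsFat}.ncard =
      (Nat.card V).choose s * fatCount g l s q :=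
  ncard_isCoreOf_and V g l s q IsFat IsFat (fun φ _ => isFat_map_iff φ)

lemma fatCount_le_coreCount (g l s q : ℕ) : fatCount g l s q ≤ coreCount g l s q :=
  Set.ncard_le_ncard (fun _ h => h.1) (Set.toFinite _)

/-- The count of inner subdivisions is read off on exactly as many labels as the larger core has
vertices, so the choices of support are `s + 1` and one, and a single label is unused. -/
lemma fatCount_succ (g l q B : ℕ) :
    (2 * l + 3 * q + B + 1) * fatCount g l (2 * l + 3 * q + B) q * (l + q + B) =
      fatCount g l (2 * l + 3 * q + B + 1) q * (B + 1) := by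
  have h := fat_subdivide_count (V := Fin (2 * l + 3 * q + B + 1)) g l q B
  rw [ncard_isFat, ncard_isFat, Nat.card_fin, Nat.choose_self, Nat.choose_succ_self_right,
    Nat.add_sub_cancel_left] at h
  have : 2 * ((2 * l + 3 * q + B + 1) * fatCount g l (2 * l + 3 * q + B) q * (l + q + B)) =
      2 * (fatCount g l (2 * l + 3 * q + B + 1) q * (B + 1)) := by linarith
  omega

lemma coreCount_le_fatCount (g l s q : ℕ) :
    (s + 2 * (l + q)).factorial * coreCount g l s q ≤
      s.factorial * fatCount g l (s + 2 * (l + q)) q := by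
  have h := core_count_le_fat (V := Fin (s + 2 * (l + q))) g l q s
  rw [ncard_isFat, ncard_isCoreOf, Nat.card_fin, Nat.choose_self, Nat.add_sub_cancel_left,
    Nat.descFactorial_self, one_mul] at h
  have h' := Nat.choose_mul_factorial_mul_factorial (Nat.le_add_right s (2 * (l + q)))
  rw [Nat.add_sub_cancel_left] at h'
  calc _ = s.factorial * ((s + 2 * (l + q)).choose s * coreCount g l s q *
        (2 * (l + q)).factorial) := by rw [← h']; ring
    _ ≤ _ := Nat.mul_le_mul_left _ h

/-- As for subdivisions, the larger core uses all `s + 3` labels, which leaves three for the new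
path. -/
lemma fatCount_split (g l s q : ℕ) :
    (s + 3).factorial * fatCount g l s q * (2 * l - q) ≤
      s.factorial * fatCount g l (s + 3) (q + 1) * (9 * (q + 1)) := by
  have h := fat_split_count (V := Fin (s + 3)) g l q s
  rw [ncard_isFat, ncard_isFat, Nat.card_fin, Nat.choose_self, Nat.add_sub_cancel_left,
    Nat.descFactorial_self, one_mul] at h
  have h' := Nat.choose_mul_factorial_mul_factorial (Nat.le_add_right s 3)
  rw [Nat.add_sub_cancel_left] at h'
  calc _ = s.factorial * ((s + 3).choose s * fatCount g l s q * ((2 * l - q) *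
        (3).factorial)) := by rw [← h']; ring
    _ ≤ s.factorial * (fatCount g l (s + 3) (q + 1) * (9 * (q + 1))) := Nat.mul_le_mul_left _ h
    _ = _ := by ring

end SimpleGraph

/-! ### Triangles with a common vertex -/

section Windmill

open Equiv Equiv.Perm

variable (L : ℕ) [NeZero L]

/-- The rotation at the vertices of a windmill. In the `i`-th triangle `c, a, b`, whose common
vertex is `c`, the darts `0, …, 5` are `ca, ac, ab, ba, bc, cb`. -/
def windmillNext : Perm (ZMod L × Fin 6) where
  toFun p := match p.2 with
    | 0 => (p.1, 5)
    | 1 => (p.1, 2)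
    | 2 => (p.1, 1)
    | 3 => (p.1, 4)
    | 4 => (p.1, 3)
    | 5 => (p.1 + 1, 0)
  invFun p := match p.2 with
    | 0 => (p.1 - 1, 5)
    | 1 => (p.1, 2)
    | 2 => (p.1, 1)
    | 3 => (p.1, 4)
    | 4 => (p.1, 3)
    | 5 => (p.1, 0)
  left_inv := by rintro ⟨i, k⟩; fin_cases k <;> simp
  right_inv := by rintro ⟨i, k⟩; fin_cases k <;> simp

def windmillRev : Perm (ZMod L × Fin 6) where
  toFun p := match p.2 with
    | 0 => (p.1, 1)
    | 1 => (p.1, 0)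
    | 2 => (p.1, 3)
    | 3 => (p.1, 2)
    | 4 => (p.1, 5)
    | 5 => (p.1, 4)
  invFun p := match p.2 with
    | 0 => (p.1, 1)
    | 1 => (p.1, 0)
    | 2 => (p.1, 3)
    | 3 => (p.1, 2)
    | 4 => (p.1, 5)
    | 5 => (p.1, 4)
  left_inv := by rintro ⟨i, k⟩; fin_cases k <;> rfl
  right_inv := by rintro ⟨i, k⟩; fin_cases k <;> rfl

lemma windmillNext_sameCycle_center (i j : ZMod L) :
    SameCycle (windmillNext L) (i, 0) (j, 0) := by
  have h1 : ∀ i, SameCycle (windmillNext L) (i, 0) (i + 1, 0) := fun i =>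
    (SameCycle.step (windmillNext L) (i, 0)).trans (SameCycle.step (windmillNext L) (i, 5))
  have h2 : ∀ k : ℕ, SameCycle (windmillNext L) (i, 0) (i + k, 0) := by
    intro k
    induction k with
    | zero => simpa using SameCycle.refl _ _
    | succ k ih =>
      push_cast
      rw [← add_assoc]
      exact ih.trans (h1 _)
  have h3 := h2 (j - i).val
  rwa [ZMod.natCast_zmod_val, add_sub_cancel] at h3

lemma windmillNext_cycleCount : cycleCount (windmillNext L) = 2 * L + 1 := by
  let c : ZMod L × Fin 6 → Option (ZMod L × Bool) := fun p => match p.2 with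
    | 0 => none
    | 1 => some (p.1, false)
    | 2 => some (p.1, false)
    | 3 => some (p.1, true)
    | 4 => some (p.1, true)
    | 5 => none
  rw [cycleCount_eq_card (windmillNext L) c]
  · simp; ring
  · rintro (_ | ⟨i, _ | _⟩)
    exacts [⟨(0, 0), rfl⟩, ⟨(i, 1), rfl⟩, ⟨(i, 3), rfl⟩]
  · rintro ⟨i, k⟩; fin_cases k <;> rfl
  · have h5 : ∀ i : ZMod L, SameCycle (windmillNext L) (i, 5) (i, 0) := fun i =>
      (SameCycle.step (windmillNext L) (i, 0)).symm
    have h2 : ∀ i : ZMod L, SameCycle (windmillNext L) (i, 2) (i, 1) := fun i =>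
      SameCycle.step (windmillNext L) (i, 2)
    have h4 : ∀ i : ZMod L, SameCycle (windmillNext L) (i, 4) (i, 3) := fun i =>
      SameCycle.step (windmillNext L) (i, 4)
    have h0 := windmillNext_sameCycle_center L
    rintro ⟨i, k⟩ ⟨j, m⟩ h
    fin_cases k <;> fin_cases m <;> simp [c] at h <;> try subst h
    all_goals first
      | exact SameCycle.refl _ _
      | exact h0 _ _
      | exact h2 _
      | exact (h2 _).symm
      | exact h4 _
      | exact (h4 _).symm
      | exact (h5 _).trans (h0 _ _)
      | exact (h0 _ _).trans (h5 _).symm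
      | exact (h5 _).trans ((h0 _ _).trans (h5 _).symm)

lemma windmillRev_cycleCount : cycleCount (windmillRev L) = 3 * L := by
  let c : ZMod L × Fin 6 → ZMod L × Fin 3 := fun p => match p.2 with
    | 0 => (p.1, 0)
    | 1 => (p.1, 0)
    | 2 => (p.1, 1)
    | 3 => (p.1, 1)
    | 4 => (p.1, 2)
    | 5 => (p.1, 2)
  rw [cycleCount_eq_card (windmillRev L) c]
  · simp; ring
  · rintro ⟨i, k⟩
    fin_cases k
    exacts [⟨(i, 0), rfl⟩, ⟨(i, 2), rfl⟩, ⟨(i, 4), rfl⟩]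
  · rintro ⟨i, k⟩; fin_cases k <;> rfl
  · rintro ⟨i, k⟩ ⟨j, m⟩ h
    fin_cases k <;> fin_cases m <;> simp [c] at h <;> subst h <;> first
      | exact SameCycle.refl _ _
      | exact SameCycle.step (windmillRev L) _

/-- The odd darts of each triangle bound its inner face; all the even darts together bound the outer
face. -/
lemma windmillFace_cycleCount : cycleCount (windmillNext L * windmillRev L) = L + 1 := by
  let c : ZMod L × Fin 6 → Option (ZMod L) := fun p => match p.2 with
    | 0 => none
    | 1 => some p.1
    | 2 => none
    | 3 => some p.1
    | 4 => none
    | 5 => some p.1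
  rw [cycleCount_eq_card (windmillNext L * windmillRev L) c]
  · simp
  · rintro (_ | i)
    exacts [⟨(0, 0), rfl⟩, ⟨(i, 1), rfl⟩]
  · rintro ⟨i, k⟩; fin_cases k <;> rfl
  · have s := SameCycle.step (windmillNext L * windmillRev L)
    have h2 : ∀ i : ZMod L, SameCycle (windmillNext L * windmillRev L) (i, 0) (i, 2) :=
      fun i => s (i, 0)
    have h4 : ∀ i : ZMod L, SameCycle (windmillNext L * windmillRev L) (i, 0) (i, 4) :=
      fun i => (h2 i).trans (s (i, 2))
    have h5 : ∀ i : ZMod L, SameCycle (windmillNext L * windmillRev L) (i, 1) (i, 5) :=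
      fun i => s (i, 1)
    have h3 : ∀ i : ZMod L, SameCycle (windmillNext L * windmillRev L) (i, 1) (i, 3) :=
      fun i => (h5 i).trans (s (i, 5))
    have h0 : ∀ i j : ZMod L, SameCycle (windmillNext L * windmillRev L) (i, 0) (j, 0) := by
      intro i j
      have h : ∀ k : ℕ, SameCycle (windmillNext L * windmillRev L) (i, 0) (i + k, 0) := by
        intro k
        induction k with
        | zero => simpa using SameCycle.refl _ _
        | succ k ih =>
          push_cast
          rw [← add_assoc]
          exact ih.trans ((h4 _).trans (s (_, 4)))
      have := h (j - i).val
      rwa [ZMod.natCast_zmod_val, add_sub_cancel] at this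
    have e0 : ∀ (i : ZMod L) (k : Fin 6), k = 0 ∨ k = 2 ∨ k = 4 →
        SameCycle (windmillNext L * windmillRev L) (0, 0) (i, k) := by
      rintro i k (rfl | rfl | rfl)
      exacts [h0 _ _, (h0 _ _).trans (h2 _), (h0 _ _).trans (h4 _)]
    have e1 : ∀ (i : ZMod L) (k : Fin 6), k = 1 ∨ k = 3 ∨ k = 5 →
        SameCycle (windmillNext L * windmillRev L) (i, 1) (i, k) := by
      rintro i k (rfl | rfl | rfl)
      exacts [SameCycle.refl _ _, h3 _, h5 _]
    rintro ⟨i, k⟩ ⟨j, m⟩ h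
    fin_cases k <;> fin_cases m <;> simp [c] at h <;> try subst h
    all_goals first
      | exact (e0 _ _ (by decide)).symm.trans (e0 _ _ (by decide))
      | exact (e1 _ _ (by decide)).symm.trans (e1 _ _ (by decide))

/-- The plane drawing of a windmill. -/
def windmillMap : SurfaceMap (ZMod L × Fin 6) where
  next := windmillNext L
  rev := windmillRev L
  rev_rev := by rintro ⟨i, k⟩; fin_cases k <;> rfl
  rev_ne := by rintro ⟨i, k⟩; fin_cases k <;> simp [windmillRev]
  connected := by
    have hE := SurfaceMap.linked_equivalence (windmillNext L) (windmillRev L)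
    have n : ∀ p, SurfaceMap.Linked (windmillNext L) (windmillRev L) p (windmillNext L p) :=
      fun p => SurfaceMap.linked_of_sameCycle (SameCycle.step _ _)
    have r := SurfaceMap.linked_rev (windmillNext L) (windmillRev L)
    have key : ∀ p, SurfaceMap.Linked (windmillNext L) (windmillRev L) (0, 0) p := by
      rintro ⟨i, k⟩
      have h0 : SurfaceMap.Linked (windmillNext L) (windmillRev L) (0, 0) (i, 0) :=
        SurfaceMap.linked_of_sameCycle (windmillNext_sameCycle_center L 0 i)
      have h1 := hE.trans h0 (r (i, 0))
      have h2 := hE.trans h1 (n (i, 1))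
      have h3 := hE.trans h2 (r (i, 2))
      have h4 := hE.trans h3 (n (i, 3))
      have h5 := hE.trans h4 (r (i, 4))
      fin_cases k
      exacts [h0, h1, h2, h3, h4, h5]
    exact fun d e => hE.trans (hE.symm (key d)) (key e)

/-- `L` triangles with a common vertex. -/
def windmill : SimpleGraph (Option (ZMod L × Bool)) where
  Adj p q := p ≠ q ∧ ∀ i j : ZMod L × Bool, p = some i → q = some j → i.1 = j.1
  symm := ⟨fun _ _ h => ⟨h.1.symm, fun i j hi hj => (h.2 j i hj hi).symm⟩⟩
  loopless := ⟨fun _ h => h.1 rfl⟩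

/-- The drawing is plane, since `(2L + 1) - 3L + (L + 1) = 2`, and handles raise the genus to `g`.
-/
lemma windmill_drawableOn (g : ℕ) : (windmill L).DrawableOn g := by
  apply SimpleGraph.DrawableOn.mono_genus
  let M := windmillMap L
  let y : Option (ZMod L × Bool) → ZMod L × Fin 6
    | none => (0, 0)
    | some (i, false) => (i, 1)
    | some (i, true) => (i, 3)
  refine ⟨ZMod L × Fin 6, inferInstance, ⟨(0, 0)⟩, M, ?_, fun v => M.tail (y v), ?_, ?_⟩
  · rw [SurfaceMap.hasGenus_iff]
    have e1 : cycleCount M.next = 2 * L + 1 := windmillNext_cycleCount L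
    have e2 : cycleCount M.rev = 3 * L := windmillRev_cycleCount L
    have e3 : cycleCount (M.next * M.rev) = L + 1 := windmillFace_cycleCount L
    rw [e1, e2, e3]
    push_cast
    ring
  · let c : ZMod L × Fin 6 → Option (ZMod L × Bool) := fun p => match p.2 with
      | 0 => none
      | 1 => some (p.1, false)
      | 2 => some (p.1, false)
      | 3 => some (p.1, true)
      | 4 => some (p.1, true)
      | 5 => none
    have hc : ∀ p q, M.tail p = M.tail q → c p = c q := by
      intro p q h
      refine SameCycle.rel_of_step (r := fun p q => c p = c q)
        ⟨fun _ => rfl, fun h => h.symm, fun h h' => h.trans h'⟩ ?_ (M.tail_eq_iff.1 h)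
      rintro ⟨i, k⟩; fin_cases k <;> rfl
    have hcy : ∀ v, c (y v) = v := by
      rintro (_ | ⟨i, _ | _⟩) <;> rfl
    intro u _ v _ h
    rw [← hcy u, ← hcy v]
    exact hc _ _ h
  · have s1 : ∀ p, M.tail (windmillNext L p) = M.tail p := fun p =>
      (M.tail_eq_iff.2 (SameCycle.step M.next p)).symm
    have s0 : ∀ i, M.tail (i, 0) = M.tail (0, 0) := fun i =>
      M.tail_eq_iff.2 (windmillNext_sameCycle_center L i 0)
    have hca : ∀ i, M.tail (i, 0) = M.tail (0, 0) ∧ M.head (i, 0) = M.tail (i, 1) := fun i =>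
      ⟨s0 i, rfl⟩
    have hab : ∀ i, M.tail (i, 2) = M.tail (i, 1) ∧ M.head (i, 2) = M.tail (i, 3) := fun i =>
      ⟨s1 (i, 1), rfl⟩
    have hcb : ∀ i, M.tail (i, 5) = M.tail (0, 0) ∧ M.head (i, 5) = M.tail (i, 3) := fun i =>
      ⟨(s1 (i, 0)).trans (s0 i), s1 (i, 3)⟩
    have hrev : ∀ d v w, M.tail d = v ∧ M.head d = w → ∃ d, M.tail d = w ∧ M.head d = v :=
      fun d v w h => ⟨M.rev d, h.2, by rw [M.head_rev, h.1]⟩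
    rintro (_ | ⟨i, _ | _⟩) (_ | ⟨j, _ | _⟩) ⟨hne, hij⟩
    · exact absurd rfl hne
    · exact ⟨_, hca j⟩
    · exact ⟨_, hcb j⟩
    · exact hrev _ _ _ (hca i)
    · obtain rfl : i = j := hij _ _ rfl rfl
      exact absurd rfl hne
    · obtain rfl : i = j := hij _ _ rfl rfl
      exact ⟨_, hab i⟩
    · exact hrev _ _ _ (hcb i)
    · obtain rfl : i = j := hij _ _ rfl rfl
      exact hrev _ _ _ (hab i)
    · obtain rfl : i = j := hij _ _ rfl rfl
      exact absurd rfl hne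

open SimpleGraph in
-- With `l + 1` triangles there are `l` more edges than vertices, and the smallest possible number
-- `2 * l + 3 * q` of vertices of a fat core is attained for `q = 1`. The centre has degree `2 * l +
-- 2`, so `1 ≤ l` makes it a kernel vertex.
lemma windmill_isCoreOf (g l : ℕ) (hl : 1 ≤ l) :
    IsCoreOf g l (2 * l + 3) 1 (windmill (l + 1)) ∧ (windmill (l + 1)).IsFat := by
  set G := windmill (l + 1) with hG
  have hN : ∀ i b, G.neighborSet (some (i, b)) = {none, some (i, !b)} := by
    intro i b
    ext q
    rcases q with _ | ⟨j, b'⟩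
    · simp [hG, windmill]
    · simp only [mem_neighborSet, hG, windmill, Set.mem_insert_iff, Set.mem_singleton_iff]
      constructor
      · rintro ⟨h1, h2⟩
        have := h2 _ _ rfl rfl
        simp only at this
        subst this
        right
        have : b ≠ b' := fun h => h1 (by rw [h])
        rw [Bool.eq_not.2 this.symm]
      · rintro (h | h)
        · exact absurd h (by simp)
        · simp only [Option.some.injEq, Prod.mk.injEq] at h
          obtain ⟨rfl, rfl⟩ := h
          refine ⟨by simp, ?_⟩
          rintro x y hx hy
          simp only [Option.some.injEq] at hx hy
          rw [← hx, ← hy]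
  have h2 : ∀ i b, G.ndeg (some (i, b)) = 2 := by
    intro i b
    rw [ndeg, hN, Set.ncard_pair (by simp)]
  have hN0 : G.neighborSet none = {none}ᶜ := by
    ext q
    simp only [mem_neighborSet, hG, windmill, Set.mem_compl_iff, Set.mem_singleton_iff]
    constructor
    · rintro h; exact h.1.symm
    · intro h
      exact ⟨Ne.symm h, by simp⟩
  have hcard : Nat.card (Option (ZMod (l + 1) × Bool)) = 2 * l + 3 := by
    rw [Finite.card_option, Nat.card_prod, Nat.card_zmod]
    simp; ring
  have h0 : G.ndeg none = 2 * l + 2 := by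
    rw [ndeg, hN0, Set.ncard_compl, Set.ncard_singleton, hcard]; rfl
  have hpos : ∀ p, 2 ≤ G.ndeg p := by
    rintro (_ | ⟨i, b⟩)
    · rw [h0]; omega
    · rw [h2]
  have hsupp : G.support = Set.univ := by
    ext p
    simpa using mem_support_of_ndeg_pos (show 0 < G.ndeg p by have := hpos p; omega)
  have hK : ∀ p, 3 ≤ G.ndeg p ↔ p = none := by
    rintro (_ | ⟨i, b⟩)
    · rw [h0]; simp; omega
    · rw [h2]; simp
  refine ⟨⟨⟨fun v _ => hpos v, ?_⟩, windmill_drawableOn _ g, ?_, ?_, ?_⟩, ?_⟩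
  · rintro v -
    refine ⟨none, ?_, (hK _).2 rfl⟩
    rcases v with _ | ⟨i, b⟩
    · exact Reachable.refl _
    · apply Adj.reachable
      rw [← mem_neighborSet, hN]
      exact Or.inl rfl
  · rw [hsupp, Set.ncard_univ, hcard]
  · have : {v | 3 ≤ G.ndeg v} = {none} := by
      ext p; exact hK p
    rw [this, Set.ncard_singleton]
  · rw [Fintype.sum_option, h0, Finset.sum_congr rfl (g := fun _ => 2)]
    · simp only [Finset.sum_const, Finset.card_univ, Fintype.card_prod, ZMod.card,
        Fintype.card_bool, smul_eq_mul]
      ring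
    · rintro ⟨i, b⟩ _
      exact h2 i b
  · intro v w hv hvw
    rw [hK] at hv
    subst hv
    have hw : w ≠ none := by
      rintro rfl
      exact hvw.ne rfl
    obtain ⟨⟨i, b⟩, rfl⟩ := Option.ne_none_iff_exists'.1 hw
    exact ⟨h2 i b, fun v' hv' _ => (hK v').1 hv'⟩

lemma fatCount_one_pos (g l : ℕ) (hl : 1 ≤ l) : 0 < SimpleGraph.fatCount g l (2 * l + 3) 1 := by
  have h := SimpleGraph.ncard_isFat (Option (ZMod (l + 1) × Bool)) g l (2 * l + 3) 1
  have hpos : 0 < {C : SimpleGraph (Option (ZMod (l + 1) × Bool)) |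
      SimpleGraph.IsCoreOf g l (2 * l + 3) 1 C ∧ C.IsFat}.ncard :=
    (Set.ncard_pos).2 ⟨_, windmill_isCoreOf g l hl⟩
  rw [h] at hpos
  exact Nat.pos_of_mul_pos_left hpos

end Windmill

/-! ### Bounds on the number of cores -/

namespace SimpleGraph

lemma coreCount_eq_zero_of_lt {g l s q : ℕ} (h : s < q ∨ 2 * l < q) : coreCount g l s q = 0 := by
  rw [coreCount, Set.ncard_eq_zero]
  ext C
  simp only [Set.mem_ofPred_eq, Set.mem_empty_iff_false, iff_false]
  intro hC
  have h1 := hC.kernel_le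
  have h2 : {v | 3 ≤ C.ndeg v}.ncard ≤ C.support.ncard :=
    Set.ncard_le_ncard (fun v hv => mem_support_of_ndeg_pos
      (lt_of_lt_of_le (by norm_num) (show 3 ≤ C.ndeg v from hv))) (Set.toFinite _)
  rw [hC.kernel_ncard, hC.support_ncard] at h2
  omega

/-- The normalised number of cores of which every kernel edge is subdivided by exactly two
vertices. -/
noncomputable def fatWeight (g l q : ℕ) : ℝ :=
  (fatCount g l (2 * l + 3 * q) q : ℝ) / (2 * l + 3 * q).factorial

lemma fatWeight_nonneg (g l q : ℕ) : 0 ≤ fatWeight g l q := by unfold fatWeight; positivity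

/-- Stars and bars: beyond two subdividing vertices on each kernel edge, `B` further ones are
distributed over `l + q = k + 1` kernel edges. The proof matches the recursion `fatCount_succ` with
that of the binomial coefficients. -/
lemma fatCount_eq_choose (g l q k B : ℕ) (hk : l + q = k + 1) :
    (fatCount g l (2 * l + 3 * q + B) q : ℝ) =
      (2 * l + 3 * q + B).factorial * (fatWeight g l q * (B + k).choose B) := by
  induction B with
  | zero =>
    rw [fatWeight]
    have : ((2 * l + 3 * q).factorial : ℝ) ≠ 0 := by positivity
    simp only [add_zero, zero_add, Nat.choose_zero_right, Nat.cast_one, mul_one]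
    field_simp
  | succ B ih =>
    have h : ((2 * l + 3 * q + B + 1 : ℕ) : ℝ) * fatCount g l (2 * l + 3 * q + B) q *
        ((l + q + B : ℕ) : ℝ) = fatCount g l (2 * l + 3 * q + B + 1) q * ((B + 1 : ℕ) : ℝ) := by
      exact_mod_cast fatCount_succ g l q B
    have h2 : ((B + k + 1 : ℕ) : ℝ) * (B + k).choose B =
        (B + k + 1).choose (B + 1) * ((B + 1 : ℕ) : ℝ) := by
      exact_mod_cast Nat.add_one_mul_choose_eq (B + k) B
    rw [ih, show l + q + B = B + k + 1 by omega] at h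
    have hB : ((B + 1 : ℕ) : ℝ) ≠ 0 := by positivity
    rw [← add_assoc, show B + 1 + k = B + k + 1 by ring, Nat.factorial_succ]
    apply mul_right_cancel₀ hB
    rw [← h]
    push_cast at h2 ⊢
    linear_combination ((2 * l + 3 * q + B + 1 : ℝ) * (2 * l + 3 * q + B).factorial *
      fatWeight g l q) * h2

/-- After fattening, a core with `s` vertices has `s + 2 * (l + q)` vertices, so that `B = s - q` in
the exact count and `B + k` is below `s + l`. -/
lemma coreCount_le_choose (g l s q k : ℕ) (hk : l + q = k + 1) :
    (coreCount g l s q : ℝ) ≤ s.factorial * (fatWeight g l q * ((s + l : ℝ) ^ k / k.factorial)) := by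
  by_cases hq : s < q
  · rw [coreCount_eq_zero_of_lt (Or.inl hq), Nat.cast_zero]
    have := fatWeight_nonneg g l q
    positivity
  have h : ((s + 2 * (l + q)).factorial : ℝ) * coreCount g l s q ≤
      s.factorial * fatCount g l (s + 2 * (l + q)) q := by
    exact_mod_cast coreCount_le_fatCount g l s q
  obtain ⟨B, rfl⟩ := Nat.exists_eq_add_of_le (not_lt.1 hq)
  rw [show q + B + 2 * (l + q) = 2 * l + 3 * q + B by ring, fatCount_eq_choose g l q k B hk] at h
  have hf : (0 : ℝ) < (2 * l + 3 * q + B).factorial := by positivity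
  have h3 : (coreCount g l (q + B) q : ℝ) ≤
      (q + B).factorial * (fatWeight g l q * (B + k).choose B) := by
    refine le_of_mul_le_mul_left (h.trans_eq ?_) hf
    ring
  refine h3.trans ?_
  have := fatWeight_nonneg g l q
  gcongr
  rw [show (B + k).choose B = (B + k).choose k from Nat.choose_symm_add]
  refine (Nat.choose_le_pow_div k (B + k)).trans ?_
  gcongr
  have : (B + k : ℕ) ≤ q + B + l := by omega
  exact_mod_cast this

/-- Fat cores with cubic kernel suffice: they have `8 * l + B` vertices, and the binomial
coefficient is at least a power of `B + 1` over the factorial. -/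
lemma le_coreCount (g l s : ℕ) (hl : 1 ≤ l) (hs : 8 * l ≤ s) :
    s.factorial * (fatWeight g l (2 * l) * ((s - 8 * l : ℝ) ^ (3 * l - 1) / (3 * l - 1).factorial))
      ≤ coreCount g l s (2 * l) := by
  obtain ⟨B, rfl⟩ := Nat.exists_eq_add_of_le hs
  have h := fatCount_eq_choose g l (2 * l) (3 * l - 1) B (by omega)
  rw [show 2 * l + 3 * (2 * l) + B = 8 * l + B by ring] at h
  refine le_trans ?_ (Nat.cast_le.2 (fatCount_le_coreCount g l _ _))
  rw [h]
  have := fatWeight_nonneg g l (2 * l)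
  gcongr
  rw [show (B + (3 * l - 1)).choose B = (B + (3 * l - 1)).choose (3 * l - 1) from
    Nat.choose_symm_add]
  refine le_trans ?_ (Nat.pow_le_choose (3 * l - 1) (B + (3 * l - 1)))
  gcongr
  · push_cast; simp
  · rw [show B + (3 * l - 1) + 1 - (3 * l - 1) = B + 1 by omega]
    push_cast; linarith

lemma fatWeight_succ (g l q : ℕ) (hq : q ≤ 2 * l) :
    fatWeight g l q * (2 * l - q) ≤ 9 * (q + 1) * fatWeight g l (q + 1) := by
  have h : ((2 * l + 3 * q + 3).factorial : ℝ) * fatCount g l (2 * l + 3 * q) q *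
      ((2 * l - q : ℕ) : ℝ) ≤ (2 * l + 3 * q).factorial *
        fatCount g l (2 * l + 3 * q + 3) (q + 1) * (9 * (q + 1)) := by
    exact_mod_cast fatCount_split g l (2 * l + 3 * q) q
  rw [Nat.cast_sub hq] at h
  push_cast at h
  rw [fatWeight, fatWeight, show 2 * l + 3 * (q + 1) = 2 * l + 3 * q + 3 by ring]
  rw [div_mul_eq_mul_div, mul_div_assoc', div_le_div_iff₀ (by positivity) (by positivity)]
  linarith

/-- Splitting raises the number of kernel vertices of a windmill from one up to `2 * l`, the
deficiency being positive at each step before. -/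
lemma fatWeight_pos (g l : ℕ) (hl : 1 ≤ l) : 0 < fatWeight g l (2 * l) := by
  have key : ∀ j, j + 1 ≤ 2 * l → 0 < fatWeight g l (j + 1) := by
    intro j
    induction j with
    | zero =>
      intro _
      have := fatCount_one_pos g l hl
      unfold fatWeight
      positivity
    | succ j ih =>
      intro hj
      have h1 := ih (by omega)
      have h2 := fatWeight_succ g l (j + 1) (by omega)
      have h3 : (0 : ℝ) < 2 * l - (j + 1 : ℕ) := by
        have : ((j + 1 + 1 : ℕ) : ℝ) ≤ ((2 * l : ℕ) : ℝ) := Nat.cast_le.2 hj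
        push_cast at this ⊢
        linarith
      have h4 := (mul_pos h1 h3).trans_le h2
      exact pos_of_mul_pos_right h4 (by positivity)
  have := key (2 * l - 1) (by omega)
  rwa [show 2 * l - 1 + 1 = 2 * l by omega] at this

/-- At deficiency `d + 1` a kernel vertex can be split in at least `d + 1` ways, and reversing the
split costs `9 * (q + 1) ≤ 18 * l`; the product of the quotients is `(18 * l) ^ d / d!`. -/
lemma fatWeight_sub_le (g l d : ℕ) (hd : d ≤ 2 * l) :
    fatWeight g l (2 * l - d) ≤ (18 * l : ℝ) ^ d / d.factorial * fatWeight g l (2 * l) := by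
  induction d with
  | zero => simp
  | succ d ih =>
    have h := fatWeight_succ g l (2 * l - (d + 1)) (by omega)
    rw [show 2 * l - (d + 1) + 1 = 2 * l - d by omega, Nat.cast_sub hd] at h
    have h2 := ih (by omega)
    have hd' : ((d + 1 : ℕ) : ℝ) ≤ ((2 * l : ℕ) : ℝ) := Nat.cast_le.2 hd
    have h3 := fatWeight_nonneg g l (2 * l - d)
    push_cast at h hd'
    have hpos : (0 : ℝ) < d + 1 := by positivity
    have h4 : fatWeight g l (2 * l - (d + 1)) * (d + 1) ≤ 18 * l * fatWeight g l (2 * l - d) := by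
      have h5 : (2 * (l : ℝ) - (d + 1) + 1) * fatWeight g l (2 * l - d) ≤
          2 * l * fatWeight g l (2 * l - d) := by
        gcongr; linarith
      nlinarith
    have h6 : fatWeight g l (2 * l - (d + 1)) * (d + 1) ≤
        18 * l * ((18 * l : ℝ) ^ d / d.factorial * fatWeight g l (2 * l)) :=
      h4.trans (by gcongr)
    rw [← le_div_iff₀ hpos] at h6
    refine h6.trans_eq ?_
    rw [Nat.factorial_succ, pow_succ]
    push_cast
    field_simp

/-- Each unit of deficiency removes one kernel edge, which lowers the power of `s + l` by one, and
brings a factor `18 * l * y / d`. The sum is therefore part of the binomial expansion of `(s + l +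
18 * l * y) ^ (3 * l - 1)`. -/
lemma sum_coreCount_le (g l s : ℕ) (hl : 1 ≤ l) (y : ℝ) (hy : 0 ≤ y) :
    ∑ d ∈ Finset.range (2 * l + 1), y ^ d * (coreCount g l s (2 * l - d) : ℝ) ≤
      s.factorial * (fatWeight g l (2 * l) *
        ((s + l + 18 * l * y : ℝ) ^ (3 * l - 1) / (3 * l - 1).factorial)) := by
  have h0 := fatWeight_nonneg g l (2 * l)
  have hterm : ∀ d ∈ Finset.range (2 * l + 1), y ^ d * (coreCount g l s (2 * l - d) : ℝ) ≤
      s.factorial * (fatWeight g l (2 * l) * ((18 * l * y : ℝ) ^ d * (s + l : ℝ) ^ (3 * l - 1 - d) *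
        (3 * l - 1).choose d / (3 * l - 1).factorial)) := by
    intro d hd
    have hd : d ≤ 2 * l := by rw [Finset.mem_range] at hd; omega
    have h1 := coreCount_le_choose g l s (2 * l - d) (3 * l - 1 - d) (by omega)
    have h2 := fatWeight_sub_le g l d hd
    have h3 : (coreCount g l s (2 * l - d) : ℝ) ≤ s.factorial *
        ((18 * l : ℝ) ^ d / d.factorial * fatWeight g l (2 * l) *
          ((s + l : ℝ) ^ (3 * l - 1 - d) / (3 * l - 1 - d).factorial)) :=
      h1.trans (by gcongr)
    refine (mul_le_mul_of_nonneg_left h3 (by positivity : 0 ≤ y ^ d)).trans_eq ?_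
    have h4 : (((3 * l - 1).choose d : ℕ) : ℝ) * d.factorial * (3 * l - 1 - d).factorial =
        (3 * l - 1).factorial := by
      exact_mod_cast Nat.choose_mul_factorial_mul_factorial (show d ≤ 3 * l - 1 by omega)
    have h5 : (((3 * l - 1).choose d : ℕ) : ℝ) ≠ 0 := by
      exact_mod_cast (Nat.choose_pos (show d ≤ 3 * l - 1 by omega)).ne'
    rw [← h4]
    field_simp
    ring
  refine (Finset.sum_le_sum hterm).trans ?_
  rw [← Finset.mul_sum, ← Finset.mul_sum, ← Finset.sum_div]
  gcongr
  rw [show (s + l + 18 * l * y : ℝ) = 18 * l * y + (s + l) by ring, add_pow]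
  refine Finset.sum_le_sum_of_subset_of_nonneg ?_ ?_
  · apply Finset.range_subset_range.2; omega
  · intros; positivity

end SimpleGraph

/-! ### Counting rooted forests, given by their parent maps -/

section ParentMaps

variable {V : Type*}

/-- Every iteration of `f` arrives at a fixed point, so that `f` is the parent map of a rooted
forest. -/
def IsParentMap (f : V → V) : Prop := ∀ x, ∃ k, f (f^[k] x) = f^[k] x

lemma iterate_fixed {f : V → V} {x : V} {k : ℕ} (h : f (f^[k] x) = f^[k] x) (j : ℕ) :
    f^[j + k] x = f^[k] x := by
  rw [Function.iterate_add_apply]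
  exact Function.iterate_fixed h j

/-- Going round the period often enough returns to `x` and also arrives at a fixed point. -/
lemma IsParentMap.fixed_of_periodic {f : V → V} (hf : IsParentMap f) {x : V} {j : ℕ}
    (h : f^[j + 1] x = x) : f x = x := by
  obtain ⟨k, hk⟩ := hf x
  have h1 : f^[(j + 1) * k] x = x := by
    rw [Function.iterate_mul]
    exact Function.iterate_fixed h k
  rw [show (j + 1) * k = j * k + k by ring, iterate_fixed hk] at h1
  rwa [h1] at hk

variable [DecidableEq V]

/-- Up to the first visit to `v` the two maps agree along the orbit. -/
lemma exists_iterate_of_update {f : V → V} {v w : V} :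
    ∀ (k : ℕ) (x : V), (Function.update f v w)^[k] x = v → ∃ j, f^[j] x = v := by
  intro k
  induction k with
  | zero => exact fun x h => ⟨0, h⟩
  | succ k ih =>
    intro x h
    by_cases hx : x = v
    · exact ⟨0, hx⟩
    · rw [Function.iterate_succ_apply, Function.update_of_ne hx] at h
      obtain ⟨j, hj⟩ := ih _ h
      exact ⟨j + 1, by rwa [Function.iterate_succ_apply]⟩

lemma iterate_update_of_forall_ne {f : V → V} {v w x : V} (h : ∀ k, f^[k] x ≠ v) (k : ℕ) :
    (Function.update f v w)^[k] x = f^[k] x := by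
  induction k with
  | zero => rfl
  | succ k ih =>
    rw [Function.iterate_succ_apply', Function.iterate_succ_apply', ih, Function.update_of_ne (h k)]

lemma exists_update_fixed {f : V → V} {v : V} :
    ∀ (k : ℕ) (x : V), f (f^[k] x) = f^[k] x →
      ∃ j, Function.update f v v ((Function.update f v v)^[j] x) =
        (Function.update f v v)^[j] x := by
  intro k
  induction k with
  | zero =>
    intro x h
    refine ⟨0, ?_⟩
    by_cases hx : x = v
    · subst hx; simp
    · simpa [Function.update_of_ne hx] using h
  | succ k ih =>
    intro x h
    by_cases hx : x = v
    · exact ⟨0, by subst hx; simp⟩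
    · obtain ⟨j, hj⟩ := ih (f x) h
      refine ⟨j + 1, ?_⟩
      rw [Function.iterate_succ_apply, Function.update_of_ne hx]
      exact hj

lemma IsParentMap.update_self {f : V → V} (hf : IsParentMap f) (v : V) :
    IsParentMap (Function.update f v v) := fun x => by
  obtain ⟨k, hk⟩ := hf x
  exact exists_update_fixed k x hk

lemma IsParentMap.update {f : V → V} (hf : IsParentMap f) {u v : V} (huv : ∀ k, f^[k] u ≠ v) :
    IsParentMap (Function.update f v u) := by
  have key : ∀ x, (∀ k, f^[k] x ≠ v) → ∃ k, Function.update f v u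
      ((Function.update f v u)^[k] x) = (Function.update f v u)^[k] x := by
    intro x hx
    obtain ⟨k, hk⟩ := hf x
    refine ⟨k, ?_⟩
    rw [iterate_update_of_forall_ne hx, Function.update_of_ne (hx k), hk]
  intro x
  by_cases hx : ∀ k, (Function.update f v u)^[k] x ≠ v
  · apply key
    intro k hk
    obtain ⟨j, hj⟩ := exists_iterate_of_update (f := Function.update f v u) (v := v) (w := f v)
      k x (by rwa [Function.update_idem, Function.update_eq_self])
    exact hx j hj
  · push Not at hx
    obtain ⟨j, hj⟩ := hx
    obtain ⟨k, hk⟩ := key u huv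
    refine ⟨k + (j + 1), ?_⟩
    rwa [Function.iterate_add_apply, Function.iterate_succ_apply', hj, Function.update_self]

end ParentMaps

/-- The parent maps of rooted forests with `s` roots. -/
def parentMaps (V : Type*) (s : ℕ) : Set (V → V) :=
  {f | IsParentMap f ∧ {x | f x = x}.ncard = s}

/-- Cutting a non-root `v` from its parent makes it a root. Conversely, a root `v` can be hung below
any `u` outside its own tree: `u` is arbitrary, and `v` is any of the `s` roots other than that of
`u`. This is Cayley's formula for forests in recursive form. -/
lemma ncard_parentMaps_succ (V : Type*) [Finite V] (s : ℕ) :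
    (parentMaps V s).ncard * (Nat.card V - s) =
      (parentMaps V (s + 1)).ncard * (Nat.card V * s) := by
  classical
  set R₁ : Set ((V → V) × V) := {p | p.1 ∈ parentMaps V s ∧ p.1 p.2 ≠ p.2} with hR₁
  set R₂ : Set ((V → V) × (V × V)) :=
    {p | p.1 ∈ parentMaps V (s + 1) ∧ p.1 p.2.2 = p.2.2 ∧ ∀ k, p.1^[k] p.2.1 ≠ p.2.2} with hR₂
  have e₁ : R₁.ncard = (parentMaps V s).ncard * (Nat.card V - s) := by
    refine ncard_eq_mul_of_fiber (fun p hp => hp.1) fun f hf => ?_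
    have : {b | (f, b) ∈ R₁} = {x | f x = x}ᶜ := by
      ext x; exact ⟨fun h => h.2, fun h => ⟨hf, h⟩⟩
    rw [this, Set.ncard_compl, hf.2]
  have e₂ : R₂.ncard = (parentMaps V (s + 1)).ncard * (Nat.card V * s) := by
    refine ncard_eq_mul_of_fiber (fun p hp => hp.1) fun f hf => ?_
    rw [← Set.ncard_univ]
    refine ncard_eq_mul_of_fiber (fun p _ => Set.mem_univ _) fun u _ => ?_
    obtain ⟨k, hk⟩ := hf.1 u
    have : {v | (u, v) ∈ {b | (f, b) ∈ R₂}} = {x | f x = x} \ {f^[k] u} := by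
      ext v
      constructor
      · rintro ⟨-, h1, h2⟩
        exact ⟨h1, fun h => h2 k h.symm⟩
      · rintro ⟨h1, h2⟩
        refine ⟨hf, h1, fun j hj => h2 ?_⟩
        have h1 : f v = v := h1
        have hj : f^[j] u = v := hj
        have h3 := iterate_fixed hk j
        rw [add_comm, iterate_fixed (show f (f^[j] u) = f^[j] u by rw [hj, h1]), hj] at h3
        exact h3
    rw [this, Set.ncard_sdiff_singleton_of_mem (show f^[k] u ∈ {x | f x = x} from hk), hf.2, Nat.add_sub_cancel]
  rw [← e₁, ← e₂]
  have hfix : ∀ (f : V → V) (v : V), f v ≠ v →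
      {x | Function.update f v v x = x} = insert v {x | f x = x} := by
    intro f v hv
    ext x
    by_cases hx : x = v
    · subst hx; simp
    · simp [hx]
  refine Set.ncard_congr (fun p _ => (Function.update p.1 p.2 p.2, (p.1 p.2, p.2))) ?_ ?_ ?_
  · rintro ⟨f, v⟩ ⟨hf, hv⟩
    have hv : f v ≠ v := hv
    refine ⟨⟨hf.1.update_self v, ?_⟩, Function.update_self v v f, ?_⟩
    · show {x | Function.update f v v x = x}.ncard = s + 1
      rw [hfix f v hv, Set.ncard_insert_of_notMem (by exact hv), hf.2]
    · intro k hk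
      obtain ⟨j, hj⟩ := exists_iterate_of_update k (f v) hk
      exact hv (hf.1.fixed_of_periodic (j := j) hj)
  · rintro ⟨f, v⟩ ⟨f', v'⟩ _ _ h
    simp only [Prod.mk.injEq] at h
    obtain ⟨h1, h2, rfl⟩ := h
    refine Prod.ext ?_ rfl
    have := congrArg (fun F => Function.update F v (f v)) h1
    simp only [Function.update_idem] at this
    rwa [Function.update_eq_self, h2, Function.update_eq_self] at this
  · rintro ⟨f, u, v⟩ ⟨hf, hv, huv⟩
    have hv : f v = v := hv
    have huv : ∀ k, f^[k] u ≠ v := huv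
    -- Redirecting the root `v` to `u` and making it a root again restores `f`, so the
    -- correspondence is onto.
    have h0 : Function.update (Function.update f v u) v v = f := by
      rw [Function.update_idem]
      conv_rhs => rw [← Function.update_eq_self v f, hv]
    have hne : Function.update f v u v ≠ v := by
      rw [Function.update_self]; exact huv 0
    refine ⟨(Function.update f v u, v), ⟨⟨hf.1.update huv, ?_⟩, hne⟩, ?_⟩
    · have h3 := hfix _ v hne
      rw [h0] at h3
      have h4 := hf.2
      rw [h3, Set.ncard_insert_of_notMem (by exact hne)] at h4
      exact Nat.succ_injective h4
    · simp only [Function.update_self, h0]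

/-! ### Cycles in cores -/

namespace SimpleGraph

variable {V : Type*} {C : SimpleGraph V}

lemma ndeg_eq_degree [Fintype V] [DecidableRel C.Adj] (v : V) : C.ndeg v = C.degree v := by
  rw [ndeg, Set.ncard_eq_toFinset_card', ← card_neighborFinset_eq_degree]
  rfl

lemma sum_ndeg_eq [Fintype V] : ∑ v, C.ndeg v = 2 * C.edgeSet.ncard := by
  classical
  simp_rw [ndeg_eq_degree]
  rw [sum_degrees_eq_twice_card_edges, ← coe_edgeFinset, Set.ncard_coe_finset]

lemma ndeg_toSimpleGraph (K : C.ConnectedComponent) (v : K) :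
    K.toSimpleGraph.ndeg v = C.ndeg v := by
  have : C.neighborSet v = Subtype.val '' K.toSimpleGraph.neighborSet v := by
    ext u
    constructor
    · intro h
      have h : C.Adj v u := h
      exact ⟨⟨u, K.mem_supp_of_adj_mem_supp v.2 h⟩, h, rfl⟩
    · rintro ⟨u, h, rfl⟩
      exact h
  rw [ndeg, ndeg, this, Set.ncard_image_of_injective _ Subtype.val_injective]

/-- In a graph of minimum degree two, the component of a vertex of higher degree is complex. -/
lemma exists_two_cycles [Finite V] (h2 : ∀ v ∈ C.support, 2 ≤ C.ndeg v) {w : V}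
    (hw : 3 ≤ C.ndeg w) :
    ∃ (u v : V) (p : C.Walk u u) (q : C.Walk v v), C.Reachable w u ∧ C.Reachable w v ∧
      p.IsCycle ∧ q.IsCycle ∧ {e | e ∈ p.edges} ≠ {e | e ∈ q.edges} := by
  classical
  have := Fintype.ofFinite V
  set K := C.connectedComponentMk w with hK
  have hwK : w ∈ K.supp := rfl
  have hc := K.connected_toSimpleGraph
  have hdeg : ∀ v : K, 2 ≤ K.toSimpleGraph.ndeg v := by
    intro v
    rw [ndeg_toSimpleGraph]
    apply h2
    have hr : C.Reachable w v := (ConnectedComponent.eq.1 v.2).symm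
    rcases eq_or_ne w v with h | h
    · exact mem_support_of_ndeg_pos (by rw [← h]; omega)
    · exact mem_support_of_reachable h.symm hr.symm
  have hcard : Nat.card K + 1 ≤ Nat.card K.toSimpleGraph.edgeSet := by
    have e1 := sum_ndeg_eq (C := K.toSimpleGraph)
    have e2 : ∑ _v : K, 2 < ∑ v : K, K.toSimpleGraph.ndeg v := by
      refine Finset.sum_lt_sum (fun v _ => hdeg v) ⟨⟨w, hwK⟩, Finset.mem_univ _, ?_⟩
      rw [ndeg_toSimpleGraph]
      exact hw
    rw [e1, Finset.sum_const, smul_eq_mul, Finset.card_univ, ← Nat.card_eq_fintype_card,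
      ← Nat.card_coe_set_eq] at e2
    omega
  have hcyc : ∀ H : SimpleGraph K, H.Connected → Nat.card K ≤ Nat.card H.edgeSet →
      ∃ (u : K) (p : H.Walk u u), p.IsCycle := by
    intro H hH hcard
    by_contra! hno
    have h1 := (isTree_iff_connected_and_card.1 (⟨hH, fun u p => hno u p⟩ : H.IsTree)).2
    omega
  obtain ⟨u, p, hp⟩ := hcyc _ hc (by omega)
  obtain ⟨a, b, he⟩ : ∃ a b, s(a, b) ∈ p.edges := by
    cases p with
    | nil => exact absurd hp Walk.not_isCycle_nil
    | cons h p => exact ⟨_, _, List.mem_cons_self⟩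
  set e := s(a, b) with he_def
  -- An edge of the first cycle is no bridge. Without it the component is connected and still has at
  -- least as many edges as vertices, which yields a cycle avoiding it.
  have hbr : ¬ K.toSimpleGraph.IsBridge e := fun hb =>
    (isBridge_iff_forall_cycle_notMem (p.edges_subset_edgeSet he)).1 hb p hp he
  have hc' := hc.connected_delete_edge_of_not_isBridge hbr
  obtain ⟨v, q, hq⟩ := hcyc _ hc' (by
    rw [← he_def, edgeSet_deleteEdges, Nat.card_coe_set_eq,
      Set.ncard_sdiff_singleton_of_mem (p.edges_subset_edgeSet he), ← Nat.card_coe_set_eq]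
    omega)
  have hinj : Function.Injective K.toSimpleGraph_hom := Subtype.val_injective
  have heq : e ∉ q.edges := fun h => by
    have := q.edges_subset_edgeSet h
    rw [edgeSet_deleteEdges] at this
    exact this.2 rfl
  refine ⟨u, v, p.map K.toSimpleGraph_hom, (q.mapLe (deleteEdges_le _)).map K.toSimpleGraph_hom,
    (ConnectedComponent.eq.1 u.2).symm, (ConnectedComponent.eq.1 v.2).symm, hp.map hinj,
    (hq.mapLe _).map hinj, fun heq' => heq ?_⟩
  have h1 : Sym2.map K.toSimpleGraph_hom e ∈ (p.map K.toSimpleGraph_hom).edges := by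
    rw [Walk.edges_map]
    exact List.mem_map_of_mem he
  have h2 := (Set.ext_iff.1 heq' _).1 h1
  change _ ∈ (Walk.map _ _).edges at h2
  rw [Walk.edges_map, Walk.edges_mapLe_eq_edges, List.mem_map] at h2
  obtain ⟨e', he', h3⟩ := h2
  rwa [← Sym2.map.injective hinj h3]

/-- The vertices and edges of a cycle among vertices of degree two fill a component. -/
lemma Walk.IsCycle.mem_edges_of_ndeg_eq_two [Finite V] {u : V} {p : C.Walk u u} (hp : p.IsCycle)
    (h2 : ∀ v, C.Reachable u v → C.ndeg v = 2) {a b : V} (ha : C.Reachable u a) (hab : C.Adj a b) :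
    s(a, b) ∈ p.edges := by
  classical
  have hnb : ∀ a ∈ p.support, ∀ b, C.Adj a b → p.toSubgraph.Adj a b := by
    intro a ha b hab
    have h : p.toSubgraph.neighborSet a = C.neighborSet a := by
      apply Set.eq_of_subset_of_ncard_le (p.toSubgraph.neighborSet_subset a)
      rw [hp.ncard_neighborSet_toSubgraph_eq_two ha]
      exact (h2 a (p.takeUntil a ha).reachable).le
    have : b ∈ p.toSubgraph.neighborSet a := by rw [h]; exact hab
    exact this
  have hsupp : ∀ x y, C.Walk x y → x ∈ p.support → y ∈ p.support := by
    intro x y r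
    induction r with
    | nil => exact id
    | cons h _ ih =>
      intro hx
      apply ih
      rw [← Walk.mem_verts_toSubgraph]
      exact (hnb _ hx _ h).snd_mem
  obtain ⟨r⟩ := ha
  exact Walk.mem_edges_toSubgraph p |>.1 (hnb a (hsupp _ _ r p.start_mem_support) b hab)

/-- If all degrees in the component were two, each of the cycles would use all its edges, and their
edge sets would coincide. -/
lemma Walk.IsCycle.exists_three_le_ndeg [Finite V] (h2 : ∀ v ∈ C.support, 2 ≤ C.ndeg v)
    {u v : V} {p : C.Walk u u} {q : C.Walk v v} (hp : p.IsCycle) (hq : q.IsCycle)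
    (huv : C.Reachable u v) (hne : {e | e ∈ p.edges} ≠ {e | e ∈ q.edges}) :
    ∃ w, C.Reachable u w ∧ 3 ≤ C.ndeg w := by
  classical
  by_contra! hno
  have hu : u ∈ C.support := by
    cases p with
    | nil => exact absurd hp Walk.not_isCycle_nil
    | cons h _ => exact ⟨_, h⟩
  have h2' : ∀ w, C.Reachable u w → C.ndeg w = 2 := by
    intro w hw
    have h3 := hno w hw
    have h4 : w ∈ C.support := by
      obtain ⟨r⟩ := hw.symm
      cases r with
      | nil => exact hu
      | cons h _ => exact ⟨_, h⟩
    have := h2 w h4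
    omega
  have h2'' : ∀ w, C.Reachable v w → C.ndeg w = 2 := fun w hw => h2' w (huv.trans hw)
  apply hne
  ext e
  induction e with | _ a b =>
  constructor
  · intro h
    have ha : a ∈ p.support := p.fst_mem_support_of_mem_edges h
    exact hq.mem_edges_of_ndeg_eq_two h2''
      (huv.symm.trans ⟨p.takeUntil a ha⟩) (p.adj_of_mem_edges h)
  · intro h
    have ha : a ∈ q.support := q.fst_mem_support_of_mem_edges h
    exact hp.mem_edges_of_ndeg_eq_two h2'
      (huv.trans ⟨q.takeUntil a ha⟩) (q.adj_of_mem_edges h)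

/-- A forest has as many components as it has more vertices than edges. -/
lemma IsAcyclic.sum_ndeg [Fintype V] (h : C.IsAcyclic) :
    ∑ v, C.ndeg v + 2 * Nat.card C.ConnectedComponent = 2 * Nat.card V := by
  classical
  have hK : ∀ K : C.ConnectedComponent, ∑ v : K, C.ndeg v + 2 = 2 * Nat.card K := by
    intro K
    have h1 := (isTree_iff_connected_and_card.1 (h.isTree_connectedComponent K)).2
    have h3 := sum_ndeg_eq (C := K.toSimpleGraph)
    rw [← Nat.card_coe_set_eq] at h3
    simp_rw [ndeg_toSimpleGraph] at h3
    omega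
  let e : V ≃ Σ K : C.ConnectedComponent, K :=
    { toFun := fun v => ⟨C.connectedComponentMk v, v, rfl⟩
      invFun := fun x => x.2
      left_inv := fun _ => rfl
      right_inv := by rintro ⟨K, v, rfl⟩; rfl }
  have e1 : ∑ v, C.ndeg v = ∑ K : C.ConnectedComponent, ∑ v : K, C.ndeg v := by
    rw [← Fintype.sum_sigma (fun x : Σ K : C.ConnectedComponent, K => C.ndeg x.2)]
    exact Fintype.sum_equiv e _ _ fun v => rfl
  have e2 : Nat.card V = ∑ K : C.ConnectedComponent, Nat.card K := by
    rw [← Nat.card_sigma]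
    exact Nat.card_congr e
  rw [e1, e2, Nat.card_eq_fintype_card, Fintype.card_eq_sum_ones, Finset.mul_sum, Finset.mul_sum,
    ← Finset.sum_add_distrib]
  exact Finset.sum_congr rfl fun K _ => hK K

end SimpleGraph

/-! ### The deficiency in terms of the core -/

namespace SimpleGraph

variable {V : Type*} {G : SimpleGraph V}

/-! ### Core edges at a vertex of degree two. -/

section Edges

variable {v : V} (hv : G.core.spanningCoe.ndeg v = 2)
include hv

lemma core_edge_unique {e f f' : G.core.edgeSet} (he : v ∈ e.1) (hf : v ∈ f.1) (hf' : v ∈ f'.1)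
    (hef : e ≠ f) (hef' : e ≠ f') : f = f' := by
  obtain ⟨x, y, -, hN⟩ := Set.ncard_eq_two.1 hv
  obtain ⟨e, he'⟩ := e
  obtain ⟨f, hf1⟩ := f
  obtain ⟨f', hf1'⟩ := f'
  obtain ⟨a, rfl⟩ := he
  obtain ⟨b, rfl⟩ := hf
  obtain ⟨c, rfl⟩ := hf'
  have h1 : a ∈ ({x, y} : Set V) := hN ▸ (show a ∈ G.core.spanningCoe.neighborSet v from he')
  have h2 : b ∈ ({x, y} : Set V) := hN ▸ (show b ∈ G.core.spanningCoe.neighborSet v from hf1)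
  have h3 : c ∈ ({x, y} : Set V) := hN ▸ (show c ∈ G.core.spanningCoe.neighborSet v from hf1')
  have h4 : a ≠ b := by rintro rfl; exact hef rfl
  have h5 : a ≠ c := by rintro rfl; exact hef' rfl
  have : b = c := by
    simp only [Set.mem_insert_iff, Set.mem_singleton_iff] at h1 h2 h3
    grind
  subst this
  rfl

lemma ncard_pairs_at :
    {p : G.core.edgeSet × G.core.edgeSet | p.1 ≠ p.2 ∧ v ∈ p.1.1 ∧ v ∈ p.2.1}.ncard = 2 := by
  obtain ⟨x, y, hxy, hN⟩ := Set.ncard_eq_two.1 hv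
  have hx : s(v, x) ∈ G.core.edgeSet := by
    show x ∈ G.core.spanningCoe.neighborSet v
    rw [hN]; simp
  have hy : s(v, y) ∈ G.core.edgeSet := by
    show y ∈ G.core.spanningCoe.neighborSet v
    rw [hN]; simp
  have hne : (⟨_, hx⟩ : G.core.edgeSet) ≠ ⟨_, hy⟩ := by
    intro h
    have := Sym2.congr_right.1 (congrArg Subtype.val h)
    exact hxy this
  have hmem : ∀ e : G.core.edgeSet, v ∈ e.1 → e = ⟨_, hx⟩ ∨ e = ⟨_, hy⟩ := by
    rintro ⟨e, he⟩ ⟨a, rfl⟩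
    have h1 : a ∈ ({x, y} : Set V) := hN ▸ (show a ∈ G.core.spanningCoe.neighborSet v from he)
    rcases h1 with rfl | rfl
    · exact Or.inl rfl
    · exact Or.inr rfl
  refine Set.ncard_eq_two.2 ⟨(⟨_, hx⟩, ⟨_, hy⟩), (⟨_, hy⟩, ⟨_, hx⟩), ?_, ?_⟩
  · intro h
    exact hne (congrArg Prod.fst h)
  · ext ⟨e, f⟩
    constructor
    · rintro ⟨h1, h2, h3⟩
      rcases hmem e h2 with rfl | rfl <;> rcases hmem f h3 with rfl | rfl
      · exact absurd rfl h1
      · exact Or.inl rfl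
      · exact Or.inr rfl
      · exact absurd rfl h1
    · rintro (h | h)
      · obtain ⟨rfl, rfl⟩ := Prod.mk.inj h
        exact ⟨hne, Sym2.mem_mk_left _ _, Sym2.mem_mk_left _ _⟩
      · obtain ⟨rfl, rfl⟩ := Prod.mk.inj h
        exact ⟨hne.symm, Sym2.mem_mk_left _ _, Sym2.mem_mk_left _ _⟩

end Edges

/-- The edges of the thread graph correspond to the core vertices of degree two: each such vertex
joins exactly two core edges, and distinct core edges share at most one vertex. -/
lemma sum_ndeg_threadGraph [Finite V] [Fintype G.core.edgeSet] :
    ∑ e, G.threadGraph.ndeg e = {v | G.core.spanningCoe.ndeg v = 2}.ncard * 2 := by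
  set R : Set (V × (G.core.edgeSet × G.core.edgeSet)) := {t | G.core.spanningCoe.ndeg t.1 = 2 ∧
    t.2.1 ≠ t.2.2 ∧ t.1 ∈ t.2.1.1 ∧ t.1 ∈ t.2.2.1} with hR
  set R' : Set (G.core.edgeSet × G.core.edgeSet) := {p | G.threadGraph.Adj p.1 p.2} with hR'
  have e₁ : R.ncard = {v | G.core.spanningCoe.ndeg v = 2}.ncard * 2 := by
    refine ncard_eq_mul_of_fiber (fun t ht => ht.1) fun v hv => ?_
    rw [← ncard_pairs_at hv]
    congr 1
    ext p
    exact ⟨fun h => h.2, fun h => ⟨hv, h⟩⟩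
  have e₂ : R'.ncard = ∑ e, G.threadGraph.ndeg e := by
    rw [ncard_eq_sum_fiber]
    rfl
  rw [← e₁, ← e₂]
  symm
  refine Set.ncard_congr (fun t _ => t.2) ?_ ?_ ?_
  · rintro ⟨v, e, f⟩ ⟨h1, h2, h3, h4⟩
    exact ⟨h2, v, h3, h4, h1⟩
  · rintro ⟨v, e, f⟩ ⟨v', e', f'⟩ ⟨h1, h2, h3, h4⟩ ⟨h1', h2', h3', h4'⟩ h
    obtain ⟨rfl, rfl⟩ := Prod.mk.inj h
    refine Prod.ext ?_ rfl
    by_contra hne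
    apply h2
    apply Subtype.ext
    exact ((Sym2.mem_and_mem_iff hne).1 ⟨h3, h3'⟩).trans
      ((Sym2.mem_and_mem_iff hne).1 ⟨h4, h4'⟩).symm
  · rintro ⟨e, f⟩ ⟨h2, v, h3, h4, h1⟩
    exact ⟨(v, e, f), ⟨h1, h2, h3, h4⟩, rfl⟩

/-- Both ends of each core edge on a cycle of threads have degree two, and all core edges there lie
on the cycle. Hence the cycle would exhaust a component of the core, which contains a kernel vertex.
-/
lemma isAcyclic_threadGraph [Finite V] (hC : G.core.spanningCoe.IsCoreGraph) :
    G.threadGraph.IsAcyclic := by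
  intro e₀ p hp
  have key : ∀ e ∈ p.support, ∀ x ∈ e.1, G.core.spanningCoe.ndeg x = 2 ∧
      ∀ f : G.core.edgeSet, x ∈ f.1 → f ∈ p.support := by
    intro e he
    obtain ⟨f, f', hff', hN⟩ := Set.ncard_eq_two.1 (hp.ncard_neighborSet_toSubgraph_eq_two he)
    have hf : p.toSubgraph.Adj e f := by
      show f ∈ p.toSubgraph.neighborSet e
      rw [hN]; simp
    have hf' : p.toSubgraph.Adj e f' := by
      show f' ∈ p.toSubgraph.neighborSet e
      rw [hN]; simp
    have hfs : f ∈ p.support := (p.mem_verts_toSubgraph).1 hf.snd_mem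
    have hfs' : f' ∈ p.support := (p.mem_verts_toSubgraph).1 hf'.snd_mem
    obtain ⟨h1, v, h2, h3, h4⟩ := hf.adj_sub
    obtain ⟨h1', v', h2', h3', h4'⟩ := hf'.adj_sub
    have hvv : v ≠ v' := by
      rintro rfl
      exact hff' (core_edge_unique h4 h2 h3 h3' h1 h1')
    have hkey : ∀ x (f : G.core.edgeSet), x ∈ e.1 → x ∈ f.1 → e ≠ f → f ∈ p.support →
        G.core.spanningCoe.ndeg x = 2 →
        ∀ f' : G.core.edgeSet, x ∈ f'.1 → f' ∈ p.support := by
      intro x f hx hxf hef hfs h2 f' hxf'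
      by_cases hef' : e = f'
      · exact hef' ▸ he
      · exact core_edge_unique h2 hx hxf hxf' hef hef' ▸ hfs
    intro x hx
    rw [(Sym2.mem_and_mem_iff hvv).1 ⟨h2, h2'⟩, Sym2.mem_iff] at hx
    rcases hx with rfl | rfl
    · exact ⟨h4, hkey _ f h2 h3 h1 hfs h4⟩
    · exact ⟨h4', hkey _ f' h2' h3' h1' hfs' h4'⟩
  have hreach : ∀ x y, G.core.spanningCoe.Walk x y → (∃ e ∈ p.support, x ∈ e.1) →
      ∃ e ∈ p.support, y ∈ e.1 := by
    intro x y r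
    induction r with
    | nil => exact id
    | @cons a b c h _ ih =>
      rintro ⟨e, he, hx⟩
      exact ih ⟨⟨s(a, b), h⟩, (key e he a hx).2 _ (Sym2.mem_mk_left _ _), Sym2.mem_mk_right _ _⟩
  obtain ⟨⟨x, y⟩, hxy⟩ := e₀
  have hxy' : G.core.spanningCoe.Adj x y := hxy
  obtain ⟨w, ⟨r⟩, hw⟩ := hC.exists_reachable x ⟨y, hxy'⟩
  obtain ⟨e, he, hwe⟩ := hreach x w r ⟨_, p.start_mem_support, Sym2.mem_mk_left x y⟩
  rw [(key e he w hwe).1] at hw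
  omega

lemma kernelVerts_eq : G.kernelVerts = {v | 3 ≤ G.core.spanningCoe.ndeg v} := by
  ext v
  constructor
  · exact fun h => h.2
  · intro h
    refine ⟨?_, h⟩
    obtain ⟨w, hw⟩ := mem_support_of_ndeg_pos (lt_of_lt_of_le (by norm_num)
      (show 3 ≤ G.core.spanningCoe.ndeg v from h))
    exact G.core.edge_vert hw

/-- The thread graph is a forest with `s + l` vertices and `s - q` edges. Its components, the kernel
edges, therefore number `l + q`. -/
lemma deficiency_eq [Fintype V] {g l s q : ℕ} (h : IsCoreOf g l s q G.core.spanningCoe) :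
    G.deficiency = 2 * (l : ℤ) - q := by
  classical
  have h1 := (isAcyclic_threadGraph h.core).sum_ndeg
  have h2 := h.ncard_two
  have h3 := h.sum_ndeg
  have h4 : Nat.card G.core.edgeSet = G.core.spanningCoe.edgeSet.ncard := by
    rw [← Nat.card_coe_set_eq, Subgraph.edgeSet_spanningCoe]
  rw [sum_ndeg_eq] at h3
  rw [sum_ndeg_threadGraph, h4] at h1
  rw [deficiency, kernelVerts_eq, h.kernel_ncard, KernelEdge]
  omega

end SimpleGraph

/-! ### Complex graphs as cores with rooted trees -/

lemma IsParentMap.exists_uniform {V : Type*} [Finite V] {f : V → V} (hf : IsParentMap f) :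
    ∃ N, ∀ x, f (f^[N] x) = f^[N] x := by
  choose k hk using hf
  obtain ⟨N, hN⟩ := (Set.finite_range k).bddAbove
  refine ⟨N, fun x => ?_⟩
  obtain ⟨j, hj⟩ := Nat.exists_eq_add_of_le' (hN ⟨x, rfl⟩ : k x ≤ N)
  rw [hj, iterate_fixed (hk x), hk x]

namespace SimpleGraph

variable {V : Type*}

/-- The graph `C` together with the edges from each vertex to its parent. -/
def attach (C : SimpleGraph V) (f : V → V) : SimpleGraph V where
  Adj u v := C.Adj u v ∨ (u ≠ v ∧ (f u = v ∨ f v = u))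
  symm := ⟨fun _ _ h => h.imp (fun h => h.symm) fun h => ⟨h.1.symm, h.2.symm⟩⟩
  loopless := ⟨fun _ h => h.elim (fun h => h.ne rfl) fun h => h.1 rfl⟩

lemma le_attach (C : SimpleGraph V) (f : V → V) : C ≤ C.attach f := fun _ _ h => Or.inl h

lemma attach_adj_parent (C : SimpleGraph V) {f : V → V} {v : V} (h : f v ≠ v) :
    (C.attach f).Adj v (f v) := Or.inr ⟨h.symm, Or.inl rfl⟩

lemma attach_reachable_iterate (C : SimpleGraph V) (f : V → V) (v : V) (k : ℕ) :
    (C.attach f).Reachable v (f^[k] v) := by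
  induction k with
  | zero => rfl
  | succ k ih =>
    rw [Function.iterate_succ_apply']
    by_cases h : f (f^[k] v) = f^[k] v
    · rwa [h]
    · exact ih.trans (attach_adj_parent C h).reachable

section Core

variable {G : SimpleGraph V}

lemma complexPart_eq_top (hG : G.IsComplex) : G.complexPart = ⊤ := by
  have h : {v | (G.connectedComponentMk v).IsComplex} = Set.univ :=
    Set.eq_univ_of_forall fun v => hG _
  rw [complexPart, h]
  ext <;> simp

lemma le_core (hG : G.IsComplex) {H : G.Subgraph}
    (hH : ∀ v ∈ H.verts, 2 ≤ (H.neighborSet v).ncard) : H ≤ G.core :=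
  le_sSup ⟨by rw [complexPart_eq_top hG]; exact le_top, hH⟩

lemma two_le_core [Finite V] {v : V} (hv : v ∈ G.core.verts) :
    2 ≤ G.core.spanningCoe.ndeg v := by
  rw [core, Subgraph.verts_sSup, Set.mem_iUnion₂] at hv
  obtain ⟨H, hH, hv⟩ := hv
  exact (hH.2 v hv).trans (Set.ncard_le_ncard
    (Subgraph.neighborSet_subset_of_subgraph (le_sSup hH) v) (Set.toFinite _))

lemma support_core [Finite V] : G.core.spanningCoe.support = G.core.verts := by
  ext v
  constructor
  · rintro ⟨w, hw⟩
    exact G.core.edge_vert hw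
  · intro hv
    have := two_le_core hv
    exact mem_support_of_ndeg_pos (by omega)

lemma coreOrder_eq [Finite V] : G.coreOrder = G.core.spanningCoe.support.ncard := by
  rw [support_core, coreOrder]

lemma Walk.IsCycle.toSubgraph_le_core (hG : G.IsComplex) {u : V} {p : G.Walk u u}
    (hp : p.IsCycle) : p.toSubgraph ≤ G.core :=
  le_core hG fun _ hv =>
    (hp.ncard_neighborSet_toSubgraph_eq_two ((p.mem_verts_toSubgraph).1 hv)).ge

end Core

/-! ### Attaching a rooted forest to a core. -/

section Attach

variable {C : SimpleGraph V} {f : V → V} (hf : IsParentMap f) (hS : {x | f x = x} = C.support)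

section Adj

lemma attach_adj_of_notMem {v u : V} (hv : v ∉ C.support) (h : (C.attach f).Adj v u) :
    f v = u ∨ f u = v :=
  h.elim (fun h => absurd h (not_adj_of_notMem_support hv u)) fun h => h.2

include hS

lemma mem_support_iff_fixed {x : V} : x ∈ C.support ↔ f x = x := by rw [← hS]; rfl

lemma support_attach : (C.attach f).support = Set.univ := by
  refine Set.eq_univ_of_forall fun v => ?_
  by_cases hv : v ∈ C.support
  · obtain ⟨w, hw⟩ := hv
    exact ⟨w, le_attach C f hw⟩
  · exact ⟨_, attach_adj_parent C (fun h => hv ((mem_support_iff_fixed hS).2 h))⟩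

end Adj

include hf hS

lemma isComplex_attach [Finite V] (hC : C.IsCoreGraph) : (C.attach f).IsComplex := by
  intro K
  obtain ⟨v, rfl⟩ := K.exists_rep
  obtain ⟨k, hk⟩ := hf v
  have h1 := attach_reachable_iterate C f v k
  obtain ⟨w, hw, hw3⟩ := hC.exists_reachable _ ((mem_support_iff_fixed hS).2 hk)
  obtain ⟨a, b, p, q, ha, hb, hp, hq, hne⟩ := exists_two_cycles hC.two_le hw3
  have h2 := h1.trans (hw.mono (le_attach C f))
  refine ⟨a, b, p.mapLe (le_attach C f), q.mapLe (le_attach C f), ?_, ?_, hp.mapLe _,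
    hq.mapLe _, ?_⟩
  · exact (ConnectedComponent.eq.2 (h2.trans (ha.mono (le_attach C f)))).symm
  · exact (ConnectedComponent.eq.2 (h2.trans (hb.mono (le_attach C f)))).symm
  · simpa only [Walk.edges_mapLe_eq_edges] using hne

/-- Each vertex of `H` outside `C` has, besides its parent, a child in `H`. The set `A` of these
vertices thus satisfies `A ⊆ f '' A` and by finiteness is mapped onto itself, yet iteration of `f`
leads into the support of `C`. -/
lemma verts_subset_of_two_le [Finite V] {H : (C.attach f).Subgraph}
    (hH : ∀ v ∈ H.verts, 2 ≤ (H.neighborSet v).ncard) : H.verts ⊆ C.support := by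
  by_contra hno
  obtain ⟨v, hvH, hvS⟩ := Set.not_subset.1 hno
  set A := H.verts \ C.support with hA
  have hsub : A ⊆ f '' A := by
    rintro x ⟨hx, hxS⟩
    obtain ⟨u, hu, hux⟩ := Set.exists_ne_of_one_lt_ncard (hH x hx) (f x)
    have hu' : H.Adj x u := hu
    rcases attach_adj_of_notMem hxS hu'.adj_sub with h | h
    · exact absurd h.symm hux
    · refine ⟨u, ⟨hu'.snd_mem, fun huS => ?_⟩, h⟩
      rw [mem_support_iff_fixed hS, h] at huS
      exact hu'.adj_sub.ne huS
  have heq : A = f '' A := Set.eq_of_subset_of_ncard_le hsub (Set.ncard_image_le (Set.toFinite _))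
  obtain ⟨k, hk⟩ := hf v
  have hmem : ∀ j, f^[j] v ∈ A := by
    intro j
    induction j with
    | zero => exact ⟨hvH, hvS⟩
    | succ j ih =>
      rw [Function.iterate_succ_apply', heq]
      exact ⟨_, ih, rfl⟩
  exact (hmem k).2 ((mem_support_iff_fixed hS).2 hk)

lemma core_attach [Finite V] (hC : C.IsCoreGraph) :
    (C.attach f).core.spanningCoe = C := by
  have hG := isComplex_attach hf hS hC
  have hverts : (C.attach f).core.verts ⊆ C.support :=
    verts_subset_of_two_le hf hS fun v hv => two_le_core hv
  let H : (C.attach f).Subgraph :=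
    { verts := C.support
      Adj := C.Adj
      adj_sub := fun h => le_attach C f h
      edge_vert := fun h => ⟨_, h⟩
      symm := C.symm }
  have hH : H ≤ (C.attach f).core := le_core hG fun v hv => hC.two_le v hv
  ext u v
  constructor
  · intro h
    have h : (C.attach f).core.Adj u v := h
    rcases h.adj_sub with h1 | ⟨h1, h2 | h2⟩
    · exact h1
    · rw [(mem_support_iff_fixed hS).1 (hverts h.fst_mem)] at h2
      exact absurd h2 h1
    · rw [(mem_support_iff_fixed hS).1 (hverts h.snd_mem)] at h2
      exact absurd h2.symm h1
  · intro h
    exact hH.2 h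

/-- Where the maps differ at `x`, the edge from `x` to `f x` must be a parent edge of `f'` in the
opposite direction. The maps then differ at `f x` as well, and so on up to the root, where they
agree. -/
lemma parent_unique {f' : V → V} (hS' : {x | f' x = x} = C.support)
    (h : C.attach f = C.attach f') : f = f' := by
  have hstep : ∀ x, f x ≠ f' x → x ∉ C.support ∧ f (f x) ≠ f' (f x) := by
    intro x hx
    have hxS : x ∉ C.support := fun hxS =>
      hx (((mem_support_iff_fixed hS).1 hxS).trans ((mem_support_iff_fixed hS').1 hxS).symm)
    have hfx : f x ≠ x := fun h => hxS ((mem_support_iff_fixed hS).2 h)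
    have hadj := attach_adj_parent C hfx
    rw [h] at hadj
    rcases attach_adj_of_notMem hxS hadj with h1 | h1
    · exact absurd h1.symm hx
    · refine ⟨hxS, fun h2 => hfx ?_⟩
      rw [h1] at h2
      exact hf.fixed_of_periodic (j := 1) h2
  ext x
  by_contra hx
  have hall : ∀ k, f (f^[k] x) ≠ f' (f^[k] x) := by
    intro k
    induction k with
    | zero => exact hx
    | succ k ih =>
      rw [Function.iterate_succ_apply']
      exact (hstep _ ih).2
  obtain ⟨k, hk⟩ := hf x
  exact (hstep _ (hall k)).1 ((mem_support_iff_fixed hS).2 hk)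

/-- Each vertex outside the support contributes the edge to its parent. These edges are distinct
because two vertices cannot be parents of each other. -/
lemma ncard_edgeSet_attach [Finite V] :
    (C.attach f).edgeSet.ncard + C.support.ncard = C.edgeSet.ncard + Nat.card V := by
  have h1 : (C.attach f).edgeSet = C.edgeSet ∪ (fun v => s(v, f v)) '' C.supportᶜ := by
    ext e
    induction e with | _ a b =>
    constructor
    · rintro (h | ⟨h1, h2 | h2⟩)
      · exact Or.inl h
      · refine Or.inr ⟨a, fun ha => h1 ?_, congrArg (Sym2.mk a) h2⟩
        rw [← h2, (mem_support_iff_fixed hS).1 ha]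
      · refine Or.inr ⟨b, fun hb => h1 ?_, (congrArg (Sym2.mk b) h2).trans Sym2.eq_swap⟩
        rw [← h2, (mem_support_iff_fixed hS).1 hb]
    · rintro (h | ⟨v, hv, h⟩)
      · exact le_attach C f h
      · rw [← h]
        exact attach_adj_parent C (fun h => hv ((mem_support_iff_fixed hS).2 h))
  have h2 : Disjoint C.edgeSet ((fun v => s(v, f v)) '' C.supportᶜ) := by
    rw [Set.disjoint_right]
    rintro _ ⟨v, hv, rfl⟩ h
    exact not_adj_of_notMem_support hv _ h
  have h3 : Set.InjOn (fun v => s(v, f v)) C.supportᶜ := by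
    intro u hu v hv huv
    rcases Sym2.eq_iff.1 huv with h | h
    · exact h.1
    · refine absurd ((mem_support_iff_fixed hS).2 (hf.fixed_of_periodic (j := 1) ?_)) hu
      show f (f u) = u
      rw [h.2, h.1]
  rw [h1, Set.ncard_union_eq h2, h3.ncard_image, add_assoc, add_comm (Set.ncard _ᶜ),
    Set.ncard_add_ncard_compl]

lemma drawableOn_attach_iff [Finite V] {g : ℕ} : (C.attach f).DrawableOn g ↔ C.DrawableOn g := by
  classical
  constructor
  · intro h
    refine h.of_injOn id Function.injective_id.injOn fun u v huv => le_attach C f huv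
  -- The forest is drawn by pendant edges, starting from the roots: `T` is the set of vertices
  -- already attached, and `m` counts the others.
  · have key : ∀ (m : ℕ) (T : Set V), Tᶜ.ncard = m → C.support ⊆ T → Set.MapsTo f T T →
        (C.attach (fun v => if v ∈ T then f v else v)).DrawableOn g →
          (C.attach f).DrawableOn g := by
      intro m
      induction m with
      | zero =>
        intro T hT _ _ h
        have : T = Set.univ := Set.compl_empty_iff.1 ((Set.ncard_eq_zero).1 hT)
        simpa [this] using h
      | succ m ih =>
        intro T hT hST hmap h
        obtain ⟨v₀, hv₀⟩ : Tᶜ.Nonempty := by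
          rw [← Set.ncard_pos, hT]; omega
        -- The path of parents from a missing vertex ends in the support, so it enters `T`
        -- somewhere.
        obtain ⟨v, hv, hfv⟩ : ∃ v, v ∉ T ∧ f v ∈ T := by
          by_contra! hno
          obtain ⟨k, hk⟩ := hf v₀
          have : ∀ j, f^[j] v₀ ∉ T := by
            intro j
            induction j with
            | zero => exact hv₀
            | succ j ih => rw [Function.iterate_succ_apply']; exact hno _ ih
          exact this k (hST ((mem_support_iff_fixed hS).2 hk))
        have hvf : f v ≠ v := by intro h; rw [h] at hfv; exact hv hfv
        refine ih (insert v T) ?_ (hST.trans (Set.subset_insert _ _)) ?_ ?_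
        · have h1 := Set.ncard_add_ncard_compl T
          have h2 := Set.ncard_add_ncard_compl (insert v T)
          rw [Set.ncard_insert_of_notMem hv] at h2
          omega
        · rintro x (rfl | hx)
          · exact Or.inr hfv
          · exact Or.inr (hmap hx)
        · have hx : v ∉ (C.attach (fun v => if v ∈ T then f v else v)).support := by
            rintro ⟨w, h1 | ⟨h1, h2⟩⟩
            · exact hv (hST ⟨w, h1⟩)
            · simp only [hv, if_false] at h2
              rcases h2 with h2 | h2
              · exact h1 h2
              · split_ifs at h2 with hw
                · exact hv (h2 ▸ hmap hw)
                · exact h1 h2.symm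
          have hfvs : f v ∈ (C.attach (fun v => if v ∈ T then f v else v)).support := by
            by_cases hs : f v ∈ C.support
            · obtain ⟨w, hw⟩ := hs
              exact ⟨w, Or.inl hw⟩
            · refine ⟨f (f v), Or.inr ⟨fun h => hs ((mem_support_iff_fixed hS).2 h.symm), ?_⟩⟩
              simp [hfv]
          have hnew := h.pendant hx hfvs
          have hnadj := not_adj_of_notMem_support hx
          convert hnew using 1
          ext a b
          simp only [split, Set.mem_empty_iff_false, and_false, not_false_eq_true, and_true,
            false_or]
          by_cases hav : a = v
          · subst hav
            by_cases hba : b = a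
            · subst hba; simp
            · have hCa : ¬ C.Adj a b := fun h => hv (hST ⟨_, h⟩)
              simp only [attach, hCa, false_or, Set.mem_insert_iff, if_true, hba, hv,
                if_false, ne_eq, true_and, false_and, or_false]
              grind [Set.MapsTo]
          · by_cases hbv : b = v
            · subst hbv
              have hCa : ¬ C.Adj a b := fun h => hv (hST ⟨_, h.symm⟩)
              simp only [attach, hCa, false_or, Set.mem_insert_iff, if_true, hav, hv,
                if_false, ne_eq, true_and, false_and, or_false]
              grind [Set.MapsTo]
            · simp only [attach, Set.mem_insert_iff, hav, hbv, false_or, false_and, or_false,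
                ne_eq]
              grind [C.ne_of_adj]
    intro h
    refine key _ C.support rfl subset_rfl (fun x hx => ?_) ?_
    · rwa [(mem_support_iff_fixed hS).1 hx]
    · convert h using 1
      have : (fun v => if v ∈ C.support then f v else v) = id := by
        ext v
        split_ifs with hv
        · exact (mem_support_iff_fixed hS).1 hv
        · rfl
      rw [this]
      ext a b
      simp only [attach, id]
      constructor
      · rintro (h | ⟨h1, h2 | h2⟩)
        · exact h
        · exact absurd h2 h1
        · exact absurd h2.symm h1
      · exact Or.inl

end Attach

end SimpleGraph

/-! ### The number of complex graphs with given parameters of the core -/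

namespace SimpleGraph

variable {V : Type*} {G : SimpleGraph V}

lemma exists_reachable_core (hG : G.IsComplex) (v : V) :
    ∃ s ∈ G.core.verts, G.Reachable v s := by
  obtain ⟨u, -, p, -, hu, -, hp, -⟩ := hG (G.connectedComponentMk v)
  exact ⟨u, (hp.toSubgraph_le_core hG).1 (p.mem_verts_toSubgraph.2 p.start_mem_support),
    (ConnectedComponent.eq.1 hu).symm⟩

/-- The function `d` is the distance to the core, and the parent is the next vertex on a shortest
walk to it. -/
lemma exists_descent (hG : G.IsComplex) : ∃ (d : V → ℕ) (f : V → V),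
    (∀ v ∈ G.core.verts, f v = v) ∧ ∀ v ∉ G.core.verts, G.Adj v (f v) ∧ d (f v) < d v := by
  classical
  have hex : ∀ v, ∃ k, ∃ s ∈ G.core.verts, ∃ p : G.Walk v s, p.length = k := by
    intro v
    obtain ⟨s, hs, ⟨p⟩⟩ := exists_reachable_core hG v
    exact ⟨_, s, hs, p, rfl⟩
  have hstep : ∀ v, ∃ w, (v ∈ G.core.verts → w = v) ∧
      (v ∉ G.core.verts → G.Adj v w ∧ Nat.find (hex w) < Nat.find (hex v)) := by
    intro v
    by_cases hv : v ∈ G.core.verts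
    · exact ⟨v, fun _ => rfl, fun h => absurd hv h⟩
    · obtain ⟨s, hs, p, hp⟩ := Nat.find_spec (hex v)
      cases p with
      | nil => exact absurd hs hv
      | @cons _ w _ h p =>
        refine ⟨w, fun h => absurd h hv, fun _ => ⟨h, ?_⟩⟩
        rw [← hp, Walk.length_cons]
        exact Nat.lt_succ_of_le (Nat.find_min' (hex w) ⟨s, hs, p, rfl⟩)
  choose f hf1 hf2 using hstep
  exact ⟨fun v => Nat.find (hex v), f, hf1, hf2⟩

/-- An edge outside the core joins a vertex to its parent. -/
lemma parent_of_not_core_adj [Finite V] (hG : G.IsComplex) {d : V → ℕ} {f : V → V}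
    (h1 : ∀ v ∈ G.core.verts, f v = v)
    (h2 : ∀ v ∉ G.core.verts, G.Adj v (f v) ∧ d (f v) < d v) {u v : V} (huv : G.Adj u v)
    (hcore : ¬ G.core.Adj u v) : f u = v ∨ f v = u := by
  by_contra! hno
  -- The core and the paths of parents from `u` and `v` together induce a graph of minimum degree
  -- two: the edge `uv` supplies the missing degree at the two ends. Maximality of the core then
  -- forces `uv` into it.
  set T : Set V := {x | x ∈ G.core.verts ∨ (∃ k, f^[k] u = x) ∨ ∃ k, f^[k] v = x} with hT
  have hfT : ∀ x ∈ T, f x ∈ T := by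
    rintro x (hx | ⟨k, rfl⟩ | ⟨k, rfl⟩)
    · rw [h1 x hx]; exact Or.inl hx
    · exact Or.inr (Or.inl ⟨k + 1, Function.iterate_succ_apply' f k u⟩)
    · exact Or.inr (Or.inr ⟨k + 1, Function.iterate_succ_apply' f k v⟩)
  have hu : u ∈ T := Or.inr (Or.inl ⟨0, rfl⟩)
  have hv : v ∈ T := Or.inr (Or.inr ⟨0, rfl⟩)
  have hmin : ∀ x ∈ T, 2 ≤ (((⊤ : G.Subgraph).induce T).neighborSet x).ncard := by
    have key : ∀ a b, a ∈ T → b ∈ T → G.Adj a b → f a ≠ b → ∀ k, f^[k] a ∉ G.core.verts →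
        ∃ y ∈ T, G.Adj (f^[k] a) y ∧ y ≠ f (f^[k] a) := by
      intro a b ha hb hab hne k
      cases k with
      | zero => exact fun _ => ⟨b, hb, hab, hne.symm⟩
      | succ k =>
        intro hx
        have hpT : f^[k] a ∈ T := by
          clear hx
          induction k with
          | zero => exact ha
          | succ k ih => rw [Function.iterate_succ_apply']; exact hfT _ ih
        rw [Function.iterate_succ_apply'] at hx ⊢
        have hp : f^[k] a ∉ G.core.verts := fun h => hx (by rwa [h1 _ h])
        refine ⟨_, hpT, (h2 _ hp).1.symm, fun h => ?_⟩
        have h3 := (h2 _ hp).2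
        have h4 := (h2 _ hx).2
        rw [← h] at h4
        omega
    have key2 : ∀ x, x ∈ T → x ∉ G.core.verts → (∃ y ∈ T, G.Adj x y ∧ y ≠ f x) →
        2 ≤ (((⊤ : G.Subgraph).induce T).neighborSet x).ncard := by
      rintro x hx hxS ⟨y, hy, hxy, hne⟩
      apply (Set.one_lt_ncard (Set.toFinite _)).2
      exact ⟨y, ⟨hx, hy, hxy⟩, f x, ⟨hx, hfT x hx, (h2 x hxS).1⟩, hne⟩
    intro x hx
    by_cases hxS : x ∈ G.core.verts
    · refine (two_le_core hxS).trans (Set.ncard_le_ncard (fun y hy => ?_) (Set.toFinite _))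
      have hy : G.core.Adj x y := hy
      exact ⟨hx, Or.inl hy.snd_mem, hy.adj_sub⟩
    · apply key2 x hx hxS
      rcases hx with hx | ⟨k, rfl⟩ | ⟨k, rfl⟩
      · exact absurd hx hxS
      · exact key u v hu hv huv hno.1 k hxS
      · exact key v u hv hu huv.symm hno.2 k hxS
  have hle : (⊤ : G.Subgraph).induce T ≤ G.core := le_core hG hmin
  exact hcore (hle.2 ⟨hu, hv, huv⟩)

lemma exists_parentMap [Finite V] (hG : G.IsComplex) : ∃ f : V → V, IsParentMap f ∧
    {x | f x = x} = G.core.spanningCoe.support ∧ G.core.spanningCoe.attach f = G := by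
  obtain ⟨d, f, h1, h2⟩ := exists_descent hG
  have hfix : ∀ x, f x = x → x ∈ G.core.verts := fun x hx => by
    by_contra h
    exact (h2 x h).1.ne hx.symm
  refine ⟨f, ?_, ?_, ?_⟩
  · have key : ∀ m x, d x = m → ∃ k, f (f^[k] x) = f^[k] x := by
      intro m
      induction m using Nat.strong_induction_on with
      | _ m ih =>
        intro x hx
        by_cases hxS : x ∈ G.core.verts
        · exact ⟨0, h1 x hxS⟩
        · obtain ⟨k, hk⟩ := ih _ (hx ▸ (h2 x hxS).2) (f x) rfl
          exact ⟨k + 1, hk⟩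
    exact fun x => key _ x rfl
  · rw [support_core]
    ext x
    exact ⟨hfix x, h1 x⟩
  · ext u v
    constructor
    · rintro (h | ⟨hne, h | h⟩)
      · exact (show G.core.Adj u v from h).adj_sub
      · have hu : u ∉ G.core.verts := fun hu => hne (by rw [← h]; exact (h1 u hu).symm)
        exact h ▸ (h2 u hu).1
      · have hv : v ∉ G.core.verts := fun hv => hne (by rw [← h]; exact (h1 v hv))
        exact h ▸ (h2 v hv).1.symm
    · intro h
      by_cases hc : G.core.Adj u v
      · exact Or.inl hc
      · exact Or.inr ⟨h.ne, parent_of_not_core_adj hG h1 h2 h hc⟩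

lemma isCoreGraph_core [Finite V] (hG : G.IsComplex) : G.core.spanningCoe.IsCoreGraph := by
  obtain ⟨f, hf, hS, hfG⟩ := exists_parentMap hG
  -- The iterate `f^[N]` sends every vertex to its root in the core and contracts the tree edges, so
  -- it carries walks of `G` to connections within the core. Thus the two cycles of a component lie
  -- in one component of its core.
  obtain ⟨N, hN⟩ := hf.exists_uniform
  have h2 : ∀ v ∈ G.core.spanningCoe.support, 2 ≤ G.core.spanningCoe.ndeg v := by
    intro v hv
    rw [support_core] at hv
    exact two_le_core hv
  have hfix : ∀ x ∈ G.core.verts, f^[N] x = x := fun x hx =>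
    Function.iterate_fixed ((mem_support_iff_fixed hS).1 (by rwa [support_core])) N
  have hadj : ∀ x y, G.Adj x y → G.core.spanningCoe.Reachable (f^[N] x) (f^[N] y) := by
    intro x y h
    have hpar : ∀ a b, f a = b → f^[N] b = f^[N] a := by
      rintro a _ rfl
      rw [← Function.iterate_succ_apply, Function.iterate_succ_apply', hN]
    rw [← hfG] at h
    rcases h with h | ⟨-, h | h⟩
    · have h' : G.core.Adj x y := h
      rw [hfix x h'.fst_mem, hfix y h'.snd_mem]
      exact h.reachable
    · rw [hpar x y h]
    · rw [hpar y x h]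
  have hreach : ∀ x y, G.Walk x y → G.core.spanningCoe.Reachable (f^[N] x) (f^[N] y) := by
    intro x y r
    induction r with
    | nil => rfl
    | cons h _ ih => exact (hadj _ _ h).trans ih
  refine ⟨h2, fun v hv => ?_⟩
  rw [support_core] at hv
  obtain ⟨a, b, p, q, ha, hb, hp, hq, hne⟩ := hG (G.connectedComponentMk v)
  have hcyc : ∀ {a : V} {p : G.Walk a a}, p.IsCycle → G.connectedComponentMk a =
      G.connectedComponentMk v → (∀ e ∈ p.edges, e ∈ G.core.spanningCoe.edgeSet) ∧
        G.core.spanningCoe.Reachable v a := by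
    intro a p hp ha
    have hle := hp.toSubgraph_le_core hG
    refine ⟨fun e he => Subgraph.edgeSet_mono hle (p.mem_edges_toSubgraph.2 he), ?_⟩
    obtain ⟨r⟩ := (ConnectedComponent.eq.1 ha).symm
    have := hreach v a r
    rwa [hfix v hv, hfix a (hle.1 (p.mem_verts_toSubgraph.2 p.start_mem_support))] at this
  obtain ⟨hpe, hva⟩ := hcyc hp ha
  obtain ⟨hqe, hvb⟩ := hcyc hq hb
  obtain ⟨w, hw, hw3⟩ := (hp.transfer hpe).exists_three_le_ndeg h2 (hq.transfer hqe)
    (hva.symm.trans hvb) (by simpa only [Walk.edges_transfer] using hne)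
  exact ⟨w, hva.trans hw, hw3⟩

lemma isCoreOf_core_of_mem {g n l : ℕ} {G : SimpleGraph (Fin n)}
    (h : G ∈ complexClass g n (n + l)) :
    IsCoreOf g l G.coreOrder G.kernelVerts.ncard G.core.spanningCoe := by
  obtain ⟨hG, hemb, hm⟩ := h
  obtain ⟨f, hf, hS, hfG⟩ := exists_parentMap hG
  have hcard := ncard_edgeSet_attach hf hS
  rw [hfG, hm, Nat.card_fin] at hcard
  have hdr : (G.core.spanningCoe.attach f).DrawableOn g := by
    rw [← embeddableOnSurface_iff (support_attach hS), hfG]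
    exact hemb
  refine ⟨isCoreGraph_core hG, (drawableOn_attach_iff hf hS).1 hdr, coreOrder_eq.symm,
    by rw [kernelVerts_eq], ?_⟩
  rw [sum_ndeg_eq, coreOrder_eq]
  omega

lemma attach_mem_complexClass {g n l s q : ℕ} {C : SimpleGraph (Fin n)} {f : Fin n → Fin n}
    (hf : IsParentMap f) (hS : {x | f x = x} = C.support) (hC : IsCoreOf g l s q C) :
    C.attach f ∈ complexClass g n (n + l) := by
  refine ⟨isComplex_attach hf hS hC.core, ?_, ?_⟩
  · rw [embeddableOnSurface_iff (support_attach hS)]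
    exact (drawableOn_attach_iff hf hS).2 hC.drawable
  · have hcard := ncard_edgeSet_attach hf hS
    have h1 := hC.sum_ndeg
    rw [sum_ndeg_eq] at h1
    rw [hC.support_ncard, Nat.card_fin] at hcard
    omega

/-- The number of complex graphs with given numbers of vertices of the core and the kernel. -/
lemma ncard_complexClass (g n l s q : ℕ) :
    {G ∈ complexClass g n (n + l) | G.coreOrder = s ∧ G.kernelVerts.ncard = q}.ncard =
      (parentMaps (Fin n) s).ncard * coreCount g l s q := by
  set R : Set ((Fin n → Fin n) × SimpleGraph (Fin n)) := {p | p.1 ∈ parentMaps (Fin n) s ∧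
    {x | p.1 x = x} = p.2.support ∧ IsCoreOf g l s q p.2} with hR
  have e : R.ncard = (parentMaps (Fin n) s).ncard * coreCount g l s q := by
    refine ncard_eq_mul_of_fiber (fun p hp => hp.1) fun f hf => ?_
    rw [← ncard_isCoreOf_of_support g l q hf.2]
    congr 1
    ext C
    exact ⟨fun h => h.2, fun h => ⟨hf, h⟩⟩
  rw [← e]
  symm
  refine Set.ncard_congr (fun p _ => p.2.attach p.1) ?_ ?_ ?_
  · rintro ⟨f, C⟩ ⟨hf, hS, hC⟩
    have hcore := core_attach hf.1 hS hC.core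
    refine ⟨attach_mem_complexClass hf.1 hS hC, ?_, ?_⟩
    · rw [coreOrder_eq, hcore]; exact hC.support_ncard
    · rw [kernelVerts_eq, hcore]; exact hC.kernel_ncard
  · rintro ⟨f, C⟩ ⟨f', C'⟩ ⟨hf, hS, hC⟩ ⟨hf', hS', hC'⟩ h
    have h : C.attach f = C'.attach f' := h
    have hcore : C = C' := (core_attach hf.1 hS hC.core).symm.trans
      ((congrArg (fun H : SimpleGraph (Fin n) => H.core.spanningCoe) h).trans
        (core_attach hf'.1 hS' hC'.core))
    subst hcore
    exact Prod.ext (parent_unique hf.1 hS hS' h) rfl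
  · rintro G ⟨hG, rfl, rfl⟩
    have hC := isCoreOf_core_of_mem hG
    obtain ⟨f, hf, hS, hfG⟩ := exists_parentMap hG.1
    exact ⟨(f, G.core.spanningCoe), ⟨⟨hf, by rw [hS]; exact hC.support_ncard⟩, hS, hC⟩, hfG⟩

end SimpleGraph

/-! ### Concentration of the number of core vertices -/

/-- The number of rooted forests on `n` vertices with `s` ordered roots. -/
noncomputable def forestWeight (n s : ℕ) : ℝ := s.factorial * (parentMaps (Fin n) s).ncard

lemma forestWeight_nonneg (n s : ℕ) : 0 ≤ forestWeight n s := by unfold forestWeight; positivity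

lemma forestWeight_succ {n s : ℕ} (hs : s ≤ n) :
    forestWeight n (s + 1) * (n * s) = forestWeight n s * ((s + 1) * (n - s)) := by
  have h : ((parentMaps (Fin n) s).ncard : ℝ) * ((n - s : ℕ) : ℝ) =
      (parentMaps (Fin n) (s + 1)).ncard * (n * s) := by
    have := ncard_parentMaps_succ (Fin n) s
    rw [Nat.card_fin] at this
    exact_mod_cast this
  rw [Nat.cast_sub hs] at h
  rw [forestWeight, forestWeight, Nat.factorial_succ]
  push_cast
  linear_combination -(s.factorial * (s + 1) : ℝ) * h

lemma forestWeight_zero {n : ℕ} (hn : 0 < n) : forestWeight n 0 = 0 := by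
  have h := forestWeight_succ (n := n) (s := 0) (Nat.zero_le _)
  have hn' : (n : ℝ) ≠ 0 := by positivity
  simpa [hn'] using h.symm

lemma forestWeight_self_pos (n : ℕ) : 0 < forestWeight n n := by
  have h : (id : Fin n → Fin n) ∈ parentMaps (Fin n) n := by
    refine ⟨fun x => ⟨0, rfl⟩, ?_⟩
    have : {x : Fin n | id x = x} = Set.univ := Set.eq_univ_of_forall fun x => rfl
    rw [this, Set.ncard_univ, Nat.card_fin]
  have : 0 < (parentMaps (Fin n) n).ncard := (Set.ncard_pos).2 ⟨_, h⟩
  unfold forestWeight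
  positivity

/-- Up to a factor that does not depend on `s`, a bound on the number of complex graphs with `s`
vertices in the core. -/
noncomputable def coreWeight (n l : ℕ) (c : ℝ) (s : ℕ) : ℝ :=
  forestWeight n s * (s + c * l) ^ (3 * l - 1)

lemma coreWeight_nonneg {n l : ℕ} {c : ℝ} (hc : 0 ≤ c) (s : ℕ) : 0 ≤ coreWeight n l c s := by
  have := forestWeight_nonneg n s
  unfold coreWeight
  positivity

/-- The forest factor changes by `(1 + 1/s) * (1 - s/n)` and each of the `3 * l - 1` linear factors
by at most `1 + 1/s`; now `1 + x ≤ exp x`. The exponent changes sign at `s² = 3nl`, where the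
typical core order comes from. -/
lemma coreWeight_succ_le {n l s : ℕ} {c : ℝ} (hl : 1 ≤ l) (hc : 0 ≤ c) (hs : 1 ≤ s)
    (hsn : s ≤ n) :
    coreWeight n l c (s + 1) ≤ coreWeight n l c s * Real.exp (3 * l / s - s / n) := by
  have hs0 : (0 : ℝ) < s := by exact_mod_cast hs
  have hn0 : (0 : ℝ) < n := hs0.trans_le (by exact_mod_cast hsn)
  have hA := forestWeight_nonneg n s
  have h1 : forestWeight n (s + 1) ≤ forestWeight n s * (Real.exp (1 / s) * Real.exp (-(s / n))) := by
    have h : forestWeight n (s + 1) = forestWeight n s * ((1 / s + 1) * (-(s / n) + 1)) := by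
      have := forestWeight_succ hsn
      field_simp
      linear_combination this
    rw [h]
    have h2 : (s : ℝ) / n ≤ 1 := (div_le_one hn0).2 (by exact_mod_cast hsn)
    gcongr
    · linarith
    · exact Real.add_one_le_exp _
    · exact Real.add_one_le_exp _
  have h2 : ((s + 1 : ℕ) + c * l : ℝ) ≤ (s + c * l) * Real.exp (1 / s) := by
    have h3 : (0 : ℝ) ≤ c * l := by positivity
    have h4 : (s + c * l) * (1 / s + 1) ≤ (s + c * l) * Real.exp (1 / s) := by
      gcongr
      exact Real.add_one_le_exp _
    refine le_trans ?_ h4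
    have h5 : (s + c * l) * (1 / s + 1) = s + c * l + (1 + c * l / s) := by field_simp; ring
    rw [h5]
    push_cast
    have : (0 : ℝ) ≤ c * l / s := by positivity
    linarith
  have hexp : Real.exp (3 * l / s - s / n) =
      Real.exp (1 / s) * Real.exp (-(s / n)) * Real.exp (1 / s) ^ (3 * l - 1) := by
    rw [← Real.exp_nat_mul, ← Real.exp_add, ← Real.exp_add]
    congr 1
    rw [Nat.cast_sub (by omega)]
    push_cast
    field_simp
    ring
  rw [coreWeight, coreWeight, hexp]
  calc forestWeight n (s + 1) * ((s + 1 : ℕ) + c * l : ℝ) ^ (3 * l - 1)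
      ≤ (forestWeight n s * (Real.exp (1 / s) * Real.exp (-(s / n)))) *
          ((s + c * l) * Real.exp (1 / s)) ^ (3 * l - 1) := by gcongr
    _ = _ := by rw [mul_pow]; ring

/-- The growth below the peak needs lower bounds: `1 - z` is at least `exp (-(z / (1 - z)))`, and a
linear factor gains at least `exp (1 / (s + c * l + 1))`. -/
lemma coreWeight_le_succ {n l s : ℕ} {a c S : ℝ} (ha : 0 < a) (ha1 : a ≤ 1) (hc : 0 ≤ c)
    (hl : 1 / a ≤ l) (hS0 : 0 < S) (hS : S ^ 2 = 3 * n * l) (hSn : S ≤ a / (2 * (c + 1)) * n)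
    (hs : s ≤ (1 - a) * S) :
    coreWeight n l c s ≤ coreWeight n l c (s + 1) * Real.exp (-(a / 2 * (S / n))) := by
  have hl1 : (1 : ℝ) ≤ l := le_trans ((one_le_div ha).2 ha1) hl
  have hl1' : 1 ≤ l := by exact_mod_cast hl1
  have hn0 : (0 : ℝ) < n := by
    by_contra h
    have : (n : ℝ) = 0 := le_antisymm (not_lt.1 h) (Nat.cast_nonneg n)
    rw [this, mul_zero] at hSn
    linarith
  have hal : 1 ≤ a * l := by rwa [div_le_iff₀' ha] at hl
  have hc1 : (0 : ℝ) < 2 * (c + 1) := by positivity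
  have hSn1 : S * (2 * (c + 1)) ≤ a * n := by
    rw [div_mul_eq_mul_div, le_div_iff₀ hc1] at hSn; exact hSn
  have hSn2 : S ≤ a / 2 * n := by nlinarith
  rcases Nat.eq_zero_or_pos s with rfl | hs1
  · rw [coreWeight, forestWeight_zero (by exact_mod_cast hn0), zero_mul]
    have := coreWeight_nonneg (n := n) (l := l) hc 1
    positivity
  have hs0 : (0 : ℝ) < s := by exact_mod_cast hs1
  have hsn : (s : ℝ) < n := by nlinarith
  have hsn' : s ≤ n := by exact_mod_cast hsn.le
  have hA := forestWeight_nonneg n s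
  set z : ℝ := s / n with hz
  have hz0 : 0 ≤ z := by positivity
  have hz1 : z < 1 := (div_lt_one hn0).2 hsn
  have h1 : forestWeight n s * Real.exp (-(z / (1 - z))) ≤ forestWeight n (s + 1) := by
    have h : forestWeight n (s + 1) = forestWeight n s * ((1 / s + 1) * (1 - z)) := by
      have := forestWeight_succ hsn'
      rw [hz]
      field_simp
      linear_combination this
    rw [h]
    have hz' : 0 < 1 - z := by linarith
    have h2 : Real.exp (-(z / (1 - z))) ≤ 1 - z := by
      rw [Real.exp_neg, inv_le_comm₀ (Real.exp_pos _) hz']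
      refine le_trans (le_of_eq ?_) (Real.add_one_le_exp _)
      field_simp
      ring
    have h3 : (0 : ℝ) < 1 / s := by positivity
    have h4 : 1 - z ≤ (1 / s + 1) * (1 - z) := by nlinarith
    gcongr
    exact h2.trans h4
  have hx : (0 : ℝ) < s + c * l := by positivity
  have h2 : (s + c * l) * Real.exp (1 / (s + c * l + 1)) ≤ ((s + 1 : ℕ) + c * l : ℝ) := by
    have h3 := Real.add_one_le_exp (-(1 / (s + c * l + 1)))
    rw [Real.exp_neg] at h3
    have h4 : -(1 / (s + c * l + 1)) + 1 = (s + c * l) / (s + c * l + 1) := by field_simp; ring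
    rw [h4, div_le_iff₀ (by positivity), inv_mul_eq_div, le_div_iff₀ (Real.exp_pos _)] at h3
    push_cast
    linarith
  -- As `S² = 3nl` and `s ≤ (1 - a) S`, the power gains at least `S/n` in the exponent while the
  -- forests lose at most `(1 - a/2) S/n`. The bound on `S` absorbs the terms with `c` and `z²`.
  have hexp : z / (1 - z) + a / 2 * (S / n) ≤ ((3 * l - 1 : ℕ) : ℝ) * (1 / (s + c * l + 1)) := by
    have e1 : S / n ≤ ((3 * l - 1 : ℕ) : ℝ) * (1 / (s + c * l + 1)) := by
      rw [Nat.cast_sub (by omega), mul_one_div, div_le_div_iff₀ hn0 (by positivity)]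
      push_cast
      have e2 : S * (s + c * l + 1) ≤ S * ((1 - a) * S + c * l + 1) := by gcongr
      have e3 : S * (c * l + 1) ≤ a / 2 * n * l := by
        have : S * (c * l + 1) ≤ S * ((c + 1) * l) := by gcongr; nlinarith
        nlinarith
      nlinarith
    have e2 : z / (1 - z) ≤ (1 - a / 2) * (S / n) := by
      have hzS : z ≤ (1 - a) * (S / n) := by
        rw [hz, mul_div_assoc']
        gcongr
      have hzz : S / n ≤ a / 2 := (div_le_iff₀ hn0).2 hSn2
      have hSn0 : 0 < S / n := by positivity
      rw [div_le_iff₀ (by linarith)]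
      have : (1 - a) * (S / n) ≤ (1 - a / 2) * (S / n) * (1 - a / 2) := by nlinarith [sq_nonneg a]
      refine hzS.trans (this.trans ?_)
      have h5 : z ≤ a / 2 := by nlinarith
      gcongr
      linarith
    linarith
  have hA' := forestWeight_nonneg n (s + 1)
  rw [coreWeight, coreWeight]
  have hk : Real.exp (z / (1 - z) + a / 2 * (S / n)) ≤
      Real.exp (1 / (s + c * l + 1)) ^ (3 * l - 1) := by
    rw [← Real.exp_nat_mul]
    exact Real.exp_le_exp.2 hexp
  have hone : 1 ≤ Real.exp (-(z / (1 - z))) *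
      Real.exp (1 / (s + c * l + 1)) ^ (3 * l - 1) * Real.exp (-(a / 2 * (S / n))) := by
    calc (1 : ℝ) = Real.exp (-(z / (1 - z))) * Real.exp (z / (1 - z) + a / 2 * (S / n)) *
          Real.exp (-(a / 2 * (S / n))) := by
          rw [← Real.exp_add, ← Real.exp_add]; simp
      _ ≤ _ := by gcongr
  calc forestWeight n s * (s + c * l) ^ (3 * l - 1)
      ≤ forestWeight n s * (s + c * l) ^ (3 * l - 1) * (Real.exp (-(z / (1 - z))) *
      Real.exp (1 / (s + c * l + 1)) ^ (3 * l - 1) * Real.exp (-(a / 2 * (S / n)))) :=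
        le_mul_of_one_le_right (by positivity) hone
    _ = forestWeight n s * Real.exp (-(z / (1 - z))) *
        ((s + c * l) * Real.exp (1 / (s + c * l + 1))) ^ (3 * l - 1) *
          Real.exp (-(a / 2 * (S / n))) := by rw [mul_pow]; ring
    _ ≤ _ := by gcongr

lemma le_mul_pow_of_succ_le {f : ℕ → ℝ} {r : ℝ} (hr : 0 ≤ r) {t w : ℕ}
    (h : ∀ j < w, f (t + j + 1) ≤ f (t + j) * r) : f (t + w) ≤ f t * r ^ w := by
  induction w with
  | zero => simp
  | succ w ih =>
    rw [← add_assoc, pow_succ, ← mul_assoc]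
    exact (h w (Nat.lt_succ_self _)).trans
      (mul_le_mul_of_nonneg_right (ih fun j hj => h j (hj.trans (Nat.lt_succ_self _))) hr)

lemma le_mul_pow_of_le_succ {f : ℕ → ℝ} {r : ℝ} (hr : 0 ≤ r) {t w : ℕ}
    (h : ∀ j < w, f (t + j) ≤ f (t + j + 1) * r) : f t ≤ f (t + w) * r ^ w := by
  induction w with
  | zero => simp
  | succ w ih =>
    refine (ih fun j hj => h j (hj.trans (Nat.lt_succ_self _))).trans ?_
    rw [pow_succ', ← mul_assoc]
    exact mul_le_mul_of_nonneg_right (h w (Nat.lt_succ_self _)) (pow_nonneg hr _)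

lemma sum_le_of_shift {f : ℕ → ℝ} (hf : ∀ s, 0 ≤ f s) {F F' : Finset ℕ} {e : ℕ → ℕ} {r : ℝ}
    (hr : 0 ≤ r) (he : Set.InjOn e F) (hF : ∀ s ∈ F, e s ∈ F') (h : ∀ s ∈ F, f s ≤ f (e s) * r) :
    ∑ s ∈ F, f s ≤ r * ∑ s ∈ F', f s := by
  classical
  calc ∑ s ∈ F, f s ≤ ∑ s ∈ F, f (e s) * r := Finset.sum_le_sum h
    _ = r * ∑ s ∈ F.image e, f s := by
        rw [Finset.sum_image he, Finset.mul_sum]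
        exact Finset.sum_congr rfl fun s _ => mul_comm _ _
    _ ≤ _ := by
        gcongr
        · exact fun s _ _ => hf s
        · exact Finset.image_subset_iff.2 hF

/-- Large deviations of the number of core vertices are exponentially unlikely. -/
lemma sum_coreWeight_tail {n l : ℕ} {δ c S : ℝ} (hδ : 0 < δ) (hδ1 : δ ≤ 1) (hc : 0 ≤ c)
    (hl : 8 / δ ^ 2 ≤ l) (hS0 : 0 < S) (hS : S ^ 2 = 3 * n * l)
    (hSn : S ≤ δ / (4 * (c + 1)) * n) :
    ∑ s ∈ Finset.range (n + 1) with ¬ |((s : ℕ) : ℝ) - S| ≤ δ * S, coreWeight n l c s ≤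
      2 * Real.exp (-(δ ^ 2 / 8 * l)) * ∑ s ∈ Finset.range (n + 1), coreWeight n l c s := by
  have hδl : 8 ≤ δ ^ 2 * l := by rwa [div_le_iff₀' (by positivity)] at hl
  have hδ2 : δ ^ 2 ≤ 1 := by nlinarith
  have hl8 : (8 : ℝ) ≤ l := by nlinarith
  have hl1 : 1 ≤ l := by
    have : (1 : ℝ) ≤ l := by linarith
    exact_mod_cast this
  have hn0 : (0 : ℝ) < n := by
    by_contra h
    have : (n : ℝ) = 0 := le_antisymm (not_lt.1 h) (Nat.cast_nonneg n)
    rw [this, mul_zero] at hSn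
    linarith
  have hSn' : S ≤ n := by
    have h1 : δ / (4 * (c + 1)) ≤ 1 := (div_le_one (by positivity)).2 (by linarith)
    nlinarith
  -- Shifting a tail by `w` towards `S` keeps it at distance at least `δ S / 2`, where each step
  -- gains `exp (-(δ/4) * (S/n))`. By `S * (S/n) = 3l` the total gain is about `exp (-(3/8) δ² l)`;
  -- rounding `w` down uses up part of it.
  set w := ⌊δ / 2 * S⌋₊ with hw
  have hw1 : (w : ℝ) ≤ δ / 2 * S := Nat.floor_le (by positivity)
  have hw2 : δ / 2 * S < w + 1 := Nat.lt_floor_add_one _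
  have hSS : S * (S / n) = 3 * l := by
    rw [mul_div_assoc', ← sq, hS]; field_simp
  have hSn1 : S / n ≤ 1 := (div_le_one hn0).2 hSn'
  have hSn0 : 0 < S / n := by positivity
  set r := Real.exp (-(δ / 2 / 2 * (S / n))) with hr
  have hr0 : 0 ≤ r := (Real.exp_pos _).le
  have hrw : r ^ w ≤ Real.exp (-(δ ^ 2 / 8 * l)) := by
    rw [hr, ← Real.exp_nat_mul]
    apply Real.exp_le_exp.2
    have h1 : (δ / 2 * S - 1) * (δ / 4 * (S / n)) ≤ w * (δ / 4 * (S / n)) := by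
      gcongr; linarith
    have h2 : (δ / 2 * S - 1) * (δ / 4 * (S / n)) = 3 / 8 * δ ^ 2 * l - δ / 4 * (S / n) := by
      linear_combination (δ ^ 2 / 8) * hSS
    have h3 : δ / 4 * (S / n) ≤ 1 := by nlinarith
    nlinarith
  have hf := fun s => coreWeight_nonneg (n := n) (l := l) hc s
  set E := Real.exp (-(δ ^ 2 / 8 * l)) with hE
  have hE0 : 0 ≤ E := (Real.exp_pos _).le
  have hup : ∑ s ∈ Finset.range (n + 1) with (1 + δ) * S < ((s : ℕ) : ℝ), coreWeight n l c s ≤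
      E * ∑ s ∈ Finset.range (n + 1), coreWeight n l c s := by
    have hle : ∀ s ∈ Finset.filter (fun s : ℕ => (1 + δ) * S < s) (Finset.range (n + 1)),
        s ≤ n ∧ w ≤ s ∧ (1 + δ / 2) * S ≤ (s - w : ℕ) := by
      intro s hs
      rw [Finset.mem_filter, Finset.mem_range] at hs
      have h1 : (w : ℝ) ≤ s := by nlinarith
      have h1' : w ≤ s := by exact_mod_cast h1
      refine ⟨by omega, h1', ?_⟩
      rw [Nat.cast_sub h1']
      linarith [hs.2]
    refine sum_le_of_shift (e := fun s => s - w) hf hE0 ?_ ?_ ?_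
    · intro s hs t ht hst
      have h1 := (hle s hs).2.1
      have h2 := (hle t ht).2.1
      simp only at hst
      omega
    · intro s hs
      rw [Finset.mem_range]
      have := (hle s hs).1
      omega
    · intro s hs
      obtain ⟨h1, h2, h3⟩ := hle s hs
      have h4 : coreWeight n l c (s - w + w) ≤ coreWeight n l c (s - w) * r ^ w := by
        refine le_mul_pow_of_succ_le hr0 fun j hj => ?_
        have h5 : (1 + δ / 2) * S ≤ (s - w + j : ℕ) := by
          push_cast
          have : (0 : ℝ) ≤ j := Nat.cast_nonneg j
          linarith
        set u := s - w + j with hu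
        have hu0 : (0 : ℝ) < u := lt_of_lt_of_le (by positivity) h5
        have hu1 : 1 ≤ u := by exact_mod_cast hu0
        refine (coreWeight_succ_le hl1 hc hu1 (by omega)).trans ?_
        gcongr
        · exact hf u
        · have h6 : 3 * l / (u : ℝ) ≤ S / n := by
            rw [div_le_div_iff₀ hu0 hn0]
            have : S ≤ u := by nlinarith
            nlinarith
          have h7 : (1 + δ / 2) * (S / n) ≤ u / n := by
            rw [mul_div_assoc']
            gcongr
          rw [hr]
          apply Real.exp_le_exp.2
          nlinarith
      rw [Nat.sub_add_cancel h2] at h4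
      exact h4.trans (mul_le_mul_of_nonneg_left hrw (hf _))
  have hlow : ∑ s ∈ Finset.range (n + 1) with ((s : ℕ) : ℝ) < (1 - δ) * S, coreWeight n l c s ≤
      E * ∑ s ∈ Finset.range (n + 1), coreWeight n l c s := by
    refine sum_le_of_shift (e := fun s => s + w) hf hE0 ?_ ?_ ?_
    · intro s _ t _ hst
      simpa using hst
    · intro s hs
      rw [Finset.mem_filter] at hs
      have h1 : ((s + w : ℕ) : ℝ) ≤ n := by push_cast; nlinarith [hs.2]
      rw [Finset.mem_range]
      have : s + w ≤ n := by exact_mod_cast h1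
      omega
    · intro s hs
      rw [Finset.mem_filter] at hs
      have h4 : coreWeight n l c s ≤ coreWeight n l c (s + w) * r ^ w := by
        refine le_mul_pow_of_le_succ hr0 fun j hj => ?_
        have hj' : (j : ℝ) ≤ w := by exact_mod_cast hj.le
        have hδ2 : 1 / (δ / 2) ≤ (l : ℝ) := by
          rw [one_div_div, div_le_iff₀ hδ]; nlinarith
        refine coreWeight_le_succ (by positivity) (by linarith) hc hδ2 hS0 hS ?_ ?_
        · refine hSn.trans_eq ?_
          congr 1
          field_simp
          ring
        · push_cast
          linarith [hs.2]
      exact h4.trans (mul_le_mul_of_nonneg_left hrw (hf _))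
  calc _ ≤ ∑ s ∈ Finset.range (n + 1) with (1 + δ) * S < ((s : ℕ) : ℝ), coreWeight n l c s +
        ∑ s ∈ Finset.range (n + 1) with ((s : ℕ) : ℝ) < (1 - δ) * S, coreWeight n l c s := by
        classical
        rw [← Finset.sum_union_inter]
        refine le_trans ?_ (le_add_of_nonneg_right (Finset.sum_nonneg fun s _ => hf s))
        refine Finset.sum_le_sum_of_subset_of_nonneg ?_ fun s _ _ => hf s
        intro s hs
        rw [Finset.mem_filter, abs_le, not_and_or, not_le, not_le] at hs
        rw [Finset.mem_union, Finset.mem_filter, Finset.mem_filter]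
        rcases hs.2 with h | h
        · exact Or.inr ⟨hs.1, by linarith⟩
        · exact Or.inl ⟨hs.1, by linarith⟩
    _ ≤ _ := by linarith

/-- In the range of typical core sizes, the upper and lower bounds on the number of cores are
comparable. -/
lemma coreWeight_le_of_abs_sub_le {n l s : ℕ} {c S : ℝ} (hc : 0 ≤ c) (hlS : 32 * l ≤ S)
    (hS0 : 0 < S) (hs : |(s : ℝ) - S| ≤ 1 / 2 * S) :
    8 * l ≤ s ∧ coreWeight n l c s ≤ Real.exp (12 * (c + 8) * (l ^ 2 / S)) *
      (forestWeight n s * (s - 8 * l : ℝ) ^ (3 * l - 1)) := by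
  rw [abs_le] at hs
  have h1 : S / 4 ≤ (s : ℝ) - 8 * l := by linarith
  have h2 : 8 * (l : ℝ) ≤ s := by linarith
  refine ⟨by exact_mod_cast h2, ?_⟩
  have hA := forestWeight_nonneg n s
  have h3 : (s + c * l : ℝ) ≤ (s - 8 * l) * Real.exp (4 * (c + 8) * (l / S)) := by
    have h4 := Real.add_one_le_exp (4 * (c + 8) * (l / S))
    have h5 : (s + c * l : ℝ) ≤ (s - 8 * l) * (4 * (c + 8) * (l / S) + 1) := by
      have h6 : S / 4 * (4 * (c + 8) * (l / S)) ≤ (s - 8 * l) * (4 * (c + 8) * (l / S)) := by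
        gcongr
      have h7 : S / 4 * (4 * (c + 8) * (l / S)) = (c + 8) * l := by field_simp
      linarith
    exact h5.trans (mul_le_mul_of_nonneg_left h4 (by linarith))
  have h4 : Real.exp (4 * (c + 8) * (l / S)) ^ (3 * l - 1) ≤
      Real.exp (12 * (c + 8) * (l ^ 2 / S)) := by
    rw [← Real.exp_nat_mul]
    apply Real.exp_le_exp.2
    have h5 : ((3 * l - 1 : ℕ) : ℝ) ≤ 3 * l := by exact_mod_cast Nat.sub_le _ _
    calc ((3 * l - 1 : ℕ) : ℝ) * (4 * (c + 8) * (l / S)) ≤ 3 * l * (4 * (c + 8) * (l / S)) := by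
          gcongr
      _ = _ := by ring
  rw [coreWeight]
  calc forestWeight n s * (s + c * l) ^ (3 * l - 1)
      ≤ forestWeight n s * ((s - 8 * l) * Real.exp (4 * (c + 8) * (l / S))) ^ (3 * l - 1) := by
        gcongr
    _ = Real.exp (4 * (c + 8) * (l / S)) ^ (3 * l - 1) *
        (forestWeight n s * (s - 8 * l : ℝ) ^ (3 * l - 1)) := by rw [mul_pow]; ring
    _ ≤ _ := by
        gcongr

/-- At least half of the weight lies within `S / 2` of `S`, and there the two powers are comparable.
-/
lemma sum_coreWeight_le {n l : ℕ} {c S : ℝ} (hc : 0 ≤ c) (hl : 64 ≤ l) (hS0 : 0 < S)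
    (hS : S ^ 2 = 3 * n * l) (hSn : S ≤ 1 / (32 * (c + 1)) * n) :
    ∑ s ∈ Finset.range (n + 1), coreWeight n l c s ≤
      2 * Real.exp (12 * (c + 8) * (l ^ 2 / S)) *
        ∑ s ∈ Finset.range (n + 1) with 8 * l ≤ s,
          forestWeight n s * (s - 8 * l : ℝ) ^ (3 * l - 1) := by
  have hl' : (64 : ℝ) ≤ l := by exact_mod_cast hl
  have hc1 : (0 : ℝ) < 32 * (c + 1) := by positivity
  have hSn1 : S * (32 * (c + 1)) ≤ n := by
    rw [div_mul_eq_mul_div, one_mul, le_div_iff₀ hc1] at hSn; exact hSn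
  have hSn32 : S * 32 ≤ n := by nlinarith
  have hlS : 32 * l ≤ S := by
    have h1 : S * (32 * l) ≤ S * S := by nlinarith
    exact le_of_mul_le_mul_left h1 hS0
  have htail := sum_coreWeight_tail (n := n) (l := l) (δ := 1 / 2) (c := c) (S := S) (by norm_num)
    (by norm_num) hc (by norm_num; linarith) hS0 hS (by
      rw [div_mul_eq_mul_div, le_div_iff₀ (by positivity)]
      have : (0 : ℝ) ≤ n := Nat.cast_nonneg n
      nlinarith)
  -- For `l ≥ 64` the exponent is at most `-2`, so the tail carries at most `2 * (1/4)` of the total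
  -- weight.
  have hexp : Real.exp (-((1 / 2) ^ 2 / 8 * l)) ≤ 4⁻¹ := by
    rw [Real.exp_neg]
    apply inv_anti₀ (by norm_num)
    have h2 : (2 : ℝ) + 1 ≤ Real.exp 2 := Real.add_one_le_exp 2
    have h1 : Real.exp 2 ≤ Real.exp ((1 / 2) ^ 2 / 8 * l) := Real.exp_le_exp.2 (by linarith)
    have h3 : Real.exp 2 = Real.exp 1 * Real.exp 1 := by rw [← Real.exp_add]; norm_num
    have h4 : (1 : ℝ) + 1 ≤ Real.exp 1 := Real.add_one_le_exp 1
    nlinarith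
  have hf := fun s => coreWeight_nonneg (n := n) (l := l) hc s
  have hU : 0 ≤ ∑ s ∈ Finset.range (n + 1), coreWeight n l c s := Finset.sum_nonneg fun s _ => hf s
  have hsplit := Finset.sum_filter_add_sum_filter_not (Finset.range (n + 1))
    (fun s : ℕ => |(s : ℝ) - S| ≤ 1 / 2 * S) (coreWeight n l c)
  have hwin : ∑ s ∈ Finset.range (n + 1) with |((s : ℕ) : ℝ) - S| ≤ 1 / 2 * S, coreWeight n l c s ≤
      Real.exp (12 * (c + 8) * (l ^ 2 / S)) * ∑ s ∈ Finset.range (n + 1) with 8 * l ≤ s,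
          forestWeight n s * (s - 8 * l : ℝ) ^ (3 * l - 1) := by
    rw [Finset.mul_sum]
    have hpos : ∀ s : ℕ, 8 * l ≤ s → 0 ≤ Real.exp (12 * (c + 8) * (l ^ 2 / S)) *
        (forestWeight n s * (s - 8 * l : ℝ) ^ (3 * l - 1)) := by
      intro s hs
      have h1 := forestWeight_nonneg n s
      have h2 : (0 : ℝ) ≤ s - 8 * l := by
        have : ((8 * l : ℕ) : ℝ) ≤ s := Nat.cast_le.2 hs
        push_cast at this
        linarith
      positivity
    refine (Finset.sum_le_sum fun s hs => (coreWeight_le_of_abs_sub_le hc hlS hS0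
      (Finset.mem_filter.1 hs).2).2).trans ?_
    refine Finset.sum_le_sum_of_subset_of_nonneg ?_ fun s hs _ =>
      hpos s (Finset.mem_filter.1 hs).2
    intro s hs
    rw [Finset.mem_filter] at hs ⊢
    exact ⟨hs.1, (coreWeight_le_of_abs_sub_le (n := n) hc hlS hS0 hs.2).1⟩
  nlinarith

/-! ### Moments of the deficiency of random complex graphs -/

namespace SimpleGraph

lemma kernel_le_of_mem {g n l : ℕ} {G : SimpleGraph (Fin n)}
    (h : G ∈ complexClass g n (n + l)) : G.kernelVerts.ncard ≤ 2 * l :=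
  (isCoreOf_core_of_mem h).kernel_le

lemma deficiency_eq_of_mem {g n l : ℕ} {G : SimpleGraph (Fin n)}
    (h : G ∈ complexClass g n (n + l)) :
    G.deficiency = ((2 * l - G.kernelVerts.ncard : ℕ) : ℤ) := by
  rw [deficiency_eq (isCoreOf_core_of_mem h), Nat.cast_sub (kernel_le_of_mem h)]
  push_cast
  rfl

lemma coreOrder_le {n : ℕ} (G : SimpleGraph (Fin n)) : G.coreOrder ≤ n := by
  have := Set.ncard_le_card G.core.verts
  rwa [Nat.card_fin] at this

/-- Sums over complex graphs of functions of the numbers of core and kernel vertices. -/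
lemma sum_complexClass {g n l : ℕ} (h : ℕ → ℕ → ℝ) :
    ∑ G ∈ (complexClass g n (n + l)).toFinite.toFinset,
        h G.coreOrder (2 * l - G.kernelVerts.ncard) =
      ∑ s ∈ Finset.range (n + 1), ∑ d ∈ Finset.range (2 * l + 1),
        h s d * ((parentMaps (Fin n) s).ncard * coreCount g l s (2 * l - d)) := by
  classical
  rw [← Finset.sum_product',
    ← Finset.sum_fiberwise_of_maps_to (t := Finset.range (n + 1) ×ˢ Finset.range (2 * l + 1))
      (g := fun G => (G.coreOrder, 2 * l - G.kernelVerts.ncard))]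
  · refine Finset.sum_congr rfl fun p hp => ?_
    obtain ⟨s, d⟩ := p
    rw [Finset.mem_product, Finset.mem_range, Finset.mem_range] at hp
    have hd : d ≤ 2 * l := Nat.lt_succ_iff.1 hp.2
    have hcard := ncard_complexClass g n l s (2 * l - d)
    have hset : {G ∈ complexClass g n (n + l) | G.coreOrder = s ∧
        G.kernelVerts.ncard = 2 * l - d} = (((complexClass g n (n + l)).toFinite.toFinset.filter
          (fun G => (G.coreOrder, 2 * l - G.kernelVerts.ncard) = (s, d)) :
            Finset (SimpleGraph (Fin n))) : Set (SimpleGraph (Fin n))) := by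
      ext G
      rw [Finset.coe_filter]
      simp only [Set.Finite.mem_toFinset, Set.mem_ofPred_eq, Prod.mk.injEq]
      refine and_congr_right fun hG => and_congr_right fun _ => ?_
      have := kernel_le_of_mem hG
      omega
    rw [hset, Set.ncard_coe_finset] at hcard
    rw [Finset.sum_congr rfl (g := fun _ => h s d)]
    · rw [Finset.sum_const, nsmul_eq_mul, hcard, mul_comm]
      push_cast
      rfl
    · intro G hG
      obtain ⟨h1, h2⟩ := Prod.mk.inj (Finset.mem_filter.1 hG).2
      rw [h1, h2]
  · intro G hG
    rw [Finset.mem_product, Finset.mem_range, Finset.mem_range]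
    exact ⟨Nat.lt_succ_of_le (coreOrder_le G), by simp only; omega⟩

lemma sum_complexClass_le {g n l : ℕ} (hl : 1 ≤ l) {h : ℕ → ℝ} (hh : ∀ s, 0 ≤ h s) {y : ℝ}
    (hy : 0 ≤ y) :
    ∑ G ∈ (complexClass g n (n + l)).toFinite.toFinset,
        h G.coreOrder * y ^ (2 * l - G.kernelVerts.ncard) ≤
      fatWeight g l (2 * l) / (3 * l - 1).factorial *
        ∑ s ∈ Finset.range (n + 1), h s * coreWeight n l (1 + 18 * y) s := by
  rw [sum_complexClass (fun s d => h s * y ^ d), Finset.mul_sum]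
  refine Finset.sum_le_sum fun s _ => ?_
  have hs := hh s
  calc ∑ d ∈ Finset.range (2 * l + 1), h s * y ^ d *
        ((parentMaps (Fin n) s).ncard * coreCount g l s (2 * l - d))
      = h s * (parentMaps (Fin n) s).ncard *
        ∑ d ∈ Finset.range (2 * l + 1), y ^ d * (coreCount g l s (2 * l - d) : ℝ) := by
        rw [Finset.mul_sum]
        exact Finset.sum_congr rfl fun d _ => by ring
    _ ≤ h s * (parentMaps (Fin n) s).ncard * (s.factorial * (fatWeight g l (2 * l) *
        ((s + l + 18 * l * y : ℝ) ^ (3 * l - 1) / (3 * l - 1).factorial))) := by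
        gcongr
        exact sum_coreCount_le g l s hl y hy
    _ = _ := by
        rw [coreWeight, forestWeight,
          show (s + (1 + 18 * y) * l : ℝ) = s + l + 18 * l * y by ring]
        ring

/-- Only the graphs of deficiency zero, the summand `d = 0`, are counted. -/
lemma le_ncard_complexClass {g n l : ℕ} (hl : 1 ≤ l) :
    fatWeight g l (2 * l) / (3 * l - 1).factorial *
        ∑ s ∈ Finset.range (n + 1) with 8 * l ≤ s,
          forestWeight n s * (s - 8 * l : ℝ) ^ (3 * l - 1) ≤
      ((complexClass g n (n + l)).ncard : ℝ) := by
  have h1 : ((complexClass g n (n + l)).ncard : ℝ) = ∑ s ∈ Finset.range (n + 1),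
      ∑ d ∈ Finset.range (2 * l + 1),
        ((parentMaps (Fin n) s).ncard * coreCount g l s (2 * l - d) : ℝ) := by
    have := sum_complexClass (g := g) (n := n) (l := l) (fun _ _ => 1)
    simp only [one_mul] at this
    rw [← this, Finset.sum_const, nsmul_eq_mul, mul_one, Set.ncard_eq_toFinset_card]
  rw [h1, Finset.mul_sum]
  refine le_trans ?_ (Finset.sum_le_sum_of_subset_of_nonneg
    (Finset.filter_subset (fun s => 8 * l ≤ s) _)
    fun s _ _ => Finset.sum_nonneg fun d _ => by positivity)
  refine Finset.sum_le_sum fun s hs => ?_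
  refine le_trans ?_ (Finset.single_le_sum (f := fun d =>
    ((parentMaps (Fin n) s).ncard * coreCount g l s (2 * l - d) : ℝ))
    (fun d _ => by positivity) (Finset.mem_range.2 (Nat.succ_pos _)))
  rw [Nat.sub_zero]
  have h2 := le_coreCount g l s hl (Finset.mem_filter.1 hs).2
  refine le_trans (le_of_eq ?_) (mul_le_mul_of_nonneg_left h2 (Nat.cast_nonneg _))
  rw [forestWeight]
  ring

/-! ### Exponential moment of the deficiency and tail of the core order. -/

section Bounds

variable {g n l : ℕ} {S : ℝ} (hl : 64 ≤ l) (hS0 : 0 < S) (hS : S ^ 2 = 3 * n * l)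
include hl hS0 hS

/-- Upper and lower bounds share the unknown factor `fatWeight g l (2 * l) / (3 * l - 1)!`, so the
weights can be compared with the size of the class itself. -/
lemma sum_coreWeight_le_ncard {y : ℝ} (hy : 0 ≤ y) (hSn : S ≤ 1 / (32 * (2 + 18 * y)) * n) :
    fatWeight g l (2 * l) / (3 * l - 1).factorial *
        ∑ s ∈ Finset.range (n + 1), coreWeight n l (1 + 18 * y) s ≤
      2 * Real.exp (12 * (9 + 18 * y) * (l ^ 2 / S)) *
        ((complexClass g n (n + l)).ncard : ℝ) := by
  have h1 := sum_coreWeight_le (n := n) (l := l) (c := 1 + 18 * y) (by positivity) hl hS0 hS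
    (hSn.trans_eq (by ring_nf))
  have h2 := le_ncard_complexClass (g := g) (n := n) (l := l) (by omega)
  have h3 := fatWeight_nonneg g l (2 * l)
  rw [show 1 + 18 * y + 8 = 9 + 18 * y by ring] at h1
  calc _ ≤ fatWeight g l (2 * l) / (3 * l - 1).factorial *
        (2 * Real.exp (12 * (9 + 18 * y) * (l ^ 2 / S)) *
        ∑ s ∈ Finset.range (n + 1) with 8 * l ≤ s,
          forestWeight n s * (s - 8 * l : ℝ) ^ (3 * l - 1)) := by gcongr
    _ = 2 * Real.exp (12 * (9 + 18 * y) * (l ^ 2 / S)) *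
        (fatWeight g l (2 * l) / (3 * l - 1).factorial *
        ∑ s ∈ Finset.range (n + 1) with 8 * l ≤ s,
          forestWeight n s * (s - 8 * l : ℝ) ^ (3 * l - 1)) := by ring
    _ ≤ _ := by gcongr

lemma ncard_complexClass_pos (hSn : S ≤ 1 / 64 * n) :
    (0 : ℝ) < (complexClass g n (n + l)).ncard := by
  have h1 := sum_coreWeight_le_ncard (g := g) hl hS0 hS (le_refl 0)
    (hSn.trans_eq (by norm_num))
  have h2 : 0 < fatWeight g l (2 * l) / (3 * l - 1).factorial *
      ∑ s ∈ Finset.range (n + 1), coreWeight n l (1 + 18 * 0) s := by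
    have h3 := fatWeight_pos g l (by omega)
    have h4 : 0 < ∑ s ∈ Finset.range (n + 1), coreWeight n l (1 + 18 * 0) s := by
      refine Finset.sum_pos' (fun s _ => coreWeight_nonneg (by norm_num) s)
        ⟨n, Finset.self_mem_range_succ n, ?_⟩
      have h5 := forestWeight_self_pos n
      have h6 : (0 : ℝ) < l := by
        have : 0 < l := by omega
        exact_mod_cast this
      unfold coreWeight
      positivity
    positivity
  exact pos_of_mul_pos_right (h2.trans_le h1) (by positivity)

lemma sum_pow_deficiency_le {y : ℝ} (hy : 0 ≤ y) (hSn : S ≤ 1 / (32 * (2 + 18 * y)) * n) :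
    ∑ G ∈ (complexClass g n (n + l)).toFinite.toFinset, y ^ (2 * l - G.kernelVerts.ncard) ≤
      2 * Real.exp (12 * (9 + 18 * y) * (l ^ 2 / S)) *
        ((complexClass g n (n + l)).ncard : ℝ) := by
  have h := sum_complexClass_le (g := g) (n := n) (l := l) (by omega) (h := fun _ => 1)
    (fun _ => zero_le_one) hy
  simp only [one_mul] at h
  exact h.trans (sum_coreWeight_le_ncard hl hS0 hS hy hSn)

/-- The case `y = 1` of the sums over all deficiencies, that is `c = 19`, restricted to the tail of
the core order. The constant `324` is `12 * (9 + 18)`, the price of replacing weights by the size of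
the class. -/
lemma ncard_coreOrder_tail {δ : ℝ} (hδ : 0 < δ) (hδ1 : δ ≤ 1) (hlδ : 8 / δ ^ 2 ≤ l)
    (hSn : S ≤ δ / 640 * n) :
    ({G ∈ complexClass g n (n + l) | ¬ |(G.coreOrder : ℝ) - S| ≤ δ * S}.ncard : ℝ) ≤
      4 * Real.exp (324 * (l ^ 2 / S) - δ ^ 2 / 8 * l) *
        ((complexClass g n (n + l)).ncard : ℝ) := by
  classical
  have hn : (0 : ℝ) ≤ n := Nat.cast_nonneg n
  have h1 := sum_complexClass_le (g := g) (n := n) (l := l) (by omega)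
    (h := fun s => if ¬ |(s : ℝ) - S| ≤ δ * S then 1 else 0)
    (fun s => by split_ifs <;> norm_num) (zero_le_one)
  simp only [one_pow, mul_one, ite_mul, one_mul, zero_mul] at h1
  rw [← Finset.sum_filter, ← Finset.sum_filter, Finset.sum_const, nsmul_eq_mul, mul_one] at h1
  have h2 := sum_coreWeight_tail (n := n) (l := l) (δ := δ) (c := 1 + 18) (S := S) hδ hδ1
    (by norm_num) hlδ hS0 hS (hSn.trans (by
      rw [div_mul_eq_mul_div, div_mul_eq_mul_div]
      have : 0 ≤ δ * n := by positivity
      norm_num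
      linarith))
  have h3 := sum_coreWeight_le_ncard (g := g) hl hS0 hS zero_le_one (hSn.trans (by
    norm_num
    nlinarith))
  have h0 := fatWeight_nonneg g l (2 * l)
  have e : {G ∈ complexClass g n (n + l) | ¬ |(G.coreOrder : ℝ) - S| ≤ δ * S}.ncard =
      ((complexClass g n (n + l)).toFinite.toFinset.filter
        (fun G => ¬ |(G.coreOrder : ℝ) - S| ≤ δ * S)).card := by
    rw [← Set.ncard_coe_finset]
    congr 1
    ext G
    simp
  rw [e]
  calc _ ≤ _ := h1
    _ ≤ fatWeight g l (2 * l) / (3 * l - 1).factorial * (2 * Real.exp (-(δ ^ 2 / 8 * l)) *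
        ∑ s ∈ Finset.range (n + 1), coreWeight n l (1 + 18) s) := by gcongr
    _ = 2 * Real.exp (-(δ ^ 2 / 8 * l)) * (fatWeight g l (2 * l) / (3 * l - 1).factorial *
        ∑ s ∈ Finset.range (n + 1), coreWeight n l (1 + 18 * 1) s) := by
        rw [mul_one]; ring
    _ ≤ 2 * Real.exp (-(δ ^ 2 / 8 * l)) * (2 * Real.exp (12 * (9 + 18 * 1) * (l ^ 2 / S)) *
        ((complexClass g n (n + l)).ncard : ℝ)) := by gcongr
    _ = _ := by
        rw [sub_eq_add_neg, Real.exp_add]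
        norm_num
        ring

/-- Markov's inequality for a power of the deficiency. -/
lemma ncard_deficiency_tail {y Y : ℝ} (hy : 0 ≤ y) (hY : 0 < Y)
    (hSn : S ≤ 1 / (32 * (2 + 18 * y)) * n) {P : SimpleGraph (Fin n) → Prop}
    (hP : ∀ G ∈ complexClass g n (n + l), ¬ P G → Y ≤ y ^ (2 * l - G.kernelVerts.ncard)) :
    ({G ∈ complexClass g n (n + l) | ¬ P G}.ncard : ℝ) ≤
      2 * Real.exp (12 * (9 + 18 * y) * (l ^ 2 / S)) / Y *
        ((complexClass g n (n + l)).ncard : ℝ) := by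
  classical
  have h1 := sum_pow_deficiency_le (g := g) hl hS0 hS hy hSn
  have e : {G ∈ complexClass g n (n + l) | ¬ P G}.ncard =
      ((complexClass g n (n + l)).toFinite.toFinset.filter (fun G => ¬ P G)).card := by
    rw [← Set.ncard_coe_finset]
    congr 1
    ext G
    simp
  rw [e, div_mul_eq_mul_div, le_div_iff₀ hY]
  refine le_trans ?_ h1
  rw [← nsmul_eq_mul]
  refine (Finset.card_nsmul_le_sum _ _ _ fun G hG => ?_).trans
    (Finset.sum_le_sum_of_subset_of_nonneg (Finset.filter_subset _ _)
      fun G _ _ => by positivity)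
  rw [Finset.mem_filter, Set.Finite.mem_toFinset] at hG
  exact hP G hG.1 hG.2

end Bounds

end SimpleGraph

lemma complexProb_le_one (g n m : ℕ) (P : SimpleGraph (Fin n) → Prop) :
    complexProb g n m P ≤ 1 := by
  unfold complexProb
  apply div_le_one_of_le₀ _ (Nat.cast_nonneg _)
  exact Nat.cast_le.2 (Set.ncard_le_ncard (Set.sep_subset _ _) (Set.toFinite _))

lemma one_sub_le_complexProb {g n m : ℕ} {P : SimpleGraph (Fin n) → Prop} {B : ℝ}
    (hpos : (0 : ℝ) < (complexClass g n m).ncard)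
    (h : ({G ∈ complexClass g n m | ¬ P G}.ncard : ℝ) ≤ B * ((complexClass g n m).ncard : ℝ)) :
    1 - B ≤ complexProb g n m P := by
  have h1 : (complexClass g n m).ncard = {G ∈ complexClass g n m | P G}.ncard +
      {G ∈ complexClass g n m | ¬ P G}.ncard := by
    rw [← Set.ncard_union_eq]
    · congr 1
      ext G
      by_cases hP : P G <;> simp [hP]
    · rw [Set.disjoint_left]
      exact fun G h1 h2 => h2.2 h1.2
  have h2 : ((complexClass g n m).ncard : ℝ) = {G ∈ complexClass g n m | P G}.ncard +
      {G ∈ complexClass g n m | ¬ P G}.ncard := by exact_mod_cast h1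
  unfold complexProb
  rw [le_div_iff₀ hpos]
  linarith

/-! ### Asymptotics -/

lemma sq_div_sqrt_le {n l : ℕ} :
    (l : ℝ) ^ 2 / √(3 * (n : ℝ) * (l : ℝ)) ≤ √((l : ℝ) ^ 3 / (n : ℝ)) := by
  rcases Nat.eq_zero_or_pos n with rfl | hn
  · simp
  rcases Nat.eq_zero_or_pos l with rfl | hl
  · simp
  have hn0 : (0 : ℝ) < n := by exact_mod_cast hn
  have hl0 : (0 : ℝ) < l := by exact_mod_cast hl
  apply Real.le_sqrt_of_sq_le
  rw [div_pow, Real.sq_sqrt (by positivity), div_le_div_iff₀ (by positivity) hn0]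
  have : 0 ≤ (l : ℝ) ^ 4 * n := by positivity
  nlinarith

/-! ### Limits along sequences with l = o(n). -/

section Sequences

variable {ε : ℕ → ℝ} (hε : Tendsto ε atTop (𝓝 0)) {n l : ℕ → ℕ} (hn : Tendsto n atTop atTop)
  (hl : Tendsto l atTop atTop) (hnl : ∀ᶠ k in atTop, (l k : ℝ) ≤ ε (n k) * (n k : ℝ))
include hε hn hl hnl

lemma eventually_sqrt_le {η : ℝ} (hη : 0 < η) : ∀ᶠ k in atTop, 64 ≤ l k ∧
    0 < √(3 * (n k : ℝ) * (l k : ℝ)) ∧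
    √(3 * (n k : ℝ) * (l k : ℝ)) ^ 2 = 3 * (n k : ℝ) * (l k : ℝ) ∧
    √(3 * (n k : ℝ) * (l k : ℝ)) ≤ η * n k := by
  have h1 : ∀ᶠ k in atTop, ε (n k) < η ^ 2 / 3 :=
    (hε.comp hn).eventually_lt_const (by positivity)
  filter_upwards [h1, hn.eventually_ge_atTop 1, hl.eventually_ge_atTop 64, hnl] with k h1 h2 h3 h4
  have hn0 : (0 : ℝ) < n k := by exact_mod_cast h2
  have hl0 : (0 : ℝ) < l k := by
    have : 0 < l k := by omega
    exact_mod_cast this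
  refine ⟨h3, by positivity, Real.sq_sqrt (by positivity), ?_⟩
  apply Real.sqrt_le_iff.2 ⟨by positivity, ?_⟩
  have h5 : (l k : ℝ) ≤ η ^ 2 / 3 * n k := h4.trans (by gcongr)
  calc 3 * (n k : ℝ) * l k ≤ 3 * n k * (η ^ 2 / 3 * n k) := by gcongr
    _ = _ := by ring

lemma tendsto_coreOrder (g : ℕ) {δ : ℝ} (hδ : 0 < δ) :
    Tendsto (fun k => complexProb g (n k) (n k + l k) fun G =>
      |(G.coreOrder : ℝ) - √(3 * (n k : ℝ) * (l k : ℝ))| ≤ δ * √(3 * (n k : ℝ) * (l k : ℝ)))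
      atTop (𝓝 1) := by
  wlog hδ1 : δ ≤ 1 generalizing δ
  · refine tendsto_of_tendsto_of_tendsto_of_le_of_le (this one_pos le_rfl) tendsto_const_nhds
      (fun k => ?_) fun k => complexProb_le_one _ _ _ _
    refine div_le_div_of_nonneg_right (Nat.cast_le.2 (Set.ncard_le_ncard ?_ (Set.toFinite _)))
      (Nat.cast_nonneg _)
    rintro G ⟨h1, h2⟩
    refine ⟨h1, h2.trans ?_⟩
    gcongr
    exact (not_le.1 hδ1).le
  have hB : Tendsto (fun k => 1 - 4 * Real.exp (-(δ ^ 2 / 16 * l k))) atTop (𝓝 1) := by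
    have h1 : Tendsto (fun k => δ ^ 2 / 16 * (l k : ℝ)) atTop atTop :=
      (tendsto_natCast_atTop_atTop.comp hl).const_mul_atTop (by positivity)
    have h2 := (Real.tendsto_exp_neg_atTop_nhds_zero.comp h1).const_mul 4
    simpa using h2.const_sub 1
  refine tendsto_of_tendsto_of_tendsto_of_le_of_le' hB tendsto_const_nhds ?_
    (Eventually.of_forall fun k => complexProb_le_one _ _ _ _)
  have hlδ : ∀ᶠ k in atTop, 8 / δ ^ 2 ≤ (l k : ℝ) :=
    (tendsto_natCast_atTop_atTop.comp hl).eventually_ge_atTop _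
  filter_upwards [eventually_sqrt_le hε hn hl hnl (show 0 < δ / 640 by positivity),
    eventually_sqrt_le hε hn hl hnl (show 0 < 3 * (δ ^ 2 / 16) / 324 by positivity), hlδ]
    with k ⟨h1, h2, h3, h4⟩ ⟨_, _, _, h5⟩ h6
  have hn0 : (0 : ℝ) ≤ n k := Nat.cast_nonneg _
  refine le_trans ?_ (one_sub_le_complexProb (SimpleGraph.ncard_complexClass_pos h1 h2 h3 ?_)
    (SimpleGraph.ncard_coreOrder_tail h1 h2 h3 hδ hδ1 h6 h4))
  · gcongr
    set S := √(3 * (n k : ℝ) * (l k : ℝ))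
    -- Since `S² = 3nl`, smallness of `S/n` means smallness of `l/S`, so the loss uses up at most
    -- half of the exponent `δ² l / 8`.
    have h7 : 324 * ((l k : ℝ) ^ 2 / S) ≤ δ ^ 2 / 16 * l k := by
      have h8 : 324 * (l k : ℝ) ≤ δ ^ 2 / 16 * S := by
        have h9 : S * S ≤ S * (3 * (δ ^ 2 / 16) / 324 * n k) := by gcongr
        have hn1 : (0 : ℝ) < n k := by
          by_contra h
          have h0 : (n k : ℝ) = 0 := le_antisymm (not_lt.1 h) hn0
          rw [h0, mul_zero] at h5
          linarith
        have h10 : (n k : ℝ) * (324 * l k) ≤ n k * (δ ^ 2 / 16 * S) := by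
          rw [sq] at h3
          rw [h3] at h9
          linarith
        exact le_of_mul_le_mul_left h10 hn1
      rw [← mul_div_assoc, div_le_iff₀ h2]
      have hl0 : (0 : ℝ) ≤ l k := Nat.cast_nonneg _
      nlinarith
    linarith
  · refine h4.trans ?_
    gcongr ?_ * _
    linarith

/-- A lower bound for the probability of events that fail only if the deficiency is large. -/
lemma eventually_le_complexProb (g : ℕ) {y₀ : ℝ} (hy₀ : 0 ≤ y₀) {Y : ℕ → ℝ}
    (hY : ∀ k, 0 < Y k) {P : ∀ k, SimpleGraph (Fin (n k)) → Prop}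
    (hP : ∀ k, ∀ G ∈ complexClass g (n k) (n k + l k), ¬ P k G →
      Y k ≤ y₀ ^ G.deficiency.toNat) :
    ∀ᶠ k in atTop, 1 - 2 * Real.exp (12 * (9 + 18 * y₀) * √((l k : ℝ) ^ 3 / (n k : ℝ))) / Y k ≤
      complexProb g (n k) (n k + l k) (P k) := by
  filter_upwards [eventually_sqrt_le hε hn hl hnl (show 0 < 1 / (32 * (2 + 18 * y₀)) by positivity)]
    with k ⟨h1, h2, h3, h4⟩
  have hn0 : (0 : ℝ) ≤ n k := Nat.cast_nonneg _
  refine le_trans ?_ (one_sub_le_complexProb (SimpleGraph.ncard_complexClass_pos h1 h2 h3 ?_)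
    (SimpleGraph.ncard_deficiency_tail h1 h2 h3 hy₀ (hY k) h4 fun G hG hPG => ?_))
  · have := hY k
    gcongr
    exact sq_div_sqrt_le
  · refine h4.trans ?_
    gcongr ?_ * _
    rw [div_le_div_iff₀ (by positivity) (by norm_num)]
    linarith
  · have := hP k G hG hPG
    rwa [SimpleGraph.deficiency_eq_of_mem hG, Int.toNat_natCast] at this

lemma tendsto_deficiency_eq_zero (g : ℕ)
    (hμ : Tendsto (fun k => √((l k : ℝ) ^ 3 / (n k : ℝ))) atTop (𝓝 0)) :
    Tendsto (fun k => complexProb g (n k) (n k + l k) fun G => G.deficiency = 0)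
      atTop (𝓝 1) := by
  rw [tendsto_order]
  refine ⟨fun a ha => ?_, fun a ha => Eventually.of_forall fun k =>
    (complexProb_le_one _ _ _ _).trans_lt ha⟩
  -- In the limit the failure probability is at most `2 / y`, and this choice makes it smaller than
  -- `1 - a`.
  set y : ℝ := 1 + 4 / (1 - a) with hy
  have ha' : 0 < 1 - a := by linarith
  have hy1 : 1 ≤ y := by rw [hy]; have : 0 < 4 / (1 - a) := by positivity
                         linarith
  have hlim : Tendsto (fun k => 1 - 2 * Real.exp (12 * (9 + 18 * y) *
      √((l k : ℝ) ^ 3 / (n k : ℝ))) / y) atTop (𝓝 (1 - 2 * Real.exp (12 * (9 + 18 * y) * 0) / y)) :=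
    (((Real.continuous_exp.tendsto _).comp (hμ.const_mul _)).const_mul 2 |>.div_const y).const_sub 1
  have hlt : a < 1 - 2 * Real.exp (12 * (9 + 18 * y) * 0) / y := by
    rw [mul_zero, Real.exp_zero, mul_one, lt_sub_comm, div_lt_iff₀ (by linarith), hy]
    have : (1 - a) * (1 + 4 / (1 - a)) = 1 - a + 4 := by field_simp
    linarith
  have hP := eventually_le_complexProb hε hn hl hnl g (y₀ := y) (by linarith) (Y := fun _ => y)
    (fun _ => by linarith) (P := fun k G => G.deficiency = 0) ?_
  · filter_upwards [hP, hlim.eventually_const_lt hlt] with k h1 h2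
    exact h2.trans_le h1
  · intro k G hG hne
    apply le_self_pow₀ hy1
    rw [SimpleGraph.deficiency_eq_of_mem hG] at hne ⊢
    rw [Int.toNat_natCast]
    exact_mod_cast hne

/-- Markov's inequality with base `y = e`, which turns a bound on the deficiency into an additive
term of the exponent. -/
lemma eventually_le_exp_deficiency (g : ℕ) (D : ℕ → ℝ) :
    ∀ᶠ k in atTop, 1 - 2 * Real.exp (12 * (9 + 18 * Real.exp 1) * √((l k : ℝ) ^ 3 / (n k : ℝ))) /
      Real.exp (D k) ≤ complexProb g (n k) (n k + l k) fun G => |(G.deficiency : ℝ)| ≤ D k := by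
  refine eventually_le_complexProb hε hn hl hnl g (Real.exp_pos 1).le (fun k => Real.exp_pos (D k))
    fun k G hG hD => ?_
  rw [← Real.exp_nat_mul, mul_one]
  apply Real.exp_le_exp.2
  rw [SimpleGraph.deficiency_eq_of_mem hG, Int.cast_natCast, Nat.abs_cast, not_le] at hD
  rw [SimpleGraph.deficiency_eq_of_mem hG, Int.toNat_natCast]
  exact hD.le

end Sequences

lemma cube_root_pow (n : ℕ) : ((n : ℝ) ^ (1 / 3 : ℝ)) ^ 3 = n := by
  rw [← Real.rpow_natCast, ← Real.rpow_mul (Nat.cast_nonneg n)]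
  norm_num

theorem corollary4p10 (g : ℕ) (ε : ℕ → ℝ) (hε : Tendsto ε atTop (𝓝 0)) :
    ∃ c : ℝ, 0 < c ∧ ∀ n l : ℕ → ℕ, Tendsto n atTop atTop → Tendsto l atTop atTop →
      (∀ᶠ k in atTop, (l k : ℝ) ≤ ε (n k) * (n k : ℝ)) →
      (∀ δ : ℝ, 0 < δ →
        Tendsto (fun k => complexProb g (n k) (n k + l k) fun G =>
          |(G.coreOrder : ℝ) - √(3 * (n k : ℝ) * (l k : ℝ))| ≤ δ * √(3 * (n k : ℝ) * (l k : ℝ)))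
          atTop (𝓝 1)) ∧
      ((fun k => (l k : ℝ)) =o[atTop] (fun k => (n k : ℝ) ^ (1 / 3 : ℝ)) →
        Tendsto (fun k => complexProb g (n k) (n k + l k) fun G => G.deficiency = 0)
          atTop (𝓝 1)) ∧
      ((fun k => (l k : ℝ)) =Θ[atTop] (fun k => (n k : ℝ) ^ (1 / 3 : ℝ)) →
        ∀ η : ℝ, 0 < η → ∃ C : ℝ, 0 < C ∧ ∀ᶠ k in atTop,
          1 - η ≤ complexProb g (n k) (n k + l k) fun G => |(G.deficiency : ℝ)| ≤ C) ∧
      ((fun k => (n k : ℝ) ^ (1 / 3 : ℝ)) =o[atTop] (fun k => (l k : ℝ)) →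
        Tendsto (fun k => complexProb g (n k) (n k + l k) fun G =>
          |(G.deficiency : ℝ)| ≤ c * √((l k : ℝ) ^ 3 / (n k : ℝ))) atTop (𝓝 1)) := by
  set A : ℝ := 12 * (9 + 18 * Real.exp 1) with hA
  have hA0 : 0 < A := by positivity
  -- With `c = A + 1` the failure probability in the last case is at most `2 exp (Aμ - (A + 1)μ) = 2
  -- exp (-μ)` for `μ = √(l³/n) → ∞`. The constant is absolute.
  refine ⟨A + 1, by positivity, fun n l hn hl hnl => ⟨fun δ hδ =>
    tendsto_coreOrder hε hn hl hnl g hδ, fun h => ?_, fun h η hη => ?_, fun h => ?_⟩⟩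
  · refine tendsto_deficiency_eq_zero hε hn hl hnl g ?_
    have h1 := (h.tendsto_div_nhds_zero.pow 3).sqrt
    rw [zero_pow (by norm_num), Real.sqrt_zero] at h1
    refine h1.congr fun k => ?_
    rw [div_pow, cube_root_pow]
  · obtain ⟨M, hM, hb⟩ := h.1.exists_pos
    set B : ℝ := A * √(M ^ 3) with hB
    have hB0 : 0 ≤ B := by positivity
    -- Here `B` bounds the exponent `Aμ`, and the logarithm turns the factor `2` of the moment bound
    -- into `η`. The absolute value and the `1` make the constant positive.
    refine ⟨B + |Real.log (2 / η)| + 1, by positivity, ?_⟩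
    filter_upwards [eventually_le_exp_deficiency hε hn hl hnl g
      (fun _ => B + |Real.log (2 / η)| + 1), hb.bound, hn.eventually_ge_atTop 1] with k h1 h2 h3
    refine le_trans ?_ h1
    have hn0 : (0 : ℝ) < n k := by exact_mod_cast h3
    have hμ : √((l k : ℝ) ^ 3 / (n k : ℝ)) ≤ √(M ^ 3) := by
      apply Real.sqrt_le_sqrt
      rw [div_le_iff₀ hn0]
      rw [Real.norm_of_nonneg (Nat.cast_nonneg _), Real.norm_of_nonneg (by positivity)] at h2
      calc (l k : ℝ) ^ 3 ≤ (M * (n k : ℝ) ^ (1 / 3 : ℝ)) ^ 3 := by gcongr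
        _ = _ := by rw [mul_pow, cube_root_pow]
    have h4 : 2 * Real.exp (A * √((l k : ℝ) ^ 3 / (n k : ℝ))) ≤
        η * Real.exp (B + |Real.log (2 / η)| + 1) := by
      calc 2 * Real.exp (A * √((l k : ℝ) ^ 3 / (n k : ℝ))) ≤ 2 * Real.exp B := by
            rw [hB]; gcongr
        _ = η * (Real.exp B * Real.exp (Real.log (2 / η))) := by
            rw [Real.exp_log (by positivity)]; field_simp
        _ ≤ η * Real.exp (B + |Real.log (2 / η)| + 1) := by
            rw [← Real.exp_add]
            apply mul_le_mul_of_nonneg_left _ hη.le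
            apply Real.exp_le_exp.2
            linarith [le_abs_self (Real.log (2 / η))]
    have h5 := (div_le_iff₀ (Real.exp_pos (B + |Real.log (2 / η)| + 1))).2 h4
    linarith
  · have hμ : Tendsto (fun k => √((l k : ℝ) ^ 3 / (n k : ℝ))) atTop atTop := by
      have h1 : Tendsto (fun k => (n k : ℝ) ^ (1 / 3 : ℝ) / (l k : ℝ)) atTop (𝓝[>] 0) := by
        rw [tendsto_nhdsWithin_iff]
        refine ⟨h.tendsto_div_nhds_zero, ?_⟩
        filter_upwards [hn.eventually_ge_atTop 1, hl.eventually_ge_atTop 1] with k h1 h2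
        have hn0 : (0 : ℝ) < n k := by exact_mod_cast h1
        have hl0 : (0 : ℝ) < l k := by exact_mod_cast h2
        exact div_pos (Real.rpow_pos_of_pos hn0 _) hl0
      have h2 := Real.tendsto_sqrt_atTop.comp
        ((tendsto_pow_atTop (by norm_num : (3 : ℕ) ≠ 0)).comp h1.inv_tendsto_nhdsGT_zero)
      refine h2.congr fun k => ?_
      simp only [Function.comp_apply, Pi.inv_apply, inv_div, div_pow, cube_root_pow]
    have hlim : Tendsto (fun k => 1 - 2 * Real.exp (-√((l k : ℝ) ^ 3 / (n k : ℝ)))) atTop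
        (𝓝 1) := by
      have h2 := (Real.tendsto_exp_neg_atTop_nhds_zero.comp hμ).const_mul 2
      simpa using h2.const_sub 1
    refine tendsto_of_tendsto_of_tendsto_of_le_of_le' hlim tendsto_const_nhds ?_
      (Eventually.of_forall fun k => complexProb_le_one _ _ _ _)
    filter_upwards [eventually_le_exp_deficiency hε hn hl hnl g
      (fun k => (A + 1) * √((l k : ℝ) ^ 3 / (n k : ℝ)))] with k h1
    refine le_trans (le_of_eq ?_) h1
    rw [mul_div_assoc, ← Real.exp_sub]
    congr 3
    ring
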